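/- **Theorem 1.** *Network.* Consider $K\ge 1$ tiers of base stations (BSs). The BSs of tier $k$ form independent homogeneous planar Poisson point processes (PPPs) of intensity $\lambda_k>0$; they transmit with power $P_{\rm d}^{(k)}>0$ and have bias factor $\tau_k>0$. A user (UE) at the origin, with nearest tier-$k$ BS at distance $r_k$, connects to the nearest BS of tier $i$ if $\tau_i r_i<\tau_k r_k$ for all $k\ne i$; then $r_o=r_i$ is its serving distance. A UE of tier $k$ at serving distance $r$ transmits with power $\min(\rho^{(k)}r^{\eta_{\rm dd}},P_{\rm u})$; it is a cell-centre user (CCU, superscript $c$) if $\rho^{(k)}r^{\eta_{\rm dd}}\le P_{\rm u}$ and a cell-edge user (CEU, superscript $e$) otherwise ($\rho^{(k)},P_{\rm u}>0$). The path-loss exponents are $\eta_{\rm dd}=\eta_{\rm uu}$ (BS–UE), $\eta_{\rm du}$ (BS–BS), $\eta_{\rm ud}$ (UE–UE), all $>2$. All fading gains are i.i.d. exponential with mean one. The noise power is $N_o\ge0$. The self-interference gain $h_{\rm s}\ge 0$ has an arbitrary law $F_{H_{\rm s}}$ of mean one (with $f_{H_{\rm s}}(h)\,dh$ read as $F_{H_{\rm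 s}}(dh)$), and $\beta_{\rm u}^{(i)},\beta_{\rm d}>0$. Tier $k$ has duplexing parameter $\alpha_k\in[0,1]$ and uses on link $v\in\{{\rm u},{\rm d}\}$ (the other link being $\bar v$) a time-limited unit-energy pulse with spectrum $S_v^{(k)}$, centre frequency $f_v^{(k)}$ and bandwidth $B_v(\alpha_k)=B_v^{\rm HD}+\alpha_k(\epsilon+1)\min(B_{\rm d}^{\rm HD},B_{\rm u}^{\rm HD})$, where $B_v^{\rm HD}>0$ and $\epsilon\ge0$. Put $$J_{vw}(i,k)=\int_{-B_v(\alpha_i)/2}^{B_v(\alpha_i)/2}\overline{S_v^{(i)}(f)}\,S_w^{(k)}(f-f_w^{(k)}+f_v^{(i)})\,df,$$ $$|\tilde{\mathcal I}_v(\alpha_i,\alpha_k)|^2=\frac{|J_{vv}(i,k)|^2}{|J_{vv}(i,i)|^2},\qquad |\tilde{\mathcal C}_v(\alpha_i,\alpha_k)|^2=\frac{|J_{v\bar v}(i,k)|^2}{|J_{vv}(i,i)|^2}.$$ *Test link and tractability assumptions.* The test UE is connected to tier $i$. For the uplink (UL) the receiver is its BS, for the downlink (DL) it is the UE. The interfering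 UEs of tier $k$, seen from the receiver, form a PPP of intensity $\lambda_k$; these processes are mutually independent and independent of the BSs. Their powers $P^{(k)}_{\rm u}$ are i.i.d. with the law of the transmit power of a UE connected to tier $k$. An interfering UE of tier $k$ and power $P$ contributes only if its distance from the receiver exceeds $a$, where $a=(P/\rho^{(k)})^{1/\eta}$ if the test UE is a CCU ($\eta=\eta_{\rm uu}$ in the UL, $\eta_{\rm ud}$ in the DL) and $a=r_o$ if it is a CEU. In the DL the interfering BSs are all BSs except the serving one. In the UL, the interfering BSs of tier $k$, seen from the test BS, form a PPP of intensity $\lambda_k$ on the whole plane, independent of $r_o$ and of everything else. BS–UE links use exponent $\eta_{\rm dd}$, BS–BS links $\eta_{\rm du}$, UE–UE links $\eta_{\rm ud}$. In the two-node topology (2NT, full-duplex UEs) both ends suffer self-interference. In the three-node topology (3NT, half-duplex UEs) only the BS does, and the test UE suffers interference from a second UE of its cell, whose distance from the BS is independently distributed as the serving distance of a UE connected to tier $i$, the angle between the two UEs being uniform on $(\delta_o,\pi)$, $0\le\delta_o<\pi$. The SINR is the received signal power divided by the sum of: the interference powers from tier $k$, weighted by $|\tilde{\mathcal I}_v(\alpha_i,\alpha_k)|^2$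 (same link direction) or $|\tilde{\mathcal C}_v(\alpha_i,\alpha_k)|^2$ (opposite direction, including, with $k=i$, the second UE of the cell); the self-interference, which is $\beta_{\rm u}^{(i)}h_{\rm s}P_{\rm d}^{(i)}|\tilde{\mathcal C}_{\rm u}(\alpha_i,\alpha_i)|^2$ in the UL, $\beta_{\rm d}h_{\rm s}P_{{\rm u}_o}|\tilde{\mathcal C}_{\rm d}(\alpha_i,\alpha_i)|^2$ in the DL of 2NT ($P_{{\rm u}_o}$ being the transmit power of the test UE) and $0$ in the DL of 3NT; and $N_o$. The outage probability $\mathcal O(\theta)$ is the conditional probability of ${\rm SINR}<\theta$ given the tier and the class of the test UE. *Notation.* Let $\bar\lambda_i=\sum_k\frac{\tau_i^2}{\tau_k^2}\lambda_k$, $R_i=(P_{\rm u}/\rho^{(i)})^{1/\eta_{\rm dd}}$, $p_e^{(i)}=e^{-\pi\bar\lambda_iR_i^2}$, $p_c^{(i)}=1-p_e^{(i)}$, $$f_{R_c^{(i)}}(r)=\frac{2\pi\bar\lambda_i r e^{-\pi\bar\lambda_i r^2}}{p_c^{(i)}}\mathbf 1_{0\le r\le R_i},\qquad f_{R_e^{(i)}}(r)=2\pi\bar\lambda_i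 r e^{-\pi\bar\lambda_i r^2+\pi\bar\lambda_iR_i^2}\mathbf 1_{r>R_i},$$ $F_\eta(y)={}_2F_1(1,1-\frac2\eta;2-\frac2\eta;-y)$ for $y\ge 0$ (analytically continued), and, with $\gamma$ the lower incomplete gamma function, $$m_k(\zeta)=\mathbb E[(P_{\rm u}^{(k)})^\zeta]=\frac{(\rho^{(k)})^\zeta\,\gamma\big(\tfrac{\zeta\eta_{\rm dd}}2+1,\pi\bar\lambda_kR_k^2\big)}{(\pi\bar\lambda_k)^{\zeta\eta_{\rm dd}/2}}+P_{\rm u}^\zeta\, p_e^{(k)}.$$ For a function $g$, $$\mathbb E[g(P_{\rm u}^{(k)})]=\int_0^{R_k}g(\rho^{(k)}r^{\eta_{\rm dd}})\,2\pi\bar\lambda_k r e^{-\pi\bar\lambda_kr^2}dr+g(P_{\rm u})\,p_e^{(k)}.$$ Put $$A_k^\eta(s)=\exp\Big(-\tfrac{2\pi\lambda_k(\rho^{(k)})^{1-2/\eta}}{\eta-2}\,m_k(\tfrac2\eta)\,s\,F_\eta(\rho^{(k)}s)\Big),$$ $$E_k^\eta(s,r)=\exp\Big(-\tfrac{2\pi\lambda_k}{\eta-2}\,\mathbb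 E\big[r^{2-\eta}P_{\rm u}^{(k)}s\,F_\eta(P_{\rm u}^{(k)}s\,r^{-\eta})\big]\Big),$$ $$\underline E_k^\eta(s,r)=\exp\Big(-\tfrac{2\pi\lambda_k}{\eta-2}\,r^{2-\eta}m_k(1)\,s\,F_\eta(m_k(1)\,s\,r^{-\eta})\Big),$$ $$D_k(s)=\exp\Big(-\tfrac{2\pi^2\lambda_k}{\eta_{\rm du}}(sP_{\rm d}^{(k)})^{2/\eta_{\rm du}}\csc\tfrac{2\pi}{\eta_{\rm du}}\Big),$$ $$G_{k,i}(s,r)=\exp\Big(-\tfrac{2\pi\lambda_k}{\eta_{\rm dd}-2}\big(\tfrac{r\tau_i}{\tau_k}\big)^{2-\eta_{\rm dd}}sP_{\rm d}^{(k)}F_{\eta_{\rm dd}}\big((\tfrac{r\tau_i}{\tau_k})^{-\eta_{\rm dd}}P_{\rm d}^{(k)}s\big)\Big).$$ Let $U_1^{(k,i)}(r_o,s)=1$, except that in 3NT $$U_1^{(i,i)}(r_o,s)=\int_0^{R_i}\!\int_{\delta_o}^{\pi}\frac{p_c^{(i)}f_{R_c^{(i)}}(r)}{1+s\rho^{(i)}r^{\eta_{\rm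 dd}}q^{-\eta_{\rm ud}/2}}\frac{d\delta\,dr}{\pi-\delta_o}+\int_{R_i}^\infty\!\int_{\delta_o}^{\pi}\frac{p_e^{(i)}f_{R_e^{(i)}}(r)}{1+sP_{\rm u}q^{-\eta_{\rm ud}/2}}\frac{d\delta\,dr}{\pi-\delta_o},$$ where $q=r^2+r_o^2-2r_or\cos\delta$. Finally $$U_{{\rm SI_u}}^{(i)}(x)=\int_0^\infty e^{-x\beta_{\rm u}^{(i)}hP_{\rm d}^{(i)}|\tilde{\mathcal C}_{\rm u}(\alpha_i,\alpha_i)|^2}f_{H_{\rm s}}(h)\,dh,$$ and $U_{{\rm SI_d}}^{(i)}(x)=\int_0^\infty e^{-x\beta_{\rm d}h|\tilde{\mathcal C}_{\rm d}(\alpha_i,\alpha_i)|^2}f_{H_{\rm s}}(h)\,dh$ in 2NT, $U_{{\rm SI_d}}^{(i)}=1$ in 3NT. *Claim.* In 2NT and in 3NT, for every tier $i$ and every $\theta>0$, with $s_{k}=\frac{\theta|\tilde{\mathcal I}_{\rm u}(\alpha_i,\alpha_k)|^2}{\rho^{(i)}}$, $s'_{k}=\frac{\theta|\tilde{\mathcal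 C}_{\rm u}(\alpha_i,\alpha_k)|^2}{\rho^{(i)}}$, $t_k(r)=\frac{r^{\eta_{\rm uu}}\theta|\tilde{\mathcal I}_{\rm u}(\alpha_i,\alpha_k)|^2}{P_{\rm u}}$, $t'_k(r)=\frac{r^{\eta_{\rm uu}}\theta|\tilde{\mathcal C}_{\rm u}(\alpha_i,\alpha_k)|^2}{P_{\rm u}}$, $u_k(r)=\frac{r^{\eta_{\rm dd}}\theta|\tilde{\mathcal I}_{\rm d}(\alpha_i,\alpha_k)|^2}{P_{\rm d}^{(i)}}$, $u'_k(r)=\frac{r^{\eta_{\rm dd}}\theta|\tilde{\mathcal C}_{\rm d}(\alpha_i,\alpha_k)|^2}{P_{\rm d}^{(i)}}$: $$\mathcal O_{{\rm u}^c}^{(i)}(\theta)=1-e^{-N_o\theta/\rho^{(i)}}\,U_{\rm SI_u}^{(i)}\big(\tfrac{\theta}{\rho^{(i)}}\big)\prod_{k=1}^KA_k^{\eta_{\rm uu}}(s_k)\,D_k(s'_k),$$ $$\mathcal O_{{\rm u}^e}^{(i)}(\theta)=1-\int_{R_i}^\infty e^{-N_or^{\eta_{\rm uu}}\theta/P_{\rm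 u}}\,U_{\rm SI_u}^{(i)}\big(\tfrac{\theta r^{\eta_{\rm uu}}}{P_{\rm u}}\big)f_{R_e^{(i)}}(r)\prod_{k=1}^KE_k^{\eta_{\rm uu}}(t_k(r),r)\,D_k(t'_k(r))\,dr,$$ $$\mathcal O_{{\rm d}^c}^{(i)}(\theta)=1-\int_0^{R_i} e^{-N_or^{\eta_{\rm dd}}\theta/P_{\rm d}^{(i)}}\,U_{\rm SI_d}^{(i)}\big(\tfrac{\theta\rho^{(i)}r^{2\eta_{\rm dd}}}{P_{\rm d}^{(i)}}\big)f_{R_c^{(i)}}(r)\prod_{k=1}^KG_{k,i}(u_k(r),r)\,A_k^{\eta_{\rm ud}}(u'_k(r))\,U_1^{(k,i)}(r,u'_k(r))\,dr,$$ $$\mathcal O_{{\rm d}^e}^{(i)}(\theta)=1-\int_{R_i}^\infty e^{-N_or^{\eta_{\rm dd}}\theta/P_{\rm d}^{(i)}}\,U_{\rm SI_d}^{(i)}\big(\tfrac{\theta P_{\rm u}r^{\eta_{\rm dd}}}{P_{\rm d}^{(i)}}\big)f_{R_e^{(i)}}(r)\prod_{k=1}^KG_{k,i}(u_k(r),r)\,E_k^{\eta_{\rm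 ud}}(u'_k(r),r)\,U_1^{(k,i)}(r,u'_k(r))\,dr.$$ Moreover, replacing $E_k^{\eta}$ by $\underline E_k^{\eta}$ in the formulas for $\mathcal O_{{\rm u}^e}^{(i)}$ and $\mathcal O_{{\rm d}^e}^{(i)}$ gives upper bounds of these outage probabilities. -/

import Mathlib

open MeasureTheory ProbabilityTheory
open scoped ENNReal FourierTransform ComplexConjugate

namespace FDCellular

/-- The Euclidean plane in which base stations (BSs) and users (UEs) live. -/
abbrev Plane : Type := EuclideanSpace ℝ (Fin 2)

/-! ### Poisson point processes -/

/-- Number of points (with multiplicity, possibly infinite) of the random sequence `X` in `B`. -/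
noncomputable def pointCount {Ω : Type*} (X : ℕ → Ω → Plane) (B : Set Plane) (ω : Ω) : ℝ≥0∞ :=
  ∑' n, B.indicator (fun _ => (1 : ℝ≥0∞)) (X n ω)

/-- The random sequence `X` enumerates the points of a homogeneous Poisson point process of
intensity `c` (points per unit area) in the plane: counts of sets of finite area are Poisson with
mean `c` times the area, and counts of disjoint sets are independent. -/
structure IsHomogeneousPPP {Ω : Type*} [MeasurableSpace Ω] (X : ℕ → Ω → Plane) (c : ℝ)
    (μ : Measure Ω) : Prop where
  measurable : ∀ n, Measurable (X n)
  count_law : ∀ B : Set Plane, MeasurableSet B → volume B ≠ ∞ → ∀ m : ℕ,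
    μ {ω | pointCount X B ω = (m : ℝ≥0∞)} = poissonMeasure (c * volume.real B).toNNReal {m}
  count_indep : ∀ (l : ℕ) (B : Fin l → Set Plane), (∀ j, MeasurableSet (B j)) →
    Pairwise (fun a b => Disjoint (B a) (B b)) →
    iIndepFun (fun j => pointCount X (B j)) μ

/-! ### Special functions -/

/-- Gauss hypergeometric function `₂F₁(a, b; c; z)` for `0 < b < c` and real `z < 1`, through
Euler's integral. (The power series used by Mathlib's `ordinaryHypergeometric` diverges for
`z < -1`, and the function is needed on all of the negative axis.) -/
noncomputable def hyp2F1 (a b c z : ℝ) : ℝ :=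
  Real.Gamma c / (Real.Gamma b * Real.Gamma (c - b)) *
    ∫ t in (0 : ℝ)..1, t ^ (b - 1) * (1 - t) ^ (c - b - 1) * (1 - z * t) ^ (-a)

/-- Lower incomplete gamma function `γ(a, x)`. -/
noncomputable def lowerGamma (a x : ℝ) : ℝ :=
  ∫ t in (0 : ℝ)..x, t ^ (a - 1) * Real.exp (-t)

/-! ### Network parameters -/

/-- Link direction: downlink or uplink. -/
inductive Link
  | dl
  | ul

/-- The opposite direction. -/
def Link.other : Link → Link
  | .dl => .ul
  | .ul => .dl

/-- `twoNode` (2NT): full-duplex UEs; `threeNode` (3NT): half-duplex UEs. -/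
inductive Topology
  | twoNode
  | threeNode

/-- Cell-centre users (`ccu`) and cell-edge users (`ceu`). -/
inductive UserClass
  | ccu
  | ceu

/-- Deterministic parameters of a `K`-tier network. -/
structure Network (K : ℕ) where
  /-- BS intensity of each tier -/
  lam : Fin K → ℝ
  lam_pos : ∀ k, 0 < lam k
  /-- distance biasing factor of each tier -/
  tau : Fin K → ℝ
  tau_pos : ∀ k, 0 < tau k
  /-- BS transmit power of each tier -/
  pD : Fin K → ℝ
  pD_pos : ∀ k, 0 < pD k
  /-- maximal UE transmit power -/
  pU : ℝ
  pU_pos : 0 < pU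
  /-- target average received power of the uplink power control of each tier -/
  rho : Fin K → ℝ
  rho_pos : ∀ k, 0 < rho k
  /-- path-loss exponent between a BS and a UE, in both directions -/
  etaDD : ℝ
  etaDD_gt : 2 < etaDD
  /-- path-loss exponent between two BSs -/
  etaDU : ℝ
  etaDU_gt : 2 < etaDU
  /-- path-loss exponent between two UEs -/
  etaUD : ℝ
  etaUD_gt : 2 < etaUD
  /-- noise power -/
  noise : ℝ
  noise_nonneg : 0 ≤ noise
  /-- mean self-interference attenuation at the BSs of each tier -/
  betaU : Fin K → ℝ
  betaU_pos : ∀ k, 0 < betaU k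
  /-- mean self-interference attenuation at full-duplex UEs -/
  betaD : ℝ
  betaD_pos : 0 < betaD
  /-- law of the normalised self-interference power gain -/
  siLaw : Measure ℝ
  siLaw_prob : IsProbabilityMeasure siLaw
  siLaw_nonneg : ∀ᵐ h ∂siLaw, 0 ≤ h
  siLaw_mean : ∫ h, h ∂siLaw = 1
  /-- minimal separation angle of the two UEs scheduled by one BS in 3NT -/
  delta : ℝ
  delta_nonneg : 0 ≤ delta
  delta_lt : delta < Real.pi
  /-- half-duplex bandwidths -/
  bwHD : Link → ℝ
  bwHD_pos : ∀ v, 0 < bwHD v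
  /-- guard-band fraction -/
  guard : ℝ
  guard_nonneg : 0 ≤ guard
  /-- duplexing parameter of each tier -/
  alpha : Fin K → ℝ
  alpha_mem : ∀ k, alpha k ∈ Set.Icc (0 : ℝ) 1
  /-- centre frequency of the band used by each tier on each link -/
  freq : Link → Fin K → ℝ
  /-- pulse shape used by each tier on each link (at that tier's duplexing parameter):
  time-limited and of unit energy -/
  pulse : Link → Fin K → ℝ → ℂ
  pulse_timeLimited : ∀ v k, HasCompactSupport (pulse v k)
  pulse_memLp : ∀ v k, MemLp (pulse v k) 2 volume
  pulse_energy : ∀ v k, ∫ t, ‖pulse v k t‖ ^ 2 = 1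

namespace Network

variable {K : ℕ} (N : Network K)

/-! ### Pulse shaping and filtering factors -/

/-- Bandwidth `B_v(α_k) = B_v^HD + α_k (ε + 1) min(B_d^HD, B_u^HD)`. -/
noncomputable def bandwidth (v : Link) (k : Fin K) : ℝ :=
  N.bwHD v + N.alpha k * (N.guard + 1) * min (N.bwHD .dl) (N.bwHD .ul)

/-- Spectrum of the pulse of tier `k` on link `v`. -/
noncomputable def spectrum (v : Link) (k : Fin K) : ℝ → ℂ := 𝓕 (N.pulse v k)

/-- Signal of tier `k` on link `w`, after the matched and low-pass filter of a receiver of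
tier `i` on link `v`. -/
noncomputable def filterFactor (v w : Link) (i k : Fin K) : ℂ :=
  ∫ f in (-(N.bandwidth v i / 2))..(N.bandwidth v i / 2),
    conj (N.spectrum v i f) * N.spectrum w k (f - N.freq w k + N.freq v i)

/-- Intra-mode factor `|Ĩ_v(α_i, α_k)|²`. -/
noncomputable def intraFactor (v : Link) (i k : Fin K) : ℝ :=
  ‖N.filterFactor v v i k‖ ^ 2 / ‖N.filterFactor v v i i‖ ^ 2

/-- Cross-mode factor `|C̃_v(α_i, α_k)|²`. -/
noncomputable def crossFactor (v : Link) (i k : Fin K) : ℝ :=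
  ‖N.filterFactor v v.other i k‖ ^ 2 / ‖N.filterFactor v v i i‖ ^ 2

/-! ### Power control -/

/-- Transmit power of a UE of tier `k` at distance `r` of its serving BS: truncated channel
inversion. -/
noncomputable def txPower (k : Fin K) (r : ℝ) : ℝ := min (N.rho k * r ^ N.etaDD) N.pU

/-- Membership in a user class, for a UE of tier `k` at distance `r` of its serving BS. -/
def InClass (c : UserClass) (k : Fin K) (r : ℝ) : Prop :=
  match c with
  | .ccu => N.rho k * r ^ N.etaDD ≤ N.pU
  | .ceu => N.pU < N.rho k * r ^ N.etaDD

/-- Radius of the protection region around the receiver of a test UE of class `c`, at distance `r`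
of its serving BS, against a UE of tier `k` that transmits with power `p`, `η` being the path-loss
exponent of the interfering link. -/
noncomputable def protectionRadius (c : UserClass) (η : ℝ) (k : Fin K) (p r : ℝ) : ℝ :=
  match c with
  | .ccu => (p / N.rho k) ^ (1 / η)
  | .ceu => r

/-! ### Explicit expressions -/

/-- `λ̄_i = ∑_k (τ_i² / τ_k²) λ_k`. -/
noncomputable def lamBar (i : Fin K) : ℝ := ∑ k, N.tau i ^ 2 / N.tau k ^ 2 * N.lam k

/-- `(P_u / ρ_i)^(1/η_dd)`, the distance that separates cell-centre and cell-edge users. -/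
noncomputable def edgeRadius (i : Fin K) : ℝ := (N.pU / N.rho i) ^ (1 / N.etaDD)

/-- Probability that a UE of tier `i` is a cell-edge user. -/
noncomputable def probCEU (i : Fin K) : ℝ :=
  Real.exp (-(Real.pi * N.lamBar i * (N.pU / N.rho i) ^ (2 / N.etaDD)))

/-- Probability that a UE of tier `i` is a cell-centre user. -/
noncomputable def probCCU (i : Fin K) : ℝ := 1 - N.probCEU i

/-- Density of the serving distance of a cell-centre user of tier `i`. -/
noncomputable def densCCU (i : Fin K) (r : ℝ) : ℝ :=
  (Set.Icc 0 (N.edgeRadius i)).indicator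
    (fun r => 2 * Real.pi * N.lamBar i * r * Real.exp (-(Real.pi * N.lamBar i * r ^ 2)) /
      (1 - Real.exp (-(Real.pi * N.lamBar i * (N.pU / N.rho i) ^ (2 / N.etaDD))))) r

/-- Density of the serving distance of a cell-edge user of tier `i`. -/
noncomputable def densCEU (i : Fin K) (r : ℝ) : ℝ :=
  (Set.Ioi (N.edgeRadius i)).indicator
    (fun r => 2 * Real.pi * N.lamBar i * r *
      Real.exp (-(Real.pi * N.lamBar i * r ^ 2) +
        Real.pi * N.lamBar i * (N.pU / N.rho i) ^ (2 / N.etaDD))) r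

/-- Expectation of `g` of the transmit power of a UE of tier `k`. -/
noncomputable def powerMean (k : Fin K) (g : ℝ → ℝ) : ℝ :=
  (∫ r in (0 : ℝ)..N.edgeRadius k, g (N.rho k * r ^ N.etaDD) *
      (2 * Real.pi * N.lamBar k * r * Real.exp (-(Real.pi * N.lamBar k * r ^ 2)))) +
    g N.pU * N.probCEU k

/-- Moment of order `z` of the transmit power of a UE of tier `k`, in closed form. -/
noncomputable def powerMoment (k : Fin K) (z : ℝ) : ℝ :=
  N.rho k ^ z * lowerGamma (z * N.etaDD / 2 + 1)
      (Real.pi * N.lamBar k * (N.pU / N.rho k) ^ (2 / N.etaDD)) /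
      (Real.pi * N.lamBar k) ^ (z * N.etaDD / 2) +
    N.pU ^ z * Real.exp (-(Real.pi * N.lamBar k * (N.pU / N.rho k) ^ (2 / N.etaDD)))

/-- Interference of the UEs of tier `k` on a receiver of a cell-centre link, path-loss exponent
`η`. -/
noncomputable def ltUECentre (η : ℝ) (k : Fin K) (s : ℝ) : ℝ :=
  Real.exp (-2 * Real.pi * N.lam k * N.rho k ^ (1 - 2 / η) / (η - 2) * N.powerMoment k (2 / η) *
    s * hyp2F1 1 (1 - 2 / η) (2 - 2 / η) (-(N.rho k * s)))

/-- Interference of the UEs of tier `k` on a receiver of a cell-edge link of length `r`, path-loss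
exponent `η`. -/
noncomputable def ltUEEdge (η : ℝ) (k : Fin K) (s r : ℝ) : ℝ :=
  Real.exp (-2 * Real.pi * N.lam k / (η - 2) * N.powerMean k (fun p =>
    r ^ (2 - η) * p * s * hyp2F1 1 (1 - 2 / η) (2 - 2 / η) (-(p * s * r ^ (-η)))))

/-- Simplified expression which contains only the mean transmit power. -/
noncomputable def ltUEEdgeSimple (η : ℝ) (k : Fin K) (s r : ℝ) : ℝ :=
  Real.exp (-2 * Real.pi * N.lam k / (η - 2) * (r ^ (2 - η) * N.powerMoment k 1 * s *
    hyp2F1 1 (1 - 2 / η) (2 - 2 / η) (-(N.powerMoment k 1 * s * r ^ (-η)))))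

/-- Interference of the BSs of tier `k` on a BS. -/
noncomputable def ltBSatBS (k : Fin K) (s : ℝ) : ℝ :=
  Real.exp (-(2 * Real.pi ^ 2 * N.lam k / N.etaDU * (s * N.pD k) ^ (2 / N.etaDU) *
    (Real.sin (2 * Real.pi / N.etaDU))⁻¹))

/-- Interference of the BSs of tier `k` on a UE of tier `i` at distance `r` of its serving BS. -/
noncomputable def ltBSatUE (i k : Fin K) (s r : ℝ) : ℝ :=
  Real.exp (-2 * Real.pi * N.lam k / (N.etaDD - 2) *
    (r * N.tau i / N.tau k) ^ (2 - N.etaDD) * s * N.pD k *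
    hyp2F1 1 (1 - 2 / N.etaDD) (2 - 2 / N.etaDD)
      (-((r * N.tau i / N.tau k) ^ (-N.etaDD) * N.pD k * s)))

/-- Intra-cell interference on a UE of tier `i` at distance `ro` of its serving BS. -/
noncomputable def ltIntraCell (T : Topology) (i k : Fin K) (ro s : ℝ) : ℝ :=
  open Classical in
  match T with
  | .twoNode => 1
  | .threeNode =>
    if i = k then
      (∫ r in (0 : ℝ)..N.edgeRadius i, (∫ a in N.delta..Real.pi,
        N.probCCU i * N.densCCU i r /
          (1 + s * N.rho i * r ^ N.etaDD *
            (r ^ 2 + ro ^ 2 - 2 * ro * r * Real.cos a) ^ (-N.etaUD / 2))) /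
          (Real.pi - N.delta)) +
      (∫ r in Set.Ioi (N.edgeRadius i), (∫ a in N.delta..Real.pi,
        N.probCEU i * N.densCEU i r /
          (1 + s * N.pU *
            (r ^ 2 + ro ^ 2 - 2 * ro * r * Real.cos a) ^ (-N.etaUD / 2))) /
          (Real.pi - N.delta))
    else 1

/-- Self-interference factor of the uplink. -/
noncomputable def siFactorUL (i : Fin K) (x : ℝ) : ℝ :=
  ∫ h, Real.exp (-(x * N.betaU i * h * N.pD i * N.crossFactor .ul i i)) ∂N.siLaw

/-- Self-interference factor of the downlink. -/
noncomputable def siFactorDL (T : Topology) (i : Fin K) (x : ℝ) : ℝ :=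
  match T with
  | .twoNode => ∫ h, Real.exp (-(x * N.betaD * h * N.crossFactor .dl i i)) ∂N.siLaw
  | .threeNode => 1

end Network

/-! ### The stochastic model -/

/-- Labels of the independent sources of randomness of the model. -/
inductive Source (K : ℕ)
  | bsAtUE (k : Fin K)
  | bsAtBS (k : Fin K)
  | ue (k : Fin K)
  | uePower (k : Fin K) (n : ℕ)
  | bsFading (k : Fin K) (n : ℕ)
  | ueFading (k : Fin K) (n : ℕ)
  | linkFading
  | selfInterference
  | mateDist (i : Fin K)
  | mateAngle
  | mateFading

/-- The random elements of the model: a test UE and its serving BS. -/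
structure Elements (K : ℕ) (Ω : Type*) where
  /-- positions of all BSs of tier `k`, relative to the test UE -/
  bsAtUE : Fin K → ℕ → Ω → Plane
  /-- positions of the interfering BSs of tier `k`, relative to the test BS -/
  bsAtBS : Fin K → ℕ → Ω → Plane
  /-- positions of the UEs of tier `k` that use the uplink channel, relative to the receiver -/
  ue : Fin K → ℕ → Ω → Plane
  /-- transmit powers of these UEs -/
  uePower : Fin K → ℕ → Ω → ℝ
  /-- fading gain between the receiver and the BSs -/
  bsFading : Fin K → ℕ → Ω → ℝ
  /-- fading gain between the receiver and the UEs -/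
  ueFading : Fin K → ℕ → Ω → ℝ
  /-- fading gain of the test link -/
  linkFading : Ω → ℝ
  /-- normalised self-interference gain -/
  selfInterference : Ω → ℝ
  /-- 3NT: distance to the serving BS of the other UE of the test cell, if the cell is of tier `i` -/
  mateDist : Fin K → Ω → ℝ
  /-- 3NT: angle between the two UEs of the test cell, seen from their BS -/
  mateAngle : Ω → ℝ
  /-- 3NT: fading gain between these two UEs -/
  mateFading : Ω → ℝ

namespace Elements

variable {K : ℕ} {Ω : Type*} (E : Elements K Ω)

/-- The σ-algebra generated by a source. -/
@[reducible] def sigma : Source K → MeasurableSpace Ω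
  | .bsAtUE k => ⨆ n, MeasurableSpace.comap (E.bsAtUE k n) inferInstance
  | .bsAtBS k => ⨆ n, MeasurableSpace.comap (E.bsAtBS k n) inferInstance
  | .ue k => ⨆ n, MeasurableSpace.comap (E.ue k n) inferInstance
  | .uePower k n => MeasurableSpace.comap (E.uePower k n) inferInstance
  | .bsFading k n => MeasurableSpace.comap (E.bsFading k n) inferInstance
  | .ueFading k n => MeasurableSpace.comap (E.ueFading k n) inferInstance
  | .linkFading => MeasurableSpace.comap E.linkFading inferInstance
  | .selfInterference => MeasurableSpace.comap E.selfInterference inferInstance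
  | .mateDist i => MeasurableSpace.comap (E.mateDist i) inferInstance
  | .mateAngle => MeasurableSpace.comap E.mateAngle inferInstance
  | .mateFading => MeasurableSpace.comap E.mateFading inferInstance

/-- Distance `r_k` of the test UE to the nearest BS of tier `k`. -/
noncomputable def nearest (k : Fin K) (ω : Ω) : ℝ := ⨅ n, ‖E.bsAtUE k n ω‖

/-- The test UE connects to tier `i`: `τ_i r_i < τ_k r_k` for all `k ≠ i`. Its serving BS is then
the nearest BS of tier `i`, at distance `r_o = nearest i`. -/
def associated (N : Network K) (i : Fin K) : Set Ω :=
  {ω | ∀ k, k ≠ i → N.tau i * E.nearest i ω < N.tau k * E.nearest k ω}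

/-- The test UE connects to tier `i` and is of class `c`. -/
def userEvent (N : Network K) (c : UserClass) (i : Fin K) : Set Ω :=
  {ω | ω ∈ E.associated N i ∧ N.InClass c i (E.nearest i ω)}

open Classical in
/-- Aggregate interference of the BSs of tier `k` on the test UE, if its serving BS is of tier `i`:
all BSs except the serving one. -/
noncomputable def interfBSatUE (N : Network K) (i k : Fin K) (ω : Ω) : ℝ≥0∞ :=
  ∑' n, if k = i ∧ ‖E.bsAtUE k n ω‖ = E.nearest i ω then 0
    else ENNReal.ofReal (N.pD k * E.bsFading k n ω * ‖E.bsAtUE k n ω‖ ^ (-N.etaDD))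

/-- Aggregate interference of the BSs of tier `k` on the test BS. -/
noncomputable def interfBSatBS (N : Network K) (k : Fin K) (ω : Ω) : ℝ≥0∞ :=
  ∑' n, ENNReal.ofReal (N.pD k * E.bsFading k n ω * ‖E.bsAtBS k n ω‖ ^ (-N.etaDU))

open Classical in
/-- Aggregate interference of the UEs of tier `k` outside their protection regions, on a receiver
of the test link (class `c`, tier `i`), path-loss exponent `η`. -/
noncomputable def interfUE (N : Network K) (η : ℝ) (c : UserClass) (i k : Fin K) (ω : Ω) : ℝ≥0∞ :=
  ∑' n, if N.protectionRadius c η k (E.uePower k n ω) (E.nearest i ω) < ‖E.ue k n ω‖ then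
    ENNReal.ofReal (E.uePower k n ω * E.ueFading k n ω * ‖E.ue k n ω‖ ^ (-η)) else 0

/-- Intra-cell interference on the test UE (cell of tier `i`), the distance of the two UEs being
given by the law of cosines. -/
noncomputable def interfIntraCell (N : Network K) (T : Topology) (i : Fin K) (ω : Ω) : ℝ≥0∞ :=
  match T with
  | .twoNode => 0
  | .threeNode => ENNReal.ofReal (N.txPower i (E.mateDist i ω) * E.mateFading ω *
      (E.mateDist i ω ^ 2 + E.nearest i ω ^ 2 -
        2 * E.nearest i ω * E.mateDist i ω * Real.cos (E.mateAngle ω)) ^ (-N.etaUD / 2))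

/-- Residual self-interference power at the test BS. -/
noncomputable def selfInterfUL (N : Network K) (i : Fin K) (ω : Ω) : ℝ :=
  N.betaU i * E.selfInterference ω * N.pD i * N.crossFactor .ul i i

/-- Residual self-interference power at the test UE. -/
noncomputable def selfInterfDL (N : Network K) (T : Topology) (i : Fin K) (ω : Ω) : ℝ :=
  match T with
  | .twoNode => N.betaD * E.selfInterference ω * N.txPower i (E.nearest i ω) *
      N.crossFactor .dl i i
  | .threeNode => 0

/-- Signal-to-interference-plus-noise ratio of the test link. -/
noncomputable def sinr (N : Network K) (T : Topology) (v : Link) (c : UserClass) (i : Fin K)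
    (ω : Ω) : ℝ≥0∞ :=
  match v with
  | .ul =>
    ENNReal.ofReal (N.txPower i (E.nearest i ω) * E.nearest i ω ^ (-N.etaDD) * E.linkFading ω) /
      (∑ k, E.interfUE N N.etaDD c i k ω * ENNReal.ofReal (N.intraFactor .ul i k) +
        ∑ k, E.interfBSatBS N k ω * ENNReal.ofReal (N.crossFactor .ul i k) +
        ENNReal.ofReal (E.selfInterfUL N i ω) + ENNReal.ofReal N.noise)
  | .dl =>
    ENNReal.ofReal (N.pD i * E.nearest i ω ^ (-N.etaDD) * E.linkFading ω) /
      (∑ k, E.interfBSatUE N i k ω * ENNReal.ofReal (N.intraFactor .dl i k) +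
        ∑ k, E.interfUE N N.etaUD c i k ω * ENNReal.ofReal (N.crossFactor .dl i k) +
        E.interfIntraCell N T i ω * ENNReal.ofReal (N.crossFactor .dl i i) +
        ENNReal.ofReal (E.selfInterfDL N T i ω) + ENNReal.ofReal N.noise)

/-- Outage probability at threshold `θ` of the link `v` of a test UE of class `c` in tier `i`. -/
noncomputable def outage [MeasurableSpace Ω] (N : Network K) (μ : Measure Ω) (T : Topology)
    (v : Link) (c : UserClass) (i : Fin K) (θ : ℝ) : ℝ :=
  (μ[|E.userEvent N c i]).real {ω | E.sinr N T v c i ω < ENNReal.ofReal θ}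

/-- Joint law of the random elements. The powers of the interfering UEs and the distance of the
other UE of the test cell are distributed as the power and the serving distance of a UE which is
connected to the tier in question. -/
structure IsModel [MeasurableSpace Ω] (N : Network K) (μ : Measure Ω) : Prop where
  bsAtUE_ppp : ∀ k, IsHomogeneousPPP (E.bsAtUE k) (N.lam k) μ
  bsAtBS_ppp : ∀ k, IsHomogeneousPPP (E.bsAtBS k) (N.lam k) μ
  ue_ppp : ∀ k, IsHomogeneousPPP (E.ue k) (N.lam k) μ
  uePower_meas : ∀ k n, Measurable (E.uePower k n)
  uePower_law : ∀ k n, μ.map (E.uePower k n) =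
    (μ[|E.associated N k]).map (fun ω => N.txPower k (E.nearest k ω))
  bsFading_meas : ∀ k n, Measurable (E.bsFading k n)
  bsFading_law : ∀ k n, μ.map (E.bsFading k n) = expMeasure 1
  ueFading_meas : ∀ k n, Measurable (E.ueFading k n)
  ueFading_law : ∀ k n, μ.map (E.ueFading k n) = expMeasure 1
  linkFading_meas : Measurable E.linkFading
  linkFading_law : μ.map E.linkFading = expMeasure 1
  selfInterference_meas : Measurable E.selfInterference
  selfInterference_law : μ.map E.selfInterference = N.siLaw
  mateDist_meas : ∀ i, Measurable (E.mateDist i)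
  mateDist_law : ∀ i, μ.map (E.mateDist i) = (μ[|E.associated N i]).map (E.nearest i)
  mateAngle_meas : Measurable E.mateAngle
  mateAngle_law : μ.map E.mateAngle = volume[|Set.Icc N.delta Real.pi]
  mateFading_meas : Measurable E.mateFading
  mateFading_law : μ.map E.mateFading = expMeasure 1
  indep : iIndep E.sigma μ

end Elements

end FDCellular

/-! Given the serving distance `r`, the test link is covered when `θ ≤ b H / D`, with `b` the mean
received power, `H` an exponential gain independent of everything else and `D` the interference plus
noise. Hence the conditional coverage probability is the mean of `exp (-θ D / b)`
(`expMeasure_le_div`, `IsModel.lintegral_link`). The terms of `D` come from disjoint groups of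
independent sources once `r` is frozen, so this mean is a product of Laplace transforms
(`IsModel.lintegral_groups`). All of this is done with `exp (-x)` on `[0, ∞]`, so that no finiteness
of the interference has to be known beforehand.

Each field of interferers is a marked Poisson process. Independent marks (fading gains, then powers)
are integrated out point by point (`lintegral_mul_expNeg_tsum_marks`), which replaces a random
contribution by a deterministic function of the point. The Laplace functional of the Poisson process
(`IsHomogeneousPPP.lintegral_expNeg_tsum`) then leaves the radial integral of `y x^(-η) / (1 + y
x^(-η))` outside a disc. A power substitution turns it into Euler's integral for the hypergeometric
function (`radial_eq`) or, without a disc, into a reflection-formula integral that yields the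
cosecant (`radial_zero`).

The serving distance is the distance to the nearest BS of tier `i`, whose law is read off void
probabilities. Association requires an empty disc of radius `r τ_i / τ_k` in every other tier `k`.
The product of these void probabilities with the density of the nearest distance is `λ_i / λ̄_i`
times a Rayleigh density of rate `π λ̄_i` (`Network.density_mul_prod_voidProb`); the constant is the
association probability and cancels on conditioning.

In the downlink the BSs of the other tiers interfere and also decide the association; restricting
the Laplace functional to a void event treats both at once. The BSs of the serving tier are harder,
since they determine `r` as well. For them one needs that, given the nearest distance, the remaining
points are a Poisson process outside the disc of that radius
(`IsHomogeneousPPP.lintegral_nearestDist_outside`). This is proved by confining the distance to a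
dyadic cell, where it is a difference of two void identities, and by refining the cells.

For cell-centre users the protection radius makes the hypergeometric argument independent of the
interferer's power, so that only a power moment survives. For cell-edge users the power stays inside
the function. Concavity of `p ↦ p y / (1 + p y)` then bounds the exponent by its value at the mean
power, which gives the upper bounds of the outage. -/

namespace FDCellular

open Filter _root_.Topology

/-! ### The function `exp (-x)` on `[0, ∞]` -/

/-- `exp (-x)` for `x ∈ [0, ∞]`, with `exp (-∞) = 0`. -/
noncomputable def expNeg (x : ℝ≥0∞) : ℝ≥0∞ := EReal.exp (-(x : EReal))

lemma expNeg_zero : expNeg 0 = 1 := by simp [expNeg]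

lemma expNeg_top : expNeg ∞ = 0 := by simp [expNeg]

/-- Valid without finiteness hypotheses, since neither image in `EReal` is `-∞`. Infinite
interference therefore needs no separate treatment. -/
lemma expNeg_add (x y : ℝ≥0∞) : expNeg (x + y) = expNeg x * expNeg y := by
  rw [expNeg, expNeg, expNeg, EReal.coe_ennreal_add, EReal.neg_add, sub_eq_add_neg, EReal.exp_add]
  · left; simp
  · right; simp

lemma expNeg_sum {ι : Type*} (s : Finset ι) (f : ι → ℝ≥0∞) :
    expNeg (∑ i ∈ s, f i) = ∏ i ∈ s, expNeg (f i) := by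
  classical
  induction s using Finset.induction_on with
  | empty => simp [expNeg_zero]
  | insert a s ha ih => rw [Finset.sum_insert ha, Finset.prod_insert ha, expNeg_add, ih]

lemma expNeg_natCast_mul (n : ℕ) (x : ℝ≥0∞) : expNeg (n * x) = expNeg x ^ n := by
  have := expNeg_sum (Finset.range n) (fun _ => x)
  simpa using this

lemma expNeg_ofReal {x : ℝ} (hx : 0 ≤ x) :
    expNeg (ENNReal.ofReal x) = ENNReal.ofReal (Real.exp (-x)) := by
  rw [expNeg, EReal.coe_ennreal_ofReal, max_eq_left hx, ← EReal.coe_neg, EReal.exp_coe]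

lemma expNeg_antitone : Antitone expNeg := fun x y h => by
  rw [expNeg, expNeg, EReal.exp_le_exp_iff, EReal.neg_le_neg_iff]
  exact_mod_cast h

lemma expNeg_le_one (x : ℝ≥0∞) : expNeg x ≤ 1 := by
  simpa [expNeg_zero] using expNeg_antitone (zero_le (a := x))

lemma expNeg_ne_top (x : ℝ≥0∞) : expNeg x ≠ ∞ := ne_top_of_le_ne_top (by simp) (expNeg_le_one x)

lemma continuous_expNeg : Continuous expNeg :=
  ENNReal.continuous_exp.comp (continuous_neg.comp continuous_coe_ennreal_ereal)

@[fun_prop]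
lemma measurable_expNeg : Measurable expNeg := continuous_expNeg.measurable

/-- Inverse of `expNeg` on `[0, 1]`. -/
noncomputable def negLog (y : ℝ≥0∞) : ℝ≥0∞ := (-(ENNReal.log y)).toENNReal

@[fun_prop]
lemma measurable_negLog : Measurable negLog :=
  (ENNReal.measurable_log.neg).ereal_toENNReal

lemma expNeg_negLog {y : ℝ≥0∞} (hy : y ≤ 1) : expNeg (negLog y) = y := by
  have h : (0 : EReal) ≤ -(ENNReal.log y) := by
    rw [EReal.le_neg, neg_zero]; simpa using hy
  rw [expNeg, negLog, EReal.coe_toENNReal h, neg_neg, ENNReal.exp_log]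

lemma negLog_expNeg (x : ℝ≥0∞) : negLog (expNeg x) = x := by
  rw [negLog, expNeg, EReal.log_exp, neg_neg, EReal.toENNReal_coe]

/-- Monotone convergence for the counting measure. -/
lemma tendsto_tsum_of_monotone {f : ℕ → ℕ → ℝ≥0∞} {g : ℕ → ℝ≥0∞}
    (hf : ∀ n, Monotone fun m => f m n) (hg : ∀ n, Tendsto (fun m => f m n) atTop (𝓝 (g n))) :
    Tendsto (fun m => ∑' n, f m n) atTop (𝓝 (∑' n, g n)) := by
  simp_rw [← lintegral_count]
  exact lintegral_tendsto_of_tendsto_of_monotone (fun m => (measurable_of_countable _).aemeasurable)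
    (ae_of_all _ hf) (ae_of_all _ hg)

/-! ### Laplace functional of a Poisson point process -/

section Laplace

variable {Ω : Type*} [MeasurableSpace Ω] {μ : Measure Ω} {X : ℕ → Ω → Plane} {c : ℝ}

lemma measurable_pointCount (hX : ∀ n, Measurable (X n)) {B : Set Plane} (hB : MeasurableSet B) :
    Measurable (pointCount X B) :=
  Measurable.tsum fun n => (measurable_const.indicator hB).comp (hX n)

/-- Probability generating function of the Poisson law, from the exponential series of `L * q`. -/
lemma tsum_poisson_mul_pow (L : NNReal) {q : ℝ} (hq : 0 ≤ q) :
    ∑' m : ℕ, ENNReal.ofReal q ^ m * poissonMeasure L {m} =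
      ENNReal.ofReal (Real.exp (-(L * (1 - q)))) := by
  have h : HasSum (fun m : ℕ => q ^ m * (Real.exp (-L) * L ^ m / (m.factorial : ℝ)))
      (Real.exp (-(L * (1 - q)))) := by
    have := (NormedSpace.expSeries_div_hasSum_exp (L * q : ℝ)).mul_left (Real.exp (-L))
    rw [← Real.exp_eq_exp_ℝ, ← Real.exp_add] at this
    convert! this using 1
    · ext m; rw [mul_pow]; ring
    · ring_nf
  rw [← h.tsum_eq, ENNReal.ofReal_tsum_of_nonneg (fun m => by positivity) h.summable]
  refine tsum_congr fun m => ?_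
  rw [poissonMeasure_singleton, ENNReal.ofReal_mul (by positivity), ENNReal.ofReal_pow hq]

/-- Splitting over the values of the count reduces the claim to the Poisson generating function at
`q = expNeg a`. The weight `a = ∞`, that is `q = 0`, is allowed and gives void probabilities. -/
lemma IsHomogeneousPPP.lintegral_expNeg_count [IsProbabilityMeasure μ]
    (hX : IsHomogeneousPPP X c μ) (hc : 0 ≤ c) {B : Set Plane} (hB : MeasurableSet B)
    (hBv : volume B ≠ ∞) (a : ℝ≥0∞) :
    ∫⁻ ω, expNeg (a * pointCount X B ω) ∂μ =
      expNeg (ENNReal.ofReal c * (volume B * (1 - expNeg a))) := by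
  set L : NNReal := (c * volume.real B).toNNReal with hL
  have hA : ∀ m : ℕ, MeasurableSet {ω | pointCount X B ω = (m : ℝ≥0∞)} := fun m =>
    measurable_pointCount hX.measurable hB (measurableSet_singleton _)
  have hdisj : Pairwise (Function.onFun Disjoint
      fun m : ℕ => {ω | pointCount X B ω = (m : ℝ≥0∞)}) := by
    intro m n hmn
    refine Set.disjoint_left.2 fun ω h1 h2 => hmn ?_
    have : (m : ℝ≥0∞) = n := h1.symm.trans h2
    exact_mod_cast this
  -- The Poisson masses add up to one, so the count is almost surely a natural number although it is
  -- defined with values in `[0, ∞]`.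
  have hone : μ (⋃ m : ℕ, {ω | pointCount X B ω = (m : ℝ≥0∞)}) = 1 := by
    rw [measure_iUnion hdisj hA]
    simp_rw [hX.count_law B hB hBv]
    have := tsum_poisson_mul_pow L (q := 1) zero_le_one
    simpa using this
  have hae : ∀ᵐ ω ∂μ, ω ∈ ⋃ m : ℕ, {ω | pointCount X B ω = (m : ℝ≥0∞)} :=
    (prob_compl_eq_zero_iff (MeasurableSet.iUnion hA)).2 hone
  rw [← Measure.restrict_eq_self_of_ae_mem hae, lintegral_iUnion hA hdisj]
  have : ∀ m : ℕ, ∫⁻ ω in {ω | pointCount X B ω = (m : ℝ≥0∞)}, expNeg (a * pointCount X B ω) ∂μ =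
      expNeg a ^ m * poissonMeasure L {m} := by
    intro m
    rw [setLIntegral_congr_fun (hA m) (g := fun _ => expNeg a ^ m), setLIntegral_const,
      hX.count_law B hB hBv]
    intro ω hω
    simp only [Set.mem_ofPred_eq] at hω
    simp only [hω]
    rw [mul_comm, expNeg_natCast_mul]
  simp_rw [this]
  obtain ⟨q, hq⟩ : ∃ q, q = (expNeg a).toReal := ⟨_, rfl⟩
  have hq0 : 0 ≤ q := hq ▸ ENNReal.toReal_nonneg
  have hqa : expNeg a = ENNReal.ofReal q := by rw [hq, ENNReal.ofReal_toReal (expNeg_ne_top a)]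
  have hq1 : q ≤ 1 := by
    rw [hq]; exact ENNReal.toReal_le_of_le_ofReal zero_le_one (by simpa using expNeg_le_one a)
  rw [hqa, tsum_poisson_mul_pow L hq0, ← ENNReal.ofReal_one, ← ENNReal.ofReal_sub _ hq0,
    ← ENNReal.ofReal_toReal hBv, ← ENNReal.ofReal_mul ENNReal.toReal_nonneg,
    ← ENNReal.ofReal_mul hc, expNeg_ofReal, hL, Real.coe_toNNReal _ (by positivity)]
  · simp only [Measure.real]; ring_nf
  · have := sub_nonneg.2 hq1
    positivity

lemma IsHomogeneousPPP.lintegral_expNeg_sum_count [IsProbabilityMeasure μ]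
    (hX : IsHomogeneousPPP X c μ) (hc : 0 ≤ c) {l : ℕ} {B : Fin l → Set Plane}
    (hB : ∀ j, MeasurableSet (B j)) (hBd : Pairwise fun a b => Disjoint (B a) (B b))
    (hBv : ∀ j, volume (B j) ≠ ∞) (a : Fin l → ℝ≥0∞) :
    ∫⁻ ω, expNeg (∑ j, a j * pointCount X (B j) ω) ∂μ =
      expNeg (ENNReal.ofReal c * ∑ j, volume (B j) * (1 - expNeg (a j))) := by
  have hind := (hX.count_indep l B hB hBd).comp (fun j x => expNeg (a j * x))
    fun j => measurable_expNeg.comp (measurable_const_mul _)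
  simp_rw [expNeg_sum, Finset.mul_sum]
  rw [expNeg_sum]
  simp_rw [← hX.lintegral_expNeg_count hc (hB _) (hBv _) (a _)]
  exact lintegral_prod_eq_prod_lintegral_of_indepFun Finset.univ _ hind fun j =>
    measurable_expNeg.comp ((measurable_const_mul _).comp
      (measurable_pointCount hX.measurable (hB j)))

/-- The sum of a simple function over the points is a finite combination of counts of its disjoint
level sets, which are independent. -/
lemma IsHomogeneousPPP.lintegral_expNeg_simpleFunc [IsProbabilityMeasure μ]
    (hX : IsHomogeneousPPP X c μ) (hc : 0 ≤ c) (v : SimpleFunc Plane ℝ≥0∞)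
    (hv : ∀ y, y ≠ 0 → volume (v ⁻¹' {y}) ≠ ∞) :
    ∫⁻ ω, expNeg (∑' n, v (X n ω)) ∂μ =
      expNeg (ENNReal.ofReal c * ∫⁻ x, (1 - expNeg (v x))) := by
  classical
  -- The value `0` is dropped because its level set may have infinite area; it contributes nothing
  -- on either side.
  set s : Finset ℝ≥0∞ := v.range.filter (· ≠ 0) with hs
  set e := s.equivFin
  -- Used for `h = id` on the points and for `h y = 1 - expNeg y` under the area integral; both
  -- vanish at `0`.
  have key : ∀ (h : ℝ≥0∞ → ℝ≥0∞) (h0 : h 0 = 0) (x : Plane),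
      h (v x) = ∑ j, h (e.symm j) * (v ⁻¹' {(e.symm j : ℝ≥0∞)}).indicator (fun _ => 1) x := by
    intro h h0 x
    rw [e.symm.sum_comp (fun y : s => h y * (v ⁻¹' {(y : ℝ≥0∞)}).indicator (fun _ => 1) x),
      Finset.sum_coe_sort s (fun y => h y * (v ⁻¹' {y}).indicator (fun _ => 1) x)]
    simp only [Set.indicator_apply, Set.mem_preimage, Set.mem_singleton_iff, mul_ite, mul_one,
      mul_zero, Finset.sum_ite_eq]
    split_ifs with hx
    · rfl
    · have : v x = 0 := by
        by_contra hne
        exact hx (Finset.mem_filter.2 ⟨v.mem_range_self x, hne⟩)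
      rw [this, h0]
  have hl : ∀ ω, ∑' n, v (X n ω) =
      ∑ j, (e.symm j : ℝ≥0∞) * pointCount X (v ⁻¹' {(e.symm j : ℝ≥0∞)}) ω := by
    intro ω
    simp_rw [pointCount, ← ENNReal.tsum_mul_left]
    rw [← Summable.tsum_finsetSum fun _ _ => ENNReal.summable]
    exact tsum_congr fun n => key id rfl (X n ω)
  have hr : ∫⁻ x, (1 - expNeg (v x)) =
      ∑ j, volume (v ⁻¹' {(e.symm j : ℝ≥0∞)}) * (1 - expNeg (e.symm j)) := by
    rw [lintegral_congr (key (fun y => 1 - expNeg y) (by simp [expNeg_zero])),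
      lintegral_finsetSum _ fun j _ => (measurable_const.indicator
        (v.measurableSet_preimage _)).const_mul _]
    refine Finset.sum_congr rfl fun j _ => ?_
    rw [lintegral_const_mul _ (measurable_const.indicator (v.measurableSet_preimage _)),
      lintegral_indicator (v.measurableSet_preimage _), setLIntegral_const, one_mul, mul_comm]
  simp_rw [hl]
  rw [hr]
  refine hX.lintegral_expNeg_sum_count hc (fun j => v.measurableSet_preimage _) ?_ ?_ _
  · intro i j hij
    refine Set.disjoint_left.2 fun x hx hx' => hij ?_
    exact e.symm.injective (Subtype.ext (hx.symm.trans hx'))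
  · exact fun j => hv _ (Finset.mem_filter.1 (e.symm j).2).2

/-- Laplace functional of a homogeneous Poisson point process. -/
theorem IsHomogeneousPPP.lintegral_expNeg_tsum [IsProbabilityMeasure μ]
    (hX : IsHomogeneousPPP X c μ) (hc : 0 ≤ c) {v : Plane → ℝ≥0∞} (hv : Measurable v) :
    ∫⁻ ω, expNeg (∑' n, v (X n ω)) ∂μ =
      expNeg (ENNReal.ofReal c * ∫⁻ x, (1 - expNeg (v x))) := by
  -- The approximating simple functions are cut off to sets of finite area, so that their nonzero
  -- level sets have finite area too.
  set u : ℕ → SimpleFunc Plane ℝ≥0∞ := fun m =>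
    (SimpleFunc.eapprox v m).restrict (spanningSets volume m) with hu
  have hux : ∀ m x, u m x = (spanningSets volume m).indicator (SimpleFunc.eapprox v m) x :=
    fun m x => SimpleFunc.restrict_apply _ (measurableSet_spanningSets _ m) x
  have hmono : ∀ x, Monotone fun m => u m x := by
    intro x m n hmn
    simp only [hux]
    refine (Set.indicator_le_indicator (SimpleFunc.monotone_eapprox v hmn x)).trans ?_
    exact Set.indicator_le_indicator_of_subset (monotone_spanningSets _ hmn) (fun _ => zero_le) x
  have hlim : ∀ x, Tendsto (fun m => u m x) atTop (𝓝 (v x)) := by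
    intro x
    refine (SimpleFunc.tendsto_eapprox hv x).congr' ?_
    filter_upwards [eventually_ge_atTop (spanningSetsIndex volume x)] with m hm
    rw [hux, Set.indicator_of_mem (mem_spanningSets_of_index_le volume x hm)]
  have hfin : ∀ m, ∫⁻ ω, expNeg (∑' n, u m (X n ω)) ∂μ =
      expNeg (ENNReal.ofReal c * ∫⁻ x, (1 - expNeg (u m x))) := by
    intro m
    refine hX.lintegral_expNeg_simpleFunc hc (u m) fun y hy => ?_
    refine ne_top_of_le_ne_top (measure_spanningSets_lt_top volume m).ne (measure_mono ?_)
    intro x hx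
    by_contra hx'
    exact hy ((Set.mem_singleton_iff.1 hx).symm.trans
      ((hux m x).trans (Set.indicator_of_notMem hx' _)))
  have h1 : Tendsto (fun m => ∫⁻ ω, expNeg (∑' n, u m (X n ω)) ∂μ) atTop
      (𝓝 (∫⁻ ω, expNeg (∑' n, v (X n ω)) ∂μ)) := by
    refine tendsto_lintegral_of_dominated_convergence (fun _ => 1) (fun m => ?_)
      (fun m => ae_of_all _ fun ω => expNeg_le_one _) (by simp) (ae_of_all _ fun ω => ?_)
    · exact measurable_expNeg.comp
        (Measurable.tsum fun n => (u m).measurable.comp (hX.measurable n))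
    · exact (continuous_expNeg.tendsto _).comp
        (tendsto_tsum_of_monotone (fun n => hmono (X n ω)) fun n => hlim (X n ω))
  have h2 : Tendsto (fun m => expNeg (ENNReal.ofReal c * ∫⁻ x, (1 - expNeg (u m x)))) atTop
      (𝓝 (expNeg (ENNReal.ofReal c * ∫⁻ x, (1 - expNeg (v x))))) := by
    refine (continuous_expNeg.tendsto _).comp
      (ENNReal.Tendsto.const_mul ?_ (Or.inr ENNReal.ofReal_ne_top))
    refine lintegral_tendsto_of_tendsto_of_monotone (fun m => ?_) (ae_of_all _ fun x => ?_)
      (ae_of_all _ fun x => ?_)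
    · exact (measurable_const.sub (measurable_expNeg.comp (u m).measurable)).aemeasurable
    · exact fun m n hmn => tsub_le_tsub_left (expNeg_antitone (hmono x hmn)) _
    · exact ENNReal.Tendsto.sub tendsto_const_nhds
        ((continuous_expNeg.tendsto _).comp (hlim x)) (Or.inl ENNReal.one_ne_top)
  simp_rw [hfin] at h1
  exact tendsto_nhds_unique h1 h2

end Laplace

/-! ### Integrating out independent randomness -/

section Independence

variable {Ω α β : Type*} {m₁ m₂ m₀ mΩ : MeasurableSpace Ω} {μ : Measure Ω} [MeasurableSpace α]
  [MeasurableSpace β]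

/-- Tonelli for the joint law, which is the product of the marginal laws. -/
lemma lintegral_of_indepFun [IsFiniteMeasure μ] {A : Ω → α} {Y : Ω → β} (h : IndepFun A Y μ)
    (hA : Measurable A) (hY : Measurable Y) {G : α → β → ℝ≥0∞}
    (hG : Measurable (Function.uncurry G)) :
    ∫⁻ ω, G (A ω) (Y ω) ∂μ = ∫⁻ ω, ∫⁻ ω', G (A ω) (Y ω') ∂μ ∂μ := by
  have h1 : ∫⁻ ω, G (A ω) (Y ω) ∂μ = ∫⁻ z, Function.uncurry G z ∂(μ.map fun ω => (A ω, Y ω)) := by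
    rw [lintegral_map hG (hA.prodMk hY)]; rfl
  rw [h1, (indepFun_iff_map_prod_eq_prod_map_map hA.aemeasurable hY.aemeasurable).1 h,
    lintegral_prod _ hG.aemeasurable, lintegral_map hG.lintegral_prod_right' hA]
  refine lintegral_congr fun ω => ?_
  exact lintegral_map (f := G (A ω)) (hG.comp measurable_prodMk_left) hY

/-- Freezing: the part of the integrand that is independent of `m₁` is integrated separately. -/
lemma lintegral_freeze [IsFiniteMeasure μ] (h₁ : m₁ ≤ mΩ)
    (h₂ : m₂ ≤ mΩ) (hind : Indep m₁ m₂ μ) {A : Ω → α} (hA : Measurable[m₁] A)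
    {F : α → Ω → ℝ≥0∞}
    (hF : Measurable[(inferInstance : MeasurableSpace α).prod m₂] (Function.uncurry F)) :
    ∫⁻ ω, F (A ω) ω ∂μ = ∫⁻ ω, ∫⁻ ω', F (A ω) ω' ∂μ ∂μ := by
  -- The identity, viewed as a map from `Ω` to `Ω` equipped with `m₂`, generates exactly `m₂`. This
  -- turns independence of σ-algebras into independence of two maps.
  have hid : @IndepFun Ω α Ω mΩ _ m₂ A id μ := by
    refine (@IndepFun_iff_Indep Ω α Ω mΩ _ m₂ A id μ).2 ?_
    rw [@MeasurableSpace.comap_id Ω m₂]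
    exact indep_of_indep_of_le_left hind hA.comap_le
  exact @lintegral_of_indepFun Ω α Ω mΩ μ _ m₂ _ A id hid (hA.mono h₁ le_rfl)
    (fun s hs => h₂ s hs) F hF

/-- Integrating out independent marks, finitely many points. -/
lemma lintegral_mul_prod_marks [IsFiniteMeasure μ]
    {H : ℕ → MeasurableSpace Ω} (hH : ∀ n, H n ≤ mΩ) (h0 : ∀ n, m₀ ≤ H n)
    {M : ℕ → Ω → β} (hM : ∀ n, Measurable (M n))
    (hMH : ∀ n, ∀ k < n, Measurable[H n] (M k))
    (hind : ∀ n, Indep (H n) (MeasurableSpace.comap (M n) inferInstance) μ)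
    {ν : Measure β} [SFinite ν] (hlaw : ∀ n, μ.map (M n) = ν)
    {A : ℕ → Ω → α} (hA : ∀ n, Measurable[m₀] (A n))
    {F : α → β → ℝ≥0∞} (hF : Measurable (Function.uncurry F)) (n : ℕ)
    {Z : Ω → ℝ≥0∞} (hZ : Measurable[m₀] Z) :
    ∫⁻ ω, Z ω * ∏ k ∈ Finset.range n, F (A k ω) (M k ω) ∂μ =
      ∫⁻ ω, Z ω * ∏ k ∈ Finset.range n, ∫⁻ y, F (A k ω) y ∂ν ∂μ := by
  have hG : Measurable fun a => ∫⁻ y, F a y ∂ν := hF.lintegral_prod_right'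
  induction n generalizing Z with
  | zero => simp
  | succ n ih =>
    simp_rw [Finset.prod_range_succ]
    -- `P` carries the marks before the last one and is measurable for `H n`, hence independent of
    -- `M n`.
    set P : Ω → ℝ≥0∞ := fun ω => Z ω * ∏ k ∈ Finset.range n, F (A k ω) (M k ω) with hP
    have hPm : Measurable[H n] P := by
      refine (hZ.mono (h0 n) le_rfl).mul (Finset.measurable_fun_prod _ fun k hk => ?_)
      exact hF.comp (((hA k).mono (h0 n) le_rfl).prodMk (hMH n k (Finset.mem_range.1 hk)))
    have hAn : Measurable[H n] (A n) := (hA n).mono (h0 n) le_rfl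
    have hI : IndepFun (fun ω => (P ω, A n ω)) (M n) μ := by
      rw [IndepFun_iff_Indep]
      exact indep_of_indep_of_le_left (hind n) (hPm.prodMk hAn).comap_le
    have hK : Measurable (Function.uncurry fun (p : ℝ≥0∞ × α) (y : β) => p.1 * F p.2 y) :=
      (measurable_fst.comp measurable_fst).mul
        (hF.comp ((measurable_snd.comp measurable_fst).prodMk measurable_snd))
    have e1 := lintegral_of_indepFun hI ((hPm.prodMk hAn).mono (hH n) le_rfl) (hM n) hK
    have e2 : ∀ ω, ∫⁻ ω', P ω * F (A n ω) (M n ω') ∂μ = P ω * ∫⁻ y, F (A n ω) y ∂ν := by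
      intro ω
      have hFm : Measurable fun y => F (A n ω) y := hF.comp measurable_prodMk_left
      have h2 := lintegral_map (μ := μ) hFm (hM n)
      have h3 := lintegral_const_mul (μ := μ) (P ω) (hFm.comp (hM n))
      simp only [Function.comp_def] at h3
      rw [h3, ← hlaw n, h2]
    simp only [e2] at e1
    -- The averaged last factor is `m₀`-measurable, so it can join the prefactor; this is why the
    -- induction generalizes `Z`.
    have e3 := ih (Z := fun ω => Z ω * ∫⁻ y, F (A n ω) y ∂ν) (hZ.mul (hG.comp (hA n)))
    calc _ = ∫⁻ ω, P ω * F (A n ω) (M n ω) ∂μ := by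
          refine lintegral_congr fun ω => ?_
          rw [hP]; ring
      _ = _ := e1
      _ = ∫⁻ ω, Z ω * (∫⁻ y, F (A n ω) y ∂ν) * ∏ k ∈ Finset.range n, F (A k ω) (M k ω) ∂μ := by
          refine lintegral_congr fun ω => ?_
          rw [hP]; ring
      _ = _ := e3
      _ = _ := by
          refine lintegral_congr fun ω => ?_
          ring

/-- Replacing the contribution of a random mark by its deterministic equivalent. -/
noncomputable def markLog (ν : Measure β) (f : α → β → ℝ≥0∞) (a : α) : ℝ≥0∞ :=
  negLog (∫⁻ y, expNeg (f a y) ∂ν)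

lemma measurable_markLog {ν : Measure β} [SFinite ν] {f : α → β → ℝ≥0∞}
    (hf : Measurable (Function.uncurry f)) : Measurable (markLog ν f) :=
  measurable_negLog.comp (measurable_expNeg.comp hf).lintegral_prod_right'

-- A probability law keeps the averaged exponential in `[0, 1]`, where `negLog` inverts `expNeg`.
-- The average over a mark thus goes back into the exponent as a function of the point alone.
omit [MeasurableSpace α] in
lemma expNeg_markLog (ν : Measure β) [IsProbabilityMeasure ν] (f : α → β → ℝ≥0∞) (a : α) :
    expNeg (markLog ν f a) = ∫⁻ y, expNeg (f a y) ∂ν := by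
  refine expNeg_negLog ((lintegral_mono fun y => expNeg_le_one _).trans ?_)
  simp

/-- Integrating out independent marks, infinitely many points. -/
lemma lintegral_mul_expNeg_tsum_marks [IsFiniteMeasure μ]
    {H : ℕ → MeasurableSpace Ω} (hH : ∀ n, H n ≤ mΩ) (h0 : ∀ n, m₀ ≤ H n)
    {M : ℕ → Ω → β} (hM : ∀ n, Measurable (M n))
    (hMH : ∀ n, ∀ k < n, Measurable[H n] (M k))
    (hind : ∀ n, Indep (H n) (MeasurableSpace.comap (M n) inferInstance) μ)
    {ν : Measure β} [IsProbabilityMeasure ν] (hlaw : ∀ n, μ.map (M n) = ν)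
    {A : ℕ → Ω → α} (hA : ∀ n, Measurable[m₀] (A n))
    {f : α → β → ℝ≥0∞} (hf : Measurable (Function.uncurry f))
    {Z : Ω → ℝ≥0∞} (hZ : Measurable[m₀] Z) (hZ1 : ∀ ω, Z ω ≤ 1) :
    ∫⁻ ω, Z ω * expNeg (∑' n, f (A n ω) (M n ω)) ∂μ =
      ∫⁻ ω, Z ω * expNeg (∑' n, markLog ν f (A n ω)) ∂μ := by
  have hZm : Measurable Z := hZ.mono ((h0 0).trans (hH 0)) le_rfl
  have hAm : ∀ n, Measurable (A n) := fun n => (hA n).mono ((h0 0).trans (hH 0)) le_rfl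
  -- Finite products pass to the infinite sum by dominated convergence, every integrand being at
  -- most one.
  have lim : ∀ g : ℕ → Ω → ℝ≥0∞, (∀ n, Measurable (g n)) →
      Tendsto (fun n => ∫⁻ ω, Z ω * ∏ k ∈ Finset.range n, expNeg (g k ω) ∂μ) atTop
        (𝓝 (∫⁻ ω, Z ω * expNeg (∑' n, g n ω) ∂μ)) := by
    intro g hg
    refine tendsto_lintegral_of_dominated_convergence (fun _ => 1) (fun n => ?_)
      (fun n => ae_of_all _ fun ω => ?_) (by simp) (ae_of_all _ fun ω => ?_)
    · exact hZm.mul (Finset.measurable_fun_prod _ fun k _ => measurable_expNeg.comp (hg k))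
    · exact mul_le_one' (hZ1 ω) (Finset.prod_le_one' fun k _ => expNeg_le_one _)
    · refine ENNReal.Tendsto.const_mul ?_ (Or.inr (ne_top_of_le_ne_top (by simp) (hZ1 ω)))
      simp_rw [← expNeg_sum]
      exact (continuous_expNeg.tendsto _).comp (ENNReal.tendsto_nat_tsum _)
  have hF : Measurable (Function.uncurry fun a y => expNeg (f a y)) := measurable_expNeg.comp hf
  have l1 := lim (fun n ω => f (A n ω) (M n ω)) fun n => hf.comp ((hAm n).prodMk (hM n))
  have l2 := lim (fun n ω => markLog ν f (A n ω)) fun n => (measurable_markLog hf).comp (hAm n)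
  simp_rw [lintegral_mul_prod_marks hH h0 hM hMH hind hlaw hA hF _ hZ] at l1
  simp_rw [expNeg_markLog] at l2
  exact tendsto_nhds_unique l1 l2

end Independence

/-! ### Distance to the nearest point -/

section Nearest

lemma lintegral_Ioi_rayleigh {b : ℝ} (hb : 0 < b) {t : ℝ} (ht : 0 ≤ t) :
    ∫⁻ r in Set.Ioi t, ENNReal.ofReal (2 * b * r * Real.exp (-(b * r ^ 2))) =
      ENNReal.ofReal (Real.exp (-(b * t ^ 2))) := by
  have hd : ∀ r ∈ Set.Ici t, HasDerivAt (fun r => -Real.exp (-(b * r ^ 2)))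
      (2 * b * r * Real.exp (-(b * r ^ 2))) r := by
    intro r _
    have := ((((hasDerivAt_id r).pow 2).const_mul b).neg.exp).neg
    convert! this using 1
    simp; ring
  have hpos : ∀ r ∈ Set.Ioi t, 0 ≤ 2 * b * r * Real.exp (-(b * r ^ 2)) := by
    intro r hr
    have : 0 ≤ r := ht.trans (le_of_lt hr)
    positivity
  have hlim : Tendsto (fun r : ℝ => -Real.exp (-(b * r ^ 2))) atTop (𝓝 0) := by
    rw [← neg_zero]
    refine (Real.tendsto_exp_neg_atTop_nhds_zero.comp ?_).neg
    exact (tendsto_pow_atTop two_ne_zero).const_mul_atTop hb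
  rw [← ofReal_integral_eq_lintegral_ofReal
    (integrableOn_Ioi_deriv_of_nonneg' hd hpos hlim)
    ((ae_restrict_iff' measurableSet_Ioi).2 (ae_of_all _ hpos)),
    integral_Ioi_of_hasDerivAt_of_nonneg' hd hpos hlim]
  simp

/-- Rayleigh law of the distance to the nearest point of a Poisson point process. -/
noncomputable def rayleigh (b : ℝ) : Measure ℝ :=
  (volume.restrict (Set.Ioi 0)).withDensity
    fun r => ENNReal.ofReal (2 * b * r * Real.exp (-(b * r ^ 2)))

lemma rayleigh_Ioi {b : ℝ} (hb : 0 < b) {t : ℝ} (ht : 0 ≤ t) :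
    rayleigh b (Set.Ioi t) = ENNReal.ofReal (Real.exp (-(b * t ^ 2))) := by
  rw [rayleigh, withDensity_apply _ measurableSet_Ioi,
    Measure.restrict_restrict measurableSet_Ioi, Set.Ioi_inter_Ioi, max_eq_left ht,
    lintegral_Ioi_rayleigh hb ht]

instance (b : ℝ) : NullSingletonClass (rayleigh b) := by
  exact nullSingletonClass_withDensity _

lemma rayleigh_Iic_zero (b : ℝ) : rayleigh b (Set.Iic 0) = 0 := by
  rw [rayleigh, withDensity_apply _ measurableSet_Iic,
    Measure.restrict_restrict measurableSet_Iic, Set.Iic_inter_Ioi, Set.Ioc_self]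
  simp

lemma isProbabilityMeasure_rayleigh {b : ℝ} (hb : 0 < b) : IsProbabilityMeasure (rayleigh b) := by
  constructor
  rw [← Set.Iic_union_Ioi (a := (0 : ℝ)), measure_union (Set.Iic_disjoint_Ioi le_rfl)
    measurableSet_Ioi, rayleigh_Iic_zero, rayleigh_Ioi hb le_rfl]
  simp

lemma lintegral_rayleigh {b : ℝ} {φ : ℝ → ℝ≥0∞} (hφ : Measurable φ) :
    ∫⁻ r, φ r ∂rayleigh b = ∫⁻ r in Set.Ioi 0,
      ENNReal.ofReal (2 * b * r * Real.exp (-(b * r ^ 2))) * φ r := by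
  rw [rayleigh, lintegral_withDensity_eq_lintegral_mul _ (by fun_prop) hφ]
  rfl

/-- Distance of the nearest point of a random sequence to the origin. -/
noncomputable def nearestDist {Ω : Type*} (X : ℕ → Ω → Plane) (ω : Ω) : ℝ := ⨅ n, ‖X n ω‖

variable {Ω : Type*} [MeasurableSpace Ω] {μ : Measure Ω} {X : ℕ → Ω → Plane} {c : ℝ}

omit [MeasurableSpace Ω] in
lemma nearestDist_le (ω : Ω) (n : ℕ) : nearestDist X ω ≤ ‖X n ω‖ :=
  ciInf_le ⟨0, by rintro _ ⟨n, rfl⟩; exact norm_nonneg _⟩ n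

omit [MeasurableSpace Ω] in
lemma nearestDist_nonneg (ω : Ω) : 0 ≤ nearestDist X ω := le_ciInf fun _ => norm_nonneg _

lemma measurable_nearestDist (hX : ∀ n, Measurable (X n)) : Measurable (nearestDist X) :=
  Measurable.iInf fun n => (hX n).norm

-- The weight `∞` on `B` encodes the event that `B` contains no point, so void events become a case
-- of the Laplace functional.
omit [MeasurableSpace Ω] in
lemma expNeg_tsum_top_indicator {B : Set Plane} (ω : Ω) [Decidable (∀ n, X n ω ∉ B)] :
    expNeg (∑' n, B.indicator (fun _ => ∞) (X n ω)) = if ∀ n, X n ω ∉ B then 1 else 0 := by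
  split_ifs with h
  · simp [Set.indicator_of_notMem (h _), expNeg_zero]
  · push Not at h
    obtain ⟨n, hn⟩ := h
    rw [ENNReal.tsum_eq_top_of_eq_top ⟨n, Set.indicator_of_mem hn _⟩, expNeg_top]

lemma volume_ball_plane {t : ℝ} (ht : 0 ≤ t) :
    volume (Metric.ball (0 : Plane) t) = ENNReal.ofReal (Real.pi * t ^ 2) := by
  rw [EuclideanSpace.volume_ball_fin_two, ← ENNReal.ofReal_pow ht, mul_comm,
    ENNReal.ofReal_mul Real.pi_pos.le]

variable [IsProbabilityMeasure μ]

/-- Laplace functional of `v` plus `∞` on `B`. The integrand `1 - expNeg` equals one on `B`, which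
produces the area of `B`, and is that of `v` elsewhere. -/
lemma IsHomogeneousPPP.lintegral_void (hX : IsHomogeneousPPP X c μ) (hc : 0 ≤ c)
    {B : Set Plane} (hB : MeasurableSet B) {v : Plane → ℝ≥0∞} (hv : Measurable v) :
    ∫⁻ ω, {ω | ∀ n, X n ω ∉ B}.indicator 1 ω * expNeg (∑' n, v (X n ω)) ∂μ =
      expNeg (ENNReal.ofReal c * volume B) *
        expNeg (ENNReal.ofReal c * ∫⁻ x in Bᶜ, (1 - expNeg (v x))) := by
  classical
  have h1 : ∀ ω, {ω | ∀ n, X n ω ∉ B}.indicator 1 ω * expNeg (∑' n, v (X n ω)) =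
      expNeg (∑' n, (B.indicator (fun _ => ∞) (X n ω) + v (X n ω))) := by
    intro ω
    rw [ENNReal.tsum_add, expNeg_add, expNeg_tsum_top_indicator]
    rfl
  simp_rw [h1]
  rw [hX.lintegral_expNeg_tsum hc (v := fun x => B.indicator (fun _ => ∞) x + v x)
    ((measurable_const.indicator hB).add hv), ← expNeg_add, ← mul_add]
  congr 2
  rw [← lintegral_add_compl _ hB]
  congr 1
  · rw [← setLIntegral_one]
    refine setLIntegral_congr_fun hB fun x hx => ?_
    simp [Set.indicator_of_mem hx, expNeg_top]
  · refine setLIntegral_congr_fun hB.compl fun x hx => ?_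
    simp [Set.indicator_of_notMem hx]

/-- The open disc is the right one here: the infimum of the distances is at least `t` exactly when
no point lies in it, whether or not the infimum is attained. -/
lemma IsHomogeneousPPP.measure_le_nearestDist (hX : IsHomogeneousPPP X c μ) (hc : 0 ≤ c)
    {t : ℝ} (ht : 0 ≤ t) :
    μ {ω | t ≤ nearestDist X ω} = ENNReal.ofReal (Real.exp (-(Real.pi * c * t ^ 2))) := by
  have h := hX.lintegral_void hc (measurableSet_ball (x := (0 : Plane)) (ε := t))
    (v := fun _ => 0) measurable_const
  have hs : {ω | ∀ n, X n ω ∉ Metric.ball (0 : Plane) t} = {ω | t ≤ nearestDist X ω} := by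
    ext ω
    simp only [Set.mem_ofPred_eq, mem_ball_zero_iff, not_lt]
    exact ⟨fun h => le_ciInf h, fun h n => h.trans (nearestDist_le ω n)⟩
  have hm : MeasurableSet {ω | t ≤ nearestDist X ω} :=
    measurableSet_le measurable_const (measurable_nearestDist hX.measurable)
  simp only [tsum_zero, expNeg_zero, mul_one, tsub_self, lintegral_const, zero_mul, mul_zero] at h
  rw [hs, lintegral_indicator_one hm, volume_ball_plane ht, ← ENNReal.ofReal_mul hc,
    expNeg_ofReal (by positivity)] at h
  rw [h]; ring_nf

/-- Void probabilities determine the law through its values on the half-lines `[t, ∞)`; negative `t`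
are trivial. -/
lemma IsHomogeneousPPP.map_nearestDist (hX : IsHomogeneousPPP X c μ) (hc : 0 < c) :
    μ.map (nearestDist X) = rayleigh (Real.pi * c) := by
  have hm := measurable_nearestDist hX.measurable
  have hb : 0 < Real.pi * c := by positivity
  have := isProbabilityMeasure_rayleigh hb
  have := Measure.isProbabilityMeasure_map (μ := μ) hm.aemeasurable
  refine Measure.ext_of_Ici _ _ fun t => ?_
  rw [Measure.map_apply hm measurableSet_Ici]
  rcases le_or_gt 0 t with ht | ht
  · rw [← measure_congr Ioi_ae_eq_Ici, rayleigh_Ioi hb ht,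
      ← hX.measure_le_nearestDist hc.le ht]
    rfl
  · have h1 : nearestDist X ⁻¹' Set.Ici t = Set.univ :=
      Set.eq_univ_of_forall fun ω => ht.le.trans (nearestDist_nonneg ω)
    rw [h1, measure_univ]
    refine (le_antisymm prob_le_one ?_).symm
    rw [← measure_univ (μ := rayleigh (Real.pi * c)), ← Set.Iic_union_Ioi (a := (0 : ℝ))]
    refine (measure_union_le _ _).trans ?_
    rw [rayleigh_Iic_zero, zero_add]
    exact measure_mono fun r hr => ht.le.trans (le_of_lt hr)

lemma IsHomogeneousPPP.nearestDist_ne (hX : IsHomogeneousPPP X c μ) (hc : 0 < c) (t : ℝ) :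
    ∀ᵐ ω ∂μ, nearestDist X ω ≠ t := by
  have h : μ.map (nearestDist X) {t} = 0 := by rw [hX.map_nearestDist hc]; simp
  rw [Measure.map_apply (measurable_nearestDist hX.measurable) (measurableSet_singleton t)] at h
  exact measure_eq_zero_iff_ae_notMem.1 h

lemma IsHomogeneousPPP.nearestDist_pos (hX : IsHomogeneousPPP X c μ) (hc : 0 < c) :
    ∀ᵐ ω ∂μ, 0 < nearestDist X ω := by
  filter_upwards [hX.nearestDist_ne hc 0] with ω h
  exact lt_of_le_of_ne (nearestDist_nonneg ω) h.symm

/-- Laplace functional on the event that a disc is empty. -/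
lemma IsHomogeneousPPP.lintegral_lt_nearestDist (hX : IsHomogeneousPPP X c μ) (hc : 0 < c)
    {t : ℝ} (ht : 0 ≤ t) {v : Plane → ℝ≥0∞} (hv : Measurable v) :
    ∫⁻ ω, {ω | t < nearestDist X ω}.indicator 1 ω * expNeg (∑' n, v (X n ω)) ∂μ =
      ENNReal.ofReal (Real.exp (-(Real.pi * c * t ^ 2))) *
        expNeg (ENNReal.ofReal c * ∫⁻ x in {x | t < ‖x‖}, (1 - expNeg (v x))) := by
  have h := hX.lintegral_void hc.le (measurableSet_closedBall (x := (0 : Plane)) (ε := t)) hv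
  have hB : (Metric.closedBall (0 : Plane) t)ᶜ = {x | t < ‖x‖} := by ext x; simp
  rw [hB, Measure.addHaar_closedBall_eq_addHaar_ball, volume_ball_plane ht,
    ← ENNReal.ofReal_mul hc.le, expNeg_ofReal (by positivity)] at h
  rw [show Real.pi * c * t ^ 2 = c * (Real.pi * t ^ 2) by ring, ← h]
  -- If the infimum is not attained, it may equal `t` while the closed disc is empty. The two events
  -- then differ, but only on the null event that the distance is `t`.
  refine lintegral_congr_ae ?_
  filter_upwards [hX.nearestDist_ne hc t] with ω hω
  congr 1
  have : ω ∈ {ω | t < nearestDist X ω} ↔ ω ∈ {ω | ∀ n, X n ω ∉ Metric.closedBall (0 : Plane) t} := by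
    simp only [Set.mem_ofPred_eq, mem_closedBall_zero_iff, not_le]
    refine ⟨fun h n => h.trans_le (nearestDist_le ω n), fun h => ?_⟩
    exact lt_of_le_of_ne (le_ciInf fun n => (h n).le) hω.symm
  by_cases hm : ω ∈ {ω | t < nearestDist X ω}
  · rw [Set.indicator_of_mem hm, Set.indicator_of_mem (this.1 hm)]
  · rw [Set.indicator_of_notMem hm, Set.indicator_of_notMem (fun h => hm (this.2 h))]

end Nearest

/-! ### Joint law of the nearest point and the remaining points -/

section Residual

variable {Ω : Type*} [MeasurableSpace Ω] {μ : Measure Ω} {X : ℕ → Ω → Plane} {c : ℝ}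

/-- `W l` outside the closed disc of radius `u`, zero inside. -/
noncomputable def outside (W : ℝ → Plane → ℝ≥0∞) (u l : ℝ) (x : Plane) : ℝ≥0∞ :=
  {x : Plane | u < ‖x‖}.indicator (W l) x

/-- Laplace functional of the Poisson process at `outside W u l`. -/
noncomputable def outsideLaplace (c : ℝ) (W : ℝ → Plane → ℝ≥0∞) (u l : ℝ) : ℝ≥0∞ :=
  expNeg (ENNReal.ofReal c * ∫⁻ x, (1 - expNeg (outside W u l x)))

lemma measurable_outside {W : ℝ → Plane → ℝ≥0∞} (hW : Measurable (Function.uncurry W)) :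
    Measurable fun p : ℝ × ℝ × Plane => outside W p.1 p.2.1 p.2.2 := by
  have : (fun p : ℝ × ℝ × Plane => outside W p.1 p.2.1 p.2.2) =
      {p : ℝ × ℝ × Plane | p.1 < ‖p.2.2‖}.indicator fun p => Function.uncurry W p.2 := by
    ext p; rfl
  rw [this]
  exact (hW.comp measurable_snd).indicator (measurableSet_lt (by fun_prop) (by fun_prop))

lemma measurable_outside_comp {α : Type*} [MeasurableSpace α] {W : ℝ → Plane → ℝ≥0∞}
    (hW : Measurable (Function.uncurry W)) {u l : α → ℝ} {x : α → Plane} (hu : Measurable u)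
    (hl : Measurable l) (hx : Measurable x) : Measurable fun a => outside W (u a) (l a) (x a) :=
  (measurable_outside hW).comp (hu.prodMk (hl.prodMk hx))

lemma measurable_outsideLaplace {W : ℝ → Plane → ℝ≥0∞} (hW : Measurable (Function.uncurry W)) :
    Measurable fun p : ℝ × ℝ => outsideLaplace c W p.1 p.2 := by
  refine measurable_expNeg.comp (Measurable.const_mul ?_ _)
  refine Measurable.lintegral_prod_right' (f := fun p : (ℝ × ℝ) × Plane =>
    1 - expNeg (outside W p.1.1 p.1.2 p.2)) ?_
  refine measurable_const.sub (measurable_expNeg.comp ?_)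
  exact (measurable_outside hW).comp
    ((measurable_fst.comp measurable_fst).prodMk
      ((measurable_snd.comp measurable_fst).prodMk measurable_snd))

lemma measurable_outsideLaplace_comp {α : Type*} [MeasurableSpace α] {W : ℝ → Plane → ℝ≥0∞}
    (hW : Measurable (Function.uncurry W)) {u l : α → ℝ} (hu : Measurable u)
    (hl : Measurable l) : Measurable fun a => outsideLaplace c W (u a) (l a) :=
  Measurable.comp (g := fun p : ℝ × ℝ => outsideLaplace c W p.1 p.2) (f := fun a => (u a, l a))
    (measurable_outsideLaplace hW) (hu.prodMk hl)

lemma outsideLaplace_le_one (W : ℝ → Plane → ℝ≥0∞) (u l : ℝ) : outsideLaplace c W u l ≤ 1 :=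
  expNeg_le_one _

variable [IsProbabilityMeasure μ]

/-- The weight lives outside the disc of radius `u ≥ t`, hence is independent of what happens in the
disc of radius `t`. -/
lemma IsHomogeneousPPP.lintegral_lt_nearestDist_outside (hX : IsHomogeneousPPP X c μ) (hc : 0 < c)
    {W : ℝ → Plane → ℝ≥0∞} (hW : Measurable (Function.uncurry W)) {t u : ℝ} (ht : 0 ≤ t)
    (htu : t ≤ u) (l : ℝ) :
    ∫⁻ ω in {ω | t < nearestDist X ω}, expNeg (∑' n, outside W u l (X n ω)) ∂μ =
      μ {ω | t < nearestDist X ω} * outsideLaplace c W u l := by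
  have hm : MeasurableSet {ω | t < nearestDist X ω} :=
    measurableSet_lt measurable_const (measurable_nearestDist hX.measurable)
  have key : ∀ v : Plane → ℝ≥0∞, Measurable v →
      ∫⁻ ω in {ω | t < nearestDist X ω}, expNeg (∑' n, v (X n ω)) ∂μ =
      ENNReal.ofReal (Real.exp (-(Real.pi * c * t ^ 2))) *
        expNeg (ENNReal.ofReal c * ∫⁻ x in {x | t < ‖x‖}, (1 - expNeg (v x))) := by
    intro v hv
    rw [← hX.lintegral_lt_nearestDist hc ht hv, ← lintegral_indicator hm]
    refine lintegral_congr fun ω => ?_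
    by_cases hω : ω ∈ {ω | t < nearestDist X ω}
    · simp [Set.indicator_of_mem hω]
    · simp [Set.indicator_of_notMem hω]
  have h1 := key (outside W u l) (measurable_outside_comp hW measurable_const measurable_const measurable_id)
  have h0 := key (fun _ => 0) measurable_const
  simp only [tsum_zero, expNeg_zero, tsub_self, lintegral_zero,
    mul_zero, mul_one, lintegral_one, Measure.restrict_apply_univ] at h0
  rw [h1, h0, outsideLaplace]
  congr 3
  rw [← lintegral_indicator (measurableSet_lt measurable_const measurable_norm)]
  refine lintegral_congr fun x => ?_
  by_cases hx : t < ‖x‖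
  · exact Set.indicator_of_mem (s := {x : Plane | t < ‖x‖}) hx _
  · rw [Set.indicator_of_notMem (s := {x : Plane | t < ‖x‖}) hx, outside,
      Set.indicator_of_notMem (s := {x : Plane | u < ‖x‖}) fun h => hx (htu.trans_lt h),
      expNeg_zero, tsub_self]

/-- Difference of the preceding identity at `t` and at `u`, with the same weight; the subtracted
term is finite. -/
lemma IsHomogeneousPPP.lintegral_Ioc_nearestDist_outside (hX : IsHomogeneousPPP X c μ) (hc : 0 < c)
    {W : ℝ → Plane → ℝ≥0∞} (hW : Measurable (Function.uncurry W)) {t u : ℝ} (ht : 0 ≤ t)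
    (htu : t ≤ u) (l : ℝ) :
    ∫⁻ ω in nearestDist X ⁻¹' Set.Ioc t u, expNeg (∑' n, outside W u l (X n ω)) ∂μ =
      ∫⁻ _ in nearestDist X ⁻¹' Set.Ioc t u, outsideLaplace c W u l ∂μ := by
  have hm := measurable_nearestDist hX.measurable
  have h1 := hX.lintegral_lt_nearestDist_outside hc hW ht htu l
  have h2 := hX.lintegral_lt_nearestDist_outside hc hW (ht.trans htu) le_rfl l
  have hU : {ω | t < nearestDist X ω} =
      nearestDist X ⁻¹' Set.Ioc t u ∪ {ω | u < nearestDist X ω} := by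
    ext ω
    simp only [Set.mem_ofPred_eq, Set.mem_union, Set.mem_preimage, Set.mem_Ioc]
    constructor
    · intro h
      rcases le_or_gt (nearestDist X ω) u with h' | h'
      · exact Or.inl ⟨h, h'⟩
      · exact Or.inr h'
    · rintro (h | h)
      · exact h.1
      · exact htu.trans_lt h
  have hd : Disjoint (nearestDist X ⁻¹' Set.Ioc t u) {ω | u < nearestDist X ω} :=
    Set.disjoint_left.2 fun ω h h' => not_lt.2 h.2 h'
  have hm2 : MeasurableSet {ω | u < nearestDist X ω} := measurableSet_lt measurable_const hm
  rw [hU, lintegral_union hm2 hd, measure_union hd hm2, h2, add_mul] at h1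
  rw [setLIntegral_const, mul_comm]
  exact (ENNReal.add_left_inj (ENNReal.mul_ne_top (measure_ne_top _ _)
    (expNeg_ne_top _))).1 h1

/-- Index of the cell `(t + j / 2 ^ m, t + (j + 1) / 2 ^ m]` that contains `r`. -/
noncomputable def cellIndex (t : ℝ) (m : ℕ) (r : ℝ) : ℤ := ⌈(r - t) * 2 ^ m⌉ - 1

/-- Lower end of the cell of `r`. -/
noncomputable def cellLower (t : ℝ) (m : ℕ) (r : ℝ) : ℝ := t + cellIndex t m r / 2 ^ m

/-- Upper end of the cell of `r`. -/
noncomputable def cellUpper (t : ℝ) (m : ℕ) (r : ℝ) : ℝ := t + (cellIndex t m r + 1) / 2 ^ m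

lemma cellLower_lt (t : ℝ) (m : ℕ) (r : ℝ) : cellLower t m r < r := by
  have h := Int.ceil_lt_add_one ((r - t) * 2 ^ m)
  have h2 : (0 : ℝ) < 2 ^ m := by positivity
  have : ((cellIndex t m r : ℤ) : ℝ) / 2 ^ m < r - t := by
    rw [div_lt_iff₀ h2, cellIndex]; push_cast; linarith
  rw [cellLower]; linarith

lemma le_cellUpper (t : ℝ) (m : ℕ) (r : ℝ) : r ≤ cellUpper t m r := by
  have h := Int.le_ceil ((r - t) * 2 ^ m)
  have h2 : (0 : ℝ) < 2 ^ m := by positivity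
  have : r - t ≤ ((cellIndex t m r : ℤ) + 1 : ℝ) / 2 ^ m := by
    rw [le_div_iff₀ h2, cellIndex]; push_cast; linarith
  rw [cellUpper]; linarith

lemma cellUpper_eq (t : ℝ) (m : ℕ) (r : ℝ) : cellUpper t m r = cellLower t m r + (1 / 2) ^ m := by
  rw [cellUpper, cellLower, add_div, one_div_pow]; ring

lemma tendsto_cellLower (t r : ℝ) : Tendsto (fun m => cellLower t m r) atTop (𝓝 r) := by
  have h : Tendsto (fun m : ℕ => r - (1 / 2 : ℝ) ^ m) atTop (𝓝 r) := by
    simpa using tendsto_const_nhds.sub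
      (tendsto_pow_atTop_nhds_zero_of_lt_one (by norm_num : (0 : ℝ) ≤ 1 / 2) (by norm_num))
  refine tendsto_of_tendsto_of_tendsto_of_le_of_le h tendsto_const_nhds (fun m => ?_)
    fun m => (cellLower_lt t m r).le
  have h1 := le_cellUpper t m r
  rw [cellUpper_eq] at h1
  simp only
  linarith

lemma tendsto_cellUpper (t r : ℝ) : Tendsto (fun m => cellUpper t m r) atTop (𝓝 r) := by
  simp_rw [cellUpper_eq]
  simpa using (tendsto_cellLower t r).add
    (tendsto_pow_atTop_nhds_zero_of_lt_one (by norm_num : (0 : ℝ) ≤ 1 / 2) (by norm_num))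

/-- The dyadic grids are nested, so the cell of `r` shrinks as `m` grows. -/
lemma monotone_cellLower (t r : ℝ) : Monotone fun m => cellLower t m r := by
  refine monotone_nat_of_le_succ fun m => ?_
  have h2 : (0 : ℝ) < 2 ^ (m + 1) := by positivity
  have h : 2 * (cellIndex t m r) < ⌈(r - t) * 2 ^ (m + 1)⌉ := by
    rw [Int.lt_ceil]
    have := Int.ceil_lt_add_one ((r - t) * 2 ^ m)
    rw [cellIndex]; push_cast
    rw [pow_succ]; linarith
  have h' : 2 * cellIndex t m r ≤ cellIndex t (m + 1) r := by
    rw [cellIndex.eq_1 t (m + 1)]; omega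
  have h'' : (2 * cellIndex t m r : ℝ) ≤ cellIndex t (m + 1) r := by exact_mod_cast h'
  rw [cellLower, cellLower]
  have : (cellIndex t m r : ℝ) / 2 ^ m = (2 * cellIndex t m r) / 2 ^ (m + 1) := by
    rw [pow_succ]; field_simp
  rw [this]
  gcongr

lemma antitone_cellUpper (t r : ℝ) : Antitone fun m => cellUpper t m r := by
  refine antitone_nat_of_succ_le fun m => ?_
  have h2 : (0 : ℝ) < 2 ^ (m + 1) := by positivity
  have h : ⌈(r - t) * 2 ^ (m + 1)⌉ ≤ 2 * ⌈(r - t) * 2 ^ m⌉ := by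
    rw [Int.ceil_le]
    have := Int.le_ceil ((r - t) * 2 ^ m)
    push_cast
    rw [pow_succ]; linarith
  have h' : cellIndex t (m + 1) r + 1 ≤ 2 * (cellIndex t m r + 1) := by
    rw [cellIndex, cellIndex]; omega
  have h'' : (cellIndex t (m + 1) r + 1 : ℝ) ≤ 2 * (cellIndex t m r + 1) := by exact_mod_cast h'
  rw [cellUpper, cellUpper]
  have : (cellIndex t m r + 1 : ℝ) / 2 ^ m = (2 * (cellIndex t m r + 1)) / 2 ^ (m + 1) := by
    rw [pow_succ]; field_simp
  rw [this]
  gcongr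

lemma measurable_cellIndex (t : ℝ) (m : ℕ) : Measurable (cellIndex t m) :=
  (Int.measurable_ceil.comp (by fun_prop : Measurable fun r : ℝ => (r - t) * 2 ^ m)).sub_const 1

lemma measurable_cellLower (t : ℝ) (m : ℕ) : Measurable (cellLower t m) :=
  (((measurable_of_countable (fun z : ℤ => (z : ℝ))).comp (measurable_cellIndex t m)).div_const
    _).const_add t

lemma measurable_cellUpper (t : ℝ) (m : ℕ) : Measurable (cellUpper t m) :=
  ((((measurable_of_countable (fun z : ℤ => (z : ℝ))).comp (measurable_cellIndex t m)).add_const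
    1).div_const _).const_add t

lemma cellIndex_nonneg {t r : ℝ} (h : t < r) (m : ℕ) : 0 ≤ cellIndex t m r := by
  have : 0 < ⌈(r - t) * 2 ^ m⌉ := Int.ceil_pos.2 (mul_pos (sub_pos.2 h) (by positivity))
  rw [cellIndex]; omega

lemma le_cellLower {t r : ℝ} (h : t < r) (m : ℕ) : t ≤ cellLower t m r := by
  have : (0 : ℝ) ≤ cellIndex t m r := by exact_mod_cast cellIndex_nonneg h m
  rw [cellLower]
  have : 0 ≤ (cellIndex t m r : ℝ) / 2 ^ m := by positivity
  linarith

lemma cellIndex_eq_iff {t r : ℝ} {m : ℕ} {j : ℤ} :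
    cellIndex t m r = j ↔ r ∈ Set.Ioc (t + j / 2 ^ m) (t + (j + 1) / 2 ^ m) := by
  have h2 : (0 : ℝ) < 2 ^ m := by positivity
  rw [cellIndex, sub_eq_iff_eq_add, Int.ceil_eq_iff, Set.mem_Ioc]
  push_cast
  rw [← lt_sub_iff_add_lt', ← sub_le_iff_le_add', ← sub_le_iff_le_add' (a := r), div_lt_iff₀ h2, le_div_iff₀ h2,
    add_sub_cancel_right, ← sub_le_iff_le_add' (b := (j : ℝ))]

/-- If `r < ‖x‖`, the upper end of the cell is eventually below `‖x‖`. If `‖x‖ ≤ r`, all terms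
vanish because `r` never exceeds the upper end; this is why cells are closed on the right. -/
lemma tendsto_outside {W : ℝ → Plane → ℝ≥0∞} (hWc : ∀ x, Continuous fun r => W r x) (t r : ℝ)
    (x : Plane) :
    Tendsto (fun m => outside W (cellUpper t m r) (cellLower t m r) x) atTop
      (𝓝 (outside W r r x)) := by
  by_cases hx : r < ‖x‖
  · rw [outside, Set.indicator_of_mem (s := {x : Plane | r < ‖x‖}) hx]
    refine (((hWc x).tendsto r).comp (tendsto_cellLower t r)).congr' ?_
    filter_upwards [(tendsto_cellUpper t r).eventually_lt_const hx] with m hm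
    rw [outside, Set.indicator_of_mem (s := {x : Plane | cellUpper t m r < ‖x‖}) hm]
    rfl
  · have : ∀ m, outside W (cellUpper t m r) (cellLower t m r) x = 0 := fun m =>
      Set.indicator_of_notMem (s := {x : Plane | cellUpper t m r < ‖x‖})
        (fun h => hx ((le_cellUpper t m r).trans_lt h)) _
    simp_rw [this]
    rw [outside, Set.indicator_of_notMem (s := {x : Plane | r < ‖x‖}) hx]
    exact tendsto_const_nhds

/-- Refinement lowers the cutoff radius and raises the argument of `W`; both increase the weight.
Cutoff and argument are therefore taken at opposite ends of the cell. -/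
lemma monotone_outside {W : ℝ → Plane → ℝ≥0∞}
    (hWm : ∀ x, MonotoneOn (fun r => W r x) (Set.Ici 0)) {t r : ℝ} (ht : 0 ≤ t) (htr : t < r)
    (x : Plane) : Monotone fun m => outside W (cellUpper t m r) (cellLower t m r) x := by
  intro m n hmn
  simp only [outside]
  have h1 : {x : Plane | cellUpper t m r < ‖x‖}.indicator (W (cellLower t m r)) x ≤
      {x : Plane | cellUpper t m r < ‖x‖}.indicator (W (cellLower t n r)) x := by
    by_cases hx : x ∈ {x : Plane | cellUpper t m r < ‖x‖}
    · rw [Set.indicator_of_mem hx, Set.indicator_of_mem hx]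
      exact hWm x (ht.trans (le_cellLower htr m)) (ht.trans (le_cellLower htr n))
        (monotone_cellLower t r hmn)
    · rw [Set.indicator_of_notMem hx, Set.indicator_of_notMem hx]
  refine h1.trans (Set.indicator_le_indicator_of_subset ?_ (fun _ => zero_le) x)
  exact fun y hy => (antitone_cellUpper t r hmn).trans_lt hy

/-- On each cell its ends are constants, so the identity for a fixed interval applies; the countably
many cells above `t` are then added up. -/
lemma IsHomogeneousPPP.lintegral_cells (hX : IsHomogeneousPPP X c μ) (hc : 0 < c)
    {W : ℝ → Plane → ℝ≥0∞} (hW : Measurable (Function.uncurry W)) {t : ℝ} (ht : 0 ≤ t) (m : ℕ) :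
    ∫⁻ ω in nearestDist X ⁻¹' Set.Ioi t, expNeg (∑' n, outside W (cellUpper t m (nearestDist X ω))
        (cellLower t m (nearestDist X ω)) (X n ω)) ∂μ =
      ∫⁻ ω in nearestDist X ⁻¹' Set.Ioi t, outsideLaplace c W (cellUpper t m (nearestDist X ω))
        (cellLower t m (nearestDist X ω)) ∂μ := by
  have hm := measurable_nearestDist hX.measurable
  set C : ℕ → Set Ω := fun j =>
    nearestDist X ⁻¹' Set.Ioc (t + ((j : ℤ) : ℝ) / 2 ^ m) (t + (((j : ℤ) : ℝ) + 1) / 2 ^ m) with hC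
  have hCi : ∀ j ω, ω ∈ C j ↔ cellIndex t m (nearestDist X ω) = (j : ℤ) := fun j ω =>
    cellIndex_eq_iff.symm
  have hU : nearestDist X ⁻¹' Set.Ioi t = ⋃ j, C j := by
    ext ω
    simp only [Set.mem_iUnion, hCi, Set.mem_preimage, Set.mem_Ioi]
    constructor
    · intro h
      exact ⟨(cellIndex t m (nearestDist X ω)).toNat, (Int.toNat_of_nonneg
        (cellIndex_nonneg h m)).symm⟩
    · rintro ⟨j, hj⟩
      have h1 := cellLower_lt t m (nearestDist X ω)
      rw [cellLower, hj] at h1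
      have : (0 : ℝ) ≤ ((j : ℤ) : ℝ) / 2 ^ m := by positivity
      linarith
  have hCm : ∀ j, MeasurableSet (C j) := fun j => hm measurableSet_Ioc
  have hCd : Pairwise (Function.onFun Disjoint C) := by
    intro i j hij
    refine Set.disjoint_left.2 fun ω h1 h2 => hij ?_
    rw [hCi] at h1 h2
    exact_mod_cast h1.symm.trans h2
  rw [hU, lintegral_iUnion hCm hCd, lintegral_iUnion hCm hCd]
  refine tsum_congr fun j => ?_
  have hj : (0 : ℝ) ≤ ((j : ℤ) : ℝ) / 2 ^ m := by positivity
  have key := hX.lintegral_Ioc_nearestDist_outside hc hW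
    (t := t + ((j : ℤ) : ℝ) / 2 ^ m) (u := t + (((j : ℤ) : ℝ) + 1) / 2 ^ m) (by linarith)
    (by gcongr; linarith) (t + ((j : ℤ) : ℝ) / 2 ^ m)
  refine Eq.trans (setLIntegral_congr_fun (hCm j) fun ω hω => ?_)
    (key.trans (setLIntegral_congr_fun (hCm j) fun ω hω => ?_).symm)
  · simp only [cellUpper, cellLower, (hCi j ω).1 hω]
  · simp only [cellUpper, cellLower, (hCi j ω).1 hω]

/-- Both sides of the discretized identity converge as the cells shrink to the distance itself:
monotone convergence inside the exponentials, dominated convergence outside. -/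
lemma IsHomogeneousPPP.setLIntegral_Ioi_outside (hX : IsHomogeneousPPP X c μ) (hc : 0 < c)
    {W : ℝ → Plane → ℝ≥0∞} (hW : Measurable (Function.uncurry W))
    (hWm : ∀ x, MonotoneOn (fun r => W r x) (Set.Ici 0)) (hWc : ∀ x, Continuous fun r => W r x)
    {t : ℝ} (ht : 0 ≤ t) :
    ∫⁻ ω in nearestDist X ⁻¹' Set.Ioi t,
        expNeg (∑' n, outside W (nearestDist X ω) (nearestDist X ω) (X n ω)) ∂μ =
      ∫⁻ ω in nearestDist X ⁻¹' Set.Ioi t,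
        outsideLaplace c W (nearestDist X ω) (nearestDist X ω) ∂μ := by
  have hm := measurable_nearestDist hX.measurable
  have hmt : MeasurableSet (nearestDist X ⁻¹' Set.Ioi t) := hm measurableSet_Ioi
  have h1 : Tendsto (fun m => ∫⁻ ω in nearestDist X ⁻¹' Set.Ioi t,
      expNeg (∑' n, outside W (cellUpper t m (nearestDist X ω))
        (cellLower t m (nearestDist X ω)) (X n ω)) ∂μ) atTop
      (𝓝 (∫⁻ ω in nearestDist X ⁻¹' Set.Ioi t,
        expNeg (∑' n, outside W (nearestDist X ω) (nearestDist X ω) (X n ω)) ∂μ)) := by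
    refine tendsto_lintegral_of_dominated_convergence (fun _ => 1) (fun m => ?_)
      (fun m => ae_of_all _ fun ω => expNeg_le_one _) (by simp) ?_
    · exact measurable_expNeg.comp (Measurable.tsum fun n => measurable_outside_comp hW
        ((measurable_cellUpper t m).comp hm) ((measurable_cellLower t m).comp hm)
        (hX.measurable n))
    · refine (ae_restrict_iff' hmt).2 (ae_of_all _ fun ω hω => ?_)
      exact (continuous_expNeg.tendsto _).comp
        (tendsto_tsum_of_monotone (fun n => monotone_outside hWm ht hω (X n ω))
          fun n => tendsto_outside hWc t _ (X n ω))
  have h2 : Tendsto (fun m => ∫⁻ ω in nearestDist X ⁻¹' Set.Ioi t,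
      outsideLaplace c W (cellUpper t m (nearestDist X ω)) (cellLower t m (nearestDist X ω)) ∂μ)
      atTop (𝓝 (∫⁻ ω in nearestDist X ⁻¹' Set.Ioi t,
        outsideLaplace c W (nearestDist X ω) (nearestDist X ω) ∂μ)) := by
    refine tendsto_lintegral_of_dominated_convergence (fun _ => 1) (fun m => ?_)
      (fun m => ae_of_all _ fun ω => outsideLaplace_le_one _ _ _) (by simp) ?_
    · exact measurable_outsideLaplace_comp hW ((measurable_cellUpper t m).comp hm)
        ((measurable_cellLower t m).comp hm)
    · refine (ae_restrict_iff' hmt).2 (ae_of_all _ fun ω hω => ?_)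
      refine (continuous_expNeg.tendsto _).comp
        (ENNReal.Tendsto.const_mul ?_ (Or.inr ENNReal.ofReal_ne_top))
      refine lintegral_tendsto_of_tendsto_of_monotone (fun m => ?_) (ae_of_all _ fun x => ?_)
        (ae_of_all _ fun x => ?_)
      · exact (measurable_const.sub (measurable_expNeg.comp (measurable_outside_comp hW
          measurable_const measurable_const measurable_id))).aemeasurable
      · exact fun m n hmn => tsub_le_tsub_left
          (expNeg_antitone (monotone_outside hWm ht hω x hmn)) _
      · exact ENNReal.Tendsto.sub tendsto_const_nhds
          ((continuous_expNeg.tendsto _).comp (tendsto_outside hWc t _ x))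
          (Or.inl ENNReal.one_ne_top)
  simp_rw [hX.lintegral_cells hc hW ht] at h1
  exact tendsto_nhds_unique h1 h2

/-- Given the distance `r` of the nearest point, the other points form a Poisson point process
outside the disc of radius `r`. -/
theorem IsHomogeneousPPP.lintegral_nearestDist_outside (hX : IsHomogeneousPPP X c μ) (hc : 0 < c)
    {W : ℝ → Plane → ℝ≥0∞} (hW : Measurable (Function.uncurry W))
    (hWm : ∀ x, MonotoneOn (fun r => W r x) (Set.Ici 0)) (hWc : ∀ x, Continuous fun r => W r x)
    {φ : ℝ → ℝ≥0∞} (hφ : Measurable φ) :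
    ∫⁻ ω, φ (nearestDist X ω) *
        expNeg (∑' n, outside W (nearestDist X ω) (nearestDist X ω) (X n ω)) ∂μ =
      ∫⁻ r, φ r * outsideLaplace c W r r ∂rayleigh (Real.pi * c) := by
  have hm := measurable_nearestDist hX.measurable
  set V : Ω → ℝ≥0∞ := fun ω =>
    expNeg (∑' n, outside W (nearestDist X ω) (nearestDist X ω) (X n ω)) with hV
  set L : Ω → ℝ≥0∞ := fun ω => outsideLaplace c W (nearestDist X ω) (nearestDist X ω) with hL
  have hVm : Measurable V := measurable_expNeg.comp (Measurable.tsum fun n =>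
    measurable_outside_comp hW hm hm (hX.measurable n))
  have hLr : Measurable fun r => outsideLaplace c W r r :=
    measurable_outsideLaplace_comp hW measurable_id measurable_id
  have hLm : Measurable L := hLr.comp hm
  -- The two sides of the claim are integrals of `φ` against the images of `μ` with densities `V`
  -- and `L` under the distance. It is enough that these finite measures agree on half-lines.
  have hIoi : ∀ t : ℝ, 0 ≤ t → ((μ.withDensity V).map (nearestDist X)) (Set.Ioi t) =
      ((μ.withDensity L).map (nearestDist X)) (Set.Ioi t) := by
    intro t ht
    rw [Measure.map_apply hm measurableSet_Ioi, Measure.map_apply hm measurableSet_Ioi,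
      withDensity_apply _ (hm measurableSet_Ioi), withDensity_apply _ (hm measurableSet_Ioi)]
    exact hX.setLIntegral_Ioi_outside hc hW hWm hWc ht
  have hneg : ∀ (U : Ω → ℝ≥0∞) (t : ℝ), t ≤ 0 →
      ((μ.withDensity U).map (nearestDist X)) (Set.Ioi t) =
      ((μ.withDensity U).map (nearestDist X)) (Set.Ioi 0) := by
    intro U t ht
    rw [Measure.map_apply hm measurableSet_Ioi, Measure.map_apply hm measurableSet_Ioi]
    refine measure_congr ((withDensity_absolutelyContinuous μ U).ae_le ?_)
    filter_upwards [hX.nearestDist_pos hc] with ω hω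
    exact propext ⟨fun _ => hω, fun _ => ht.trans_lt hω⟩
  have hIoi' : ∀ t : ℝ, ((μ.withDensity V).map (nearestDist X)) (Set.Ioi t) =
      ((μ.withDensity L).map (nearestDist X)) (Set.Ioi t) := by
    intro t
    rcases le_total 0 t with ht | ht
    · exact hIoi t ht
    · rw [hneg V t ht, hneg L t ht, hIoi 0 le_rfl]
  have fin : ∀ U : Ω → ℝ≥0∞, (∀ ω, U ω ≤ 1) → IsFiniteMeasure (μ.withDensity U) := fun U hU =>
    isFiniteMeasure_withDensity (ne_top_of_le_ne_top (by simp) (lintegral_mono hU))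
  have := fin V fun ω => expNeg_le_one _
  have := fin L fun ω => expNeg_le_one _
  have huniv : ((μ.withDensity V).map (nearestDist X)) Set.univ =
      ((μ.withDensity L).map (nearestDist X)) Set.univ := by
    have h : ∀ U : Ω → ℝ≥0∞, ((μ.withDensity U).map (nearestDist X)) Set.univ =
        ((μ.withDensity U).map (nearestDist X)) (Set.Ioi (-1)) := by
      intro U
      rw [Measure.map_apply hm measurableSet_Ioi, Measure.map_apply hm MeasurableSet.univ]
      congr 1
      refine (Set.eq_univ_of_forall fun ω => ?_).symm
      exact lt_of_lt_of_le (by norm_num) (nearestDist_nonneg ω)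
    rw [h, h, hIoi']
  have hmeas : (μ.withDensity V).map (nearestDist X) = (μ.withDensity L).map (nearestDist X) := by
    refine Measure.ext_of_Iic _ _ fun t => ?_
    rw [← Set.compl_Ioi, measure_compl measurableSet_Ioi (measure_ne_top _ _),
      measure_compl measurableSet_Ioi (measure_ne_top _ _), hIoi', huniv]
  have hint : ∀ U : Ω → ℝ≥0∞, Measurable U →
      ∫⁻ ω, φ (nearestDist X ω) * U ω ∂μ = ∫⁻ r, φ r ∂(μ.withDensity U).map (nearestDist X) := by
    intro U hU
    rw [lintegral_map hφ hm]
    refine Eq.trans ?_ (lintegral_withDensity_eq_lintegral_mul μ hU (hφ.comp hm)).symm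
    exact lintegral_congr fun ω => mul_comm _ _
  rw [hint V hVm, hmeas, ← hint L hLm, ← hX.map_nearestDist hc]
  exact (lintegral_map (hφ.mul hLr) hm).symm

end Residual

/-! ### Radial integrals -/

/-- Polar coordinates: the unit circle has mass twice the area of the unit disc, that is `2 π`. -/
lemma lintegral_norm_plane {g : ℝ → ℝ≥0∞} (hg : Measurable g) :
    ∫⁻ x : Plane, g ‖x‖ = ∫⁻ r in Set.Ioi 0, ENNReal.ofReal (2 * Real.pi * r) * g r := by
  have hdim : Module.finrank ℝ Plane = 2 := by simp
  have h1 : ∫⁻ x : Plane, g ‖x‖ =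
      ∫⁻ x : ({(0)}ᶜ : Set Plane), g ‖x.1‖ ∂(volume.comap (fun x : ({(0)}ᶜ : Set Plane) => (x : Plane))) := by
    rw [lintegral_subtype_comap (measurableSet_singleton _).compl fun x : Plane ↦ g (‖x‖),
      restrict_compl_singleton]
  have h2 : ∫⁻ x : ({(0)}ᶜ : Set Plane), g ‖x.1‖ ∂(volume.comap (fun x : ({(0)}ᶜ : Set Plane) => (x : Plane))) =
      ∫⁻ x : Metric.sphere (0 : Plane) 1 × Set.Ioi (0 : ℝ), g x.2
        ∂(volume : Measure Plane).toSphere.prod (.volumeIoiPow (Module.finrank ℝ Plane - 1)) := by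
    rw [← ((volume : Measure Plane).measurePreserving_homeomorphUnitSphereProd).lintegral_comp_emb
      (Homeomorph.measurableEmbedding _)]
    simp
  rw [h1, h2, lintegral_prod _ (by fun_prop)]
  simp only [lintegral_const]
  rw [Measure.toSphere_apply_univ, hdim, Measure.volumeIoiPow,
    lintegral_withDensity_eq_lintegral_mul _ (by fun_prop) (by fun_prop)]
  simp only [Pi.mul_apply]
  rw [lintegral_subtype_comap measurableSet_Ioi fun r : ℝ =>
    ENNReal.ofReal (r ^ (2 - 1)) * g r, mul_comm, ← lintegral_const_mul _ (by fun_prop)]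
  refine setLIntegral_congr_fun measurableSet_Ioi fun r hr => ?_
  have hr0 : (0 : ℝ) < r := hr
  rw [volume_ball_plane zero_le_one, ← mul_assoc]
  congr 1
  rw [← ENNReal.ofReal_natCast, ← ENNReal.ofReal_mul (by positivity),
    ← ENNReal.ofReal_mul (by positivity)]
  congr 1
  norm_num

lemma setLIntegral_norm_plane {g : ℝ → ℝ≥0∞} (hg : Measurable g) {a : ℝ} (ha : 0 ≤ a) :
    ∫⁻ x in {x : Plane | a < ‖x‖}, g ‖x‖ =
      ∫⁻ r in Set.Ioi a, ENNReal.ofReal (2 * Real.pi * r) * g r := by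
  have h := lintegral_norm_plane (hg.indicator (measurableSet_Ioi (a := a)))
  rw [← lintegral_indicator (measurableSet_lt measurable_const measurable_norm)]
  have e : ∀ x : Plane, ({x : Plane | a < ‖x‖}.indicator (fun x => g ‖x‖) x) =
      (Set.Ioi a).indicator g ‖x‖ := fun x => rfl
  simp_rw [e]
  rw [h, ← lintegral_indicator measurableSet_Ioi, ← lintegral_indicator measurableSet_Ioi]
  refine lintegral_congr fun r => ?_
  by_cases hr : a < r
  · simp [Set.indicator_of_mem (show r ∈ Set.Ioi a from hr),
      Set.indicator_of_mem (show r ∈ Set.Ioi (0 : ℝ) from ha.trans_lt hr)]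
  · simp [Set.indicator, hr]

/-- Outage kernel: `1 - 𝔼 exp (-y H x ^ (-η))` for an exponential `H`. -/
noncomputable def kernel (η y x : ℝ) : ℝ := y * x ^ (-η) / (1 + y * x ^ (-η))

lemma one_sub_kernel {η y x : ℝ} (hy : 0 ≤ y) (hx : 0 ≤ x) :
    1 - (1 + y * x ^ (-η))⁻¹ = kernel η y x := by
  have : 0 ≤ y * x ^ (-η) := mul_nonneg hy (Real.rpow_nonneg hx _)
  have h2 : 1 + y * x ^ (-η) ≠ 0 := by positivity
  unfold kernel; field_simp; ring

/-- Radial integral of the kernel outside the disc of radius `a`. -/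
noncomputable def radial (η a y : ℝ) : ℝ≥0∞ :=
  ∫⁻ x in Set.Ioi a, ENNReal.ofReal (x * kernel η y x)

/-- The hypergeometric function of the interference transforms. -/
noncomputable abbrev hypF (η z : ℝ) : ℝ := hyp2F1 1 (1 - 2 / η) (2 - 2 / η) (-z)

/-- Here `c - b = 1`, so the factor `1 - t` disappears and the Gamma quotient is `Γ(b + 1) / Γ(b) =
b`. -/
lemma hypF_eq {η z : ℝ} (hη : 2 < η) :
    hypF η z = (1 - 2 / η) * ∫ t in (0 : ℝ)..1, t ^ (-2 / η) * (1 + z * t)⁻¹ := by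
  have h0 : 0 < 1 - 2 / η := by rw [sub_pos, div_lt_one (by linarith)]; exact hη
  have h1 : (2 - 2 / η : ℝ) = (1 - 2 / η) + 1 := by ring
  have h2 : (2 - 2 / η - (1 - 2 / η) : ℝ) = 1 := by ring
  rw [hypF, hyp2F1, h2, Real.Gamma_one, mul_one, h1, Real.Gamma_add_one h0.ne',
    mul_div_assoc, div_self (Real.Gamma_pos_of_pos h0).ne', mul_one]
  congr 1
  refine intervalIntegral.integral_congr fun t _ => ?_
  simp only [sub_self, Real.rpow_zero, mul_one, Real.rpow_neg_one]
  ring_nf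

lemma hypF_nonneg {η z : ℝ} (hη : 2 < η) (hz : 0 ≤ z) : 0 ≤ hypF η z := by
  have h0 : 0 < 1 - 2 / η := by rw [sub_pos, div_lt_one (by linarith)]; exact hη
  rw [hypF_eq hη]
  refine mul_nonneg h0.le (intervalIntegral.integral_nonneg zero_le_one fun t ht => ?_)
  have := ht.1
  positivity

/-- The exponent `-2 / η` exceeds `-1` as `η > 2`, so the singularity at `0` is integrable and the
Bochner integral takes no default value. -/
lemma lintegral_euler {η z : ℝ} (hη : 2 < η) (hz : 0 ≤ z) :
    ∫⁻ t in Set.Ioo (0 : ℝ) 1, ENNReal.ofReal (t ^ (-2 / η) * (1 + z * t)⁻¹) =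
      ENNReal.ofReal (∫ t in (0 : ℝ)..1, t ^ (-2 / η) * (1 + z * t)⁻¹) := by
  have hneg : -1 < -2 / η := by
    rw [neg_div, neg_lt_neg_iff, div_lt_one (by linarith)]; exact hη
  have hint : IntervalIntegrable (fun t : ℝ => t ^ (-2 / η) * (1 + z * t)⁻¹) volume 0 1 := by
    refine (intervalIntegral.intervalIntegrable_rpow' hneg).mul_continuousOn ?_
    refine ContinuousOn.inv₀ (by fun_prop) fun t ht => ?_
    rw [Set.uIcc_of_le zero_le_one] at ht
    have := ht.1
    positivity
  rw [intervalIntegral.integral_of_le zero_le_one, integral_Ioc_eq_integral_Ioo,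
    ofReal_integral_eq_lintegral_ofReal]
  · rw [intervalIntegrable_iff_integrableOn_Ioo_of_le zero_le_one] at hint
    exact hint
  · refine (ae_restrict_iff' measurableSet_Ioo).2 (ae_of_all _ fun t ht => ?_)
    have := ht.1
    simp only [Pi.zero_apply]
    positivity

/-- The substitution `t = (x / a) ^ (-η)` maps the exterior `(a, ∞)` onto `(0, 1)` and the kernel
onto Euler's integrand with `z = y a ^ (-η)`. -/
lemma radial_eq {η a y : ℝ} (hη : 2 < η) (ha : 0 < a) (hy : 0 ≤ y) :
    radial η a y =
      ENNReal.ofReal (a ^ (2 - η) * y / (η - 2) * hypF η (y * a ^ (-η))) := by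
  have hη0 : 0 < η := by linarith
  set z := y * a ^ (-η) with hz
  have hz0 : 0 ≤ z := mul_nonneg hy (Real.rpow_nonneg ha.le _)
  have himg : (fun x : ℝ => (x / a) ^ (-η)) '' Set.Ioi a = Set.Ioo 0 1 := by
    ext t
    constructor
    · rintro ⟨x, hx, rfl⟩
      have h1 : 1 < x / a := (one_lt_div ha).2 hx
      exact ⟨Real.rpow_pos_of_pos (by linarith) _,
        Real.rpow_lt_one_of_one_lt_of_neg h1 (by linarith)⟩
    · rintro ⟨h0, h1⟩
      refine ⟨a * t ^ (-1 / η), ?_, ?_⟩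
      · have : 1 < t ^ (-1 / η) := Real.one_lt_rpow_of_pos_of_lt_one_of_neg h0 h1
          (div_neg_of_neg_of_pos (by norm_num) hη0)
        rw [Set.mem_Ioi]; nlinarith
      · simp only
        rw [mul_div_cancel_left₀ _ ha.ne', ← Real.rpow_mul h0.le]
        have : -1 / η * -η = 1 := by field_simp
        rw [this, Real.rpow_one]
  have hderiv : ∀ x ∈ Set.Ioi a, HasDerivWithinAt (fun x : ℝ => (x / a) ^ (-η))
      (-η * (x / a) ^ (-η - 1) * (1 / a)) (Set.Ioi a) x := by
    intro x hx
    have hx0 : 0 < x / a := div_pos (ha.trans hx) ha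
    have h1 := (Real.hasDerivAt_rpow_const (p := -η) (Or.inl hx0.ne')).comp x
      ((hasDerivAt_id x).div_const a)
    exact h1.hasDerivWithinAt
  have hinj : Set.InjOn (fun x : ℝ => (x / a) ^ (-η)) (Set.Ioi a) := by
    intro x hx x' hx' h
    have hx0 : 0 < x / a := div_pos (ha.trans hx) ha
    have hx0' : 0 < x' / a := div_pos (ha.trans hx') ha
    have := (Real.rpow_left_inj hx0.le hx0'.le (neg_ne_zero.2 hη0.ne')).1 h
    exact (div_left_inj' ha.ne').1 this
  have key := lintegral_image_eq_lintegral_abs_deriv_mul measurableSet_Ioi hderiv hinj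
    (fun t => ENNReal.ofReal (t ^ (-2 / η) * (1 + z * t)⁻¹))
  rw [himg, lintegral_euler hη hz0] at key
  have hpt : ∀ x ∈ Set.Ioi a, ENNReal.ofReal (x * kernel η y x) =
      ENNReal.ofReal (y * a ^ (2 - η) / η) *
        (ENNReal.ofReal |(-η * (x / a) ^ (-η - 1) * (1 / a))| *
          ENNReal.ofReal (((x / a) ^ (-η)) ^ (-2 / η) * (1 + z * (x / a) ^ (-η))⁻¹)) := by
    intro x hx
    have hx0 : 0 < x := ha.trans hx
    have hxa : 0 < x / a := div_pos hx0 ha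
    rw [← ENNReal.ofReal_mul (abs_nonneg _), ← ENNReal.ofReal_mul (by positivity)]
    congr 1
    have e1 : |(-η * (x / a) ^ (-η - 1) * (1 / a))| = η * (x / a) ^ (-η - 1) * (1 / a) := by
      have : 0 ≤ η * (x / a) ^ (-η - 1) * (1 / a) := by positivity
      rw [neg_mul, neg_mul, abs_neg, abs_of_nonneg this]
    have e2 : ((x / a) ^ (-η)) ^ (-2 / η) = (x / a) ^ (2 : ℝ) := by
      rw [← Real.rpow_mul hxa.le]; congr 1; field_simp
    have e3 : z * (x / a) ^ (-η) = y * x ^ (-η) := by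
      rw [hz, Real.div_rpow hx0.le ha.le]
      have := (Real.rpow_pos_of_pos ha (-η)).ne'
      field_simp
    have e4 : (x / a) ^ (-η - 1) * (x / a) ^ (2 : ℝ) = x ^ (-η) * x / (a ^ (-η) * a) := by
      rw [← Real.rpow_add hxa, Real.div_rpow hx0.le ha.le]
      have : -η - 1 + 2 = -η + 1 := by ring
      rw [this, Real.rpow_add_one hx0.ne', Real.rpow_add_one ha.ne']
    have e5 : a ^ (2 - η) = a ^ (-η) * a * a := by
      have : 2 - η = -η + 1 + 1 := by ring
      rw [this, Real.rpow_add_one ha.ne', Real.rpow_add_one ha.ne']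
    have hap := (Real.rpow_pos_of_pos ha (-η)).ne'
    rw [e1, e2, e3, kernel, e5]
    calc _ = y * (x ^ (-η) * x) * (1 + y * x ^ (-η))⁻¹ := by rw [div_eq_mul_inv]; ring
      _ = y * (a ^ (-η) * a * a) / η * (η * (1 / a)) *
          ((x / a) ^ (-η - 1) * (x / a) ^ (2 : ℝ)) * (1 + y * x ^ (-η))⁻¹ := by
        rw [e4]; congr 1; field_simp
      _ = _ := by ring
  rw [radial, setLIntegral_congr_fun measurableSet_Ioi hpt, lintegral_const_mul, ← key,
    ← ENNReal.ofReal_mul (by positivity), hypF_eq hη]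
  · congr 1
    -- The prefactors agree because `(1 - 2 / η) / (η - 2) = 1 / η`.
    have : η - 2 ≠ 0 := by linarith
    field_simp
  · fun_prop

lemma lintegral_rpow_mul_exp {a r : ℝ} (ha : 0 < a) (hr : 0 < r) :
    ∫⁻ t in Set.Ioi (0 : ℝ), ENNReal.ofReal (t ^ (a - 1) * Real.exp (-(r * t))) =
      ENNReal.ofReal ((1 / r) ^ a * Real.Gamma a) := by
  have h := Real.integral_rpow_mul_exp_neg_mul_Ioi ha hr
  have hG := Real.Gamma_pos_of_pos ha
  rw [← h, ofReal_integral_eq_lintegral_ofReal]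
  · refine Integrable.of_integral_ne_zero ?_
    rw [h]; positivity
  · refine (ae_restrict_iff' measurableSet_Ioi).2 (ae_of_all _ fun t ht => ?_)
    have : (0 : ℝ) < t := ht
    simp only [Pi.zero_apply]
    positivity

lemma lintegral_exp_neg_mul {r : ℝ} (hr : 0 < r) :
    ∫⁻ t in Set.Ioi (0 : ℝ), ENNReal.ofReal (Real.exp (-(r * t))) = ENNReal.ofReal (r⁻¹) := by
  have := lintegral_rpow_mul_exp one_pos hr
  simpa using this

/-- Writing `1 / (1 + t)` as the integral of `exp (-(1 + t) u)` and exchanging the integrals gives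
`Γ(a) Γ(1 - a)`, which the reflection formula evaluates. -/
lemma lintegral_rpow_div_one_add {a : ℝ} (ha : 0 < a) (ha1 : a < 1) :
    ∫⁻ t in Set.Ioi (0 : ℝ), ENNReal.ofReal (t ^ (a - 1) * (1 + t)⁻¹) =
      ENNReal.ofReal (Real.pi / Real.sin (Real.pi * a)) := by
  have h1 : ∀ t ∈ Set.Ioi (0 : ℝ), ENNReal.ofReal (t ^ (a - 1) * (1 + t)⁻¹) =
      ∫⁻ u in Set.Ioi (0 : ℝ), ENNReal.ofReal (t ^ (a - 1) * Real.exp (-((1 + t) * u))) := by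
    intro t ht
    have ht0 : (0 : ℝ) < t := ht
    have hp : 0 ≤ t ^ (a - 1) := by positivity
    rw [ENNReal.ofReal_mul hp, ← lintegral_exp_neg_mul (by positivity : 0 < 1 + t),
      ← lintegral_const_mul _ (by fun_prop)]
    simp_rw [ENNReal.ofReal_mul hp]
  rw [setLIntegral_congr_fun measurableSet_Ioi h1, lintegral_lintegral_swap]
  · have h2 : ∀ u ∈ Set.Ioi (0 : ℝ),
        ∫⁻ t in Set.Ioi (0 : ℝ), ENNReal.ofReal (t ^ (a - 1) * Real.exp (-((1 + t) * u))) =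
        ENNReal.ofReal (Real.Gamma a) *
          ENNReal.ofReal (u ^ ((1 - a) - 1) * Real.exp (-(1 * u))) := by
      intro u hu
      have hu0 : (0 : ℝ) < u := hu
      have e : ∀ t : ℝ, t ^ (a - 1) * Real.exp (-((1 + t) * u)) =
          Real.exp (-u) * (t ^ (a - 1) * Real.exp (-(u * t))) := by
        intro t
        have : -((1 + t) * u) = -u + -(u * t) := by ring
        rw [this, Real.exp_add]; ring
      simp_rw [e, ENNReal.ofReal_mul (Real.exp_pos (-u)).le]
      rw [lintegral_const_mul _ (by fun_prop), lintegral_rpow_mul_exp ha hu0,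
        ← ENNReal.ofReal_mul (Real.exp_pos _).le,
        ← ENNReal.ofReal_mul (Real.Gamma_pos_of_pos ha).le]
      congr 1
      rw [one_div, Real.inv_rpow hu0.le, ← Real.rpow_neg hu0.le]
      have : (1 - a - 1 : ℝ) = -a := by ring
      rw [this, one_mul]; ring
    rw [setLIntegral_congr_fun measurableSet_Ioi h2, lintegral_const_mul _ (by fun_prop),
      lintegral_rpow_mul_exp (by linarith) one_pos,
      ← ENNReal.ofReal_mul (Real.Gamma_pos_of_pos ha).le]
    congr 1
    rw [← Real.Gamma_mul_Gamma_one_sub]; simp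
  · fun_prop

/-- The substitution `x = (y / t) ^ (1 / η)` turns the kernel into `t / (1 + t)` times a power,
leaving the preceding integral at `1 - 2 / η`. It needs `y > 0`; both sides vanish at `y = 0`. -/
lemma radial_zero {η y : ℝ} (hη : 2 < η) (hy : 0 ≤ y) :
    radial η 0 y =
      ENNReal.ofReal (Real.pi / η * y ^ (2 / η) * (Real.sin (2 * Real.pi / η))⁻¹) := by
  have hη0 : 0 < η := by linarith
  rcases hy.eq_or_lt with rfl | hy0
  · simp [radial, kernel, Real.zero_rpow (div_pos two_pos hη0).ne']
  set b := y ^ (1 / η) with hb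
  have hb0 : 0 < b := Real.rpow_pos_of_pos hy0 _
  have hne : -1 / η ≠ 0 := (div_neg_of_neg_of_pos (by norm_num) hη0).ne
  have hf : ∀ t : ℝ, 0 < t → (b * t ^ (-1 / η)) ^ (-η) = t / y := by
    intro t ht
    rw [Real.mul_rpow hb0.le (Real.rpow_nonneg ht.le _), hb, ← Real.rpow_mul hy0.le,
      ← Real.rpow_mul ht.le]
    have h1 : 1 / η * -η = -1 := by field_simp
    have h2 : -1 / η * -η = 1 := by field_simp
    rw [h1, h2, Real.rpow_one, Real.rpow_neg_one]; field_simp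
  have himg : (fun t : ℝ => b * t ^ (-1 / η)) '' Set.Ioi 0 = Set.Ioi 0 := by
    ext x
    constructor
    · rintro ⟨t, ht, rfl⟩
      exact mul_pos hb0 (Real.rpow_pos_of_pos ht _)
    · intro hx
      have hxb : 0 < x / b := div_pos hx hb0
      refine ⟨(x / b) ^ (-η), Real.rpow_pos_of_pos hxb _, ?_⟩
      simp only
      rw [← Real.rpow_mul hxb.le]
      have h2 : -η * (-1 / η) = 1 := by field_simp
      rw [h2, Real.rpow_one]; field_simp
  have hderiv : ∀ t ∈ Set.Ioi (0 : ℝ), HasDerivWithinAt (fun t : ℝ => b * t ^ (-1 / η))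
      (b * (-1 / η * t ^ (-1 / η - 1))) (Set.Ioi 0) t := by
    intro t ht
    exact ((Real.hasDerivAt_rpow_const (Or.inl (ne_of_gt ht))).const_mul b).hasDerivWithinAt
  have hinj : Set.InjOn (fun t : ℝ => b * t ^ (-1 / η)) (Set.Ioi 0) := by
    intro t ht t' ht' h
    have h' := mul_left_cancel₀ hb0.ne' h
    exact (Real.rpow_left_inj (le_of_lt ht) (le_of_lt ht') hne).1 h'
  have key := lintegral_image_eq_lintegral_abs_deriv_mul measurableSet_Ioi hderiv hinj
    (fun x => ENNReal.ofReal (x * kernel η y x))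
  rw [himg] at key
  have hpt : ∀ t ∈ Set.Ioi (0 : ℝ), ENNReal.ofReal |b * (-1 / η * t ^ (-1 / η - 1))| *
      ENNReal.ofReal (b * t ^ (-1 / η) * kernel η y (b * t ^ (-1 / η))) =
      ENNReal.ofReal (y ^ (2 / η) / η) *
        ENNReal.ofReal (t ^ ((1 - 2 / η) - 1) * (1 + t)⁻¹) := by
    intro t ht
    have ht0 : 0 < t := ht
    rw [← ENNReal.ofReal_mul (abs_nonneg _), ← ENNReal.ofReal_mul (by positivity)]
    congr 1
    rw [kernel, hf t ht0]
    have e0 : y * (t / y) = t := by field_simp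
    have e1 : |b * (-1 / η * t ^ (-1 / η - 1))| = b * (1 / η * t ^ (-1 / η - 1)) := by
      have h1 : b * (-1 / η * t ^ (-1 / η - 1)) = -(b * (1 / η * t ^ (-1 / η - 1))) := by ring
      have : 0 ≤ b * (1 / η * t ^ (-1 / η - 1)) := by positivity
      rw [h1, abs_neg, abs_of_nonneg this]
    have e2 : b * b = y ^ (2 / η) := by
      rw [hb, ← Real.rpow_add hy0]; congr 1; ring
    have e3 : t ^ (-1 / η - 1) * t ^ (-1 / η) * t = t ^ ((1 - 2 / η) - 1) := by
      rw [← Real.rpow_add ht0, ← Real.rpow_add_one ht0.ne']; congr 1; ring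
    rw [e0, e1, ← e2, ← e3, div_eq_mul_inv]; ring
  have hs0 : 0 < 1 - 2 / η := by rw [sub_pos, div_lt_one hη0]; exact hη
  have hs1 : 1 - 2 / η < 1 := by have : 0 < 2 / η := by positivity
                                 linarith
  rw [radial, key, setLIntegral_congr_fun measurableSet_Ioi hpt,
    lintegral_const_mul _ (by fun_prop), lintegral_rpow_div_one_add hs0 hs1,
    ← ENNReal.ofReal_mul (by positivity)]
  congr 1
  have : Real.sin (Real.pi * (1 - 2 / η)) = Real.sin (2 * Real.pi / η) := by
    rw [← Real.sin_pi_sub]; congr 1; ring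
  rw [this]; ring

/-! ### Exponential fading -/

lemma expMeasure_eq : expMeasure 1 =
    (volume.restrict (Set.Ioi 0)).withDensity fun h => ENNReal.ofReal (Real.exp (-h)) := by
  have : expMeasure 1 = volume.withDensity (exponentialPDF 1) := rfl
  rw [this, ← withDensity_indicator measurableSet_Ioi]
  refine withDensity_congr_ae ?_
  have h0 : ∀ᵐ x : ℝ, x ≠ 0 := by simp [ae_iff]
  filter_upwards [h0] with x hx
  rcases lt_or_gt_of_ne hx with h | h
  · rw [exponentialPDF_of_neg h, Set.indicator_of_notMem (by simpa using h.le)]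
  · rw [exponentialPDF_of_nonneg h.le, Set.indicator_of_mem (by simpa using h)]
    simp

instance : IsProbabilityMeasure (expMeasure 1) := isProbabilityMeasure_expMeasure one_pos

lemma lintegral_expMeasure {g : ℝ → ℝ≥0∞} (hg : Measurable g) :
    ∫⁻ h, g h ∂expMeasure 1 = ∫⁻ h in Set.Ioi 0, ENNReal.ofReal (Real.exp (-h)) * g h := by
  rw [expMeasure_eq, lintegral_withDensity_eq_lintegral_mul _ (by fun_prop) hg]
  rfl

/-- Laplace transform of the exponential distribution. -/
lemma lintegral_expNeg_expMeasure {s l : ℝ} (hs : 0 ≤ s) (hl : 0 ≤ l) :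
    ∫⁻ h, expNeg (ENNReal.ofReal s * ENNReal.ofReal (l * h)) ∂expMeasure 1 =
      ENNReal.ofReal ((1 + s * l)⁻¹) := by
  have hsl : 0 ≤ s * l := mul_nonneg hs hl
  rw [lintegral_expMeasure (by fun_prop),
    ← lintegral_exp_neg_mul (by positivity : 0 < 1 + s * l)]
  refine setLIntegral_congr_fun measurableSet_Ioi fun h hh => ?_
  have hh0 : (0 : ℝ) < h := hh
  rw [← ENNReal.ofReal_mul hs, expNeg_ofReal (by positivity),
    ← ENNReal.ofReal_mul (Real.exp_pos _).le, ← Real.exp_add]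
  congr 2; ring

/-- Coverage of an exponential signal: `ℙ (θ ≤ b H / D) = exp (-θ D / b)`. -/
lemma expMeasure_le_div {θ b : ℝ} (hθ : 0 < θ) (hb : 0 < b) (D : ℝ≥0∞) :
    expMeasure 1 {h | ENNReal.ofReal θ ≤ ENNReal.ofReal (b * h) / D} =
      expNeg (ENNReal.ofReal (θ / b) * D) := by
  have hm : MeasurableSet {h : ℝ | ENNReal.ofReal θ ≤ ENNReal.ofReal (b * h) / D} :=
    measurableSet_le measurable_const (by fun_prop)
  have hθ' : ENNReal.ofReal θ ≠ 0 := by simpa using hθ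
  -- The law charges only `(0, ∞)`, so it suffices to identify the event there with `h ≥ x`. This
  -- serves `D = 0`, where the quotient is `∞` and `x = 0`, and finite positive `D`, where `x = θ D
  -- / b`. For `D = ∞` the quotient is `0` and the event is empty.
  have key : ∀ x : ℝ, 0 ≤ x →
      ({h : ℝ | ENNReal.ofReal θ ≤ ENNReal.ofReal (b * h) / D} ∩ Set.Ioi 0 : Set ℝ) =
        (Set.Ici x ∩ Set.Ioi 0 : Set ℝ) →
      expMeasure 1 {h | ENNReal.ofReal θ ≤ ENNReal.ofReal (b * h) / D} =
        ENNReal.ofReal (Real.exp (-x)) := by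
    intro x hx hset
    rw [expMeasure_eq, withDensity_apply _ hm, Measure.restrict_restrict hm, hset,
      ← Measure.restrict_restrict measurableSet_Ici,
      Measure.restrict_restrict measurableSet_Ici]
    have h1 : (Set.Ici x ∩ Set.Ioi 0 : Set ℝ) =ᵐ[volume] Set.Ioi x := by
      have : Set.Ioi x = (Set.Ioi x ∩ Set.Ioi 0 : Set ℝ) := by
        rw [Set.Ioi_inter_Ioi, max_eq_left hx]
      rw [this]
      exact (Ioi_ae_eq_Ici.symm).inter (ae_eq_refl _)
    rw [Measure.restrict_congr_set h1,
      ← ofReal_integral_eq_lintegral_ofReal (integrableOn_exp_neg_Ioi x)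
        (ae_of_all _ fun h => (Real.exp_pos _).le), integral_exp_neg_Ioi]
  rcases eq_or_ne D 0 with rfl | hD0
  · rw [mul_zero, expNeg_zero, key 0 le_rfl]
    · simp
    · ext h
      simp only [Set.mem_inter_iff, Set.mem_ofPred_eq, Set.mem_Ioi, Set.mem_Ici]
      refine and_congr_left fun hh => ⟨fun _ => hh.le, fun _ => ?_⟩
      rw [ENNReal.div_zero (by simpa using mul_pos hb hh)]
      exact le_top
  rcases eq_or_ne D ∞ with rfl | hDt
  · have hne : ENNReal.ofReal (θ / b) ≠ 0 := by simpa using div_pos hθ hb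
    rw [ENNReal.mul_top hne, expNeg_top]
    simp [hθ.not_ge]
  · set d := D.toReal with hd
    have hd0 : 0 < d := ENNReal.toReal_pos hD0 hDt
    have hDd : D = ENNReal.ofReal d := (ENNReal.ofReal_toReal hDt).symm
    rw [key (θ / b * d) (by positivity)]
    · rw [hDd, ← ENNReal.ofReal_mul (by positivity), expNeg_ofReal (by positivity)]
    · ext h
      simp only [Set.mem_inter_iff, Set.mem_ofPred_eq, Set.mem_Ioi, Set.mem_Ici]
      refine and_congr_left fun hh => ?_
      rw [hDd, ← ENNReal.ofReal_div_of_pos hd0, ENNReal.ofReal_le_ofReal_iff (by positivity),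
        le_div_iff₀ hd0, div_mul_eq_mul_div, div_le_iff₀ hb, mul_comm b h]

lemma measurable_hypF {η : ℝ} (hη : 2 < η) : Measurable (hypF η) := by
  have : hypF η = fun z => (1 - 2 / η) * ∫ t in Set.Ioc (0 : ℝ) 1, t ^ (-2 / η) * (1 + z * t)⁻¹ := by
    ext z
    rw [hypF_eq hη, intervalIntegral.integral_of_le zero_le_one]
  rw [this]
  refine Measurable.const_mul ?_ _
  have hm : StronglyMeasurable fun p : ℝ × ℝ => p.2 ^ (-2 / η) * (1 + p.1 * p.2)⁻¹ :=
    Measurable.stronglyMeasurable (by fun_prop)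
  exact hm.integral_prod_right'.measurable

/-- The integrand decreases in `z`, and the value at `z = 0` is one. This bounds the integrands that
contain a random power. -/
lemma hypF_le_one {η z : ℝ} (hη : 2 < η) (hz : 0 ≤ z) : hypF η z ≤ 1 := by
  have hneg : -1 < -2 / η := by
    rw [neg_div, neg_lt_neg_iff, div_lt_one (by linarith)]; exact hη
  have h0 : 0 < 1 - 2 / η := by rw [neg_div] at hneg; linarith
  have hi := intervalIntegral.intervalIntegrable_rpow' (a := 0) (b := 1) hneg
  rw [hypF_eq hη]
  have h1 : ∫ t in (0 : ℝ)..1, t ^ (-2 / η) * (1 + z * t)⁻¹ ≤ ∫ t in (0 : ℝ)..1, t ^ (-2 / η) := by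
    refine intervalIntegral.integral_mono_on zero_le_one (hi.mul_continuousOn ?_) hi ?_
    · refine ContinuousOn.inv₀ (by fun_prop) fun t ht => ?_
      rw [Set.uIcc_of_le zero_le_one] at ht
      have := ht.1
      positivity
    · intro t ht
      have := ht.1
      exact mul_le_of_le_one_right (by positivity)
        (inv_le_one_of_one_le₀ (by nlinarith [mul_nonneg hz this]))
  rw [integral_rpow (Or.inl hneg)] at h1
  have h2 : (-2 / η + 1 : ℝ) = 1 - 2 / η := by ring
  rw [h2, Real.one_rpow, Real.zero_rpow h0.ne', sub_zero] at h1
  calc _ ≤ (1 - 2 / η) * (1 / (1 - 2 / η)) := by gcongr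
    _ = 1 := mul_one_div_cancel h0.ne'

namespace Network

variable {K : ℕ} (N : Network K)

/-! ### Power control -/

lemma lamBar_pos (i : Fin K) : 0 < N.lamBar i :=
  Finset.sum_pos (fun k _ => mul_pos (div_pos (pow_pos (N.tau_pos i) 2) (pow_pos (N.tau_pos k) 2))
    (N.lam_pos k)) ⟨i, Finset.mem_univ i⟩

lemma etaDD_pos : 0 < N.etaDD := two_pos.trans N.etaDD_gt

lemma edgeRadius_pos (k : Fin K) : 0 < N.edgeRadius k :=
  Real.rpow_pos_of_pos (div_pos N.pU_pos (N.rho_pos k)) _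

lemma edgeRadius_sq (k : Fin K) : N.edgeRadius k ^ 2 = (N.pU / N.rho k) ^ (2 / N.etaDD) := by
  rw [edgeRadius, ← Real.rpow_natCast, ← Real.rpow_mul (div_pos N.pU_pos (N.rho_pos k)).le]
  congr 1
  push_cast; ring

lemma inClass_ccu_iff (k : Fin K) {r : ℝ} (hr : 0 ≤ r) :
    N.rho k * r ^ N.etaDD ≤ N.pU ↔ r ≤ N.edgeRadius k := by
  rw [← le_div_iff₀' (N.rho_pos k), edgeRadius, one_div,
    Real.le_rpow_inv_iff_of_pos hr (div_pos N.pU_pos (N.rho_pos k)).le N.etaDD_pos]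

lemma txPower_of_le (k : Fin K) {r : ℝ} (hr : 0 ≤ r) (h : r ≤ N.edgeRadius k) :
    N.txPower k r = N.rho k * r ^ N.etaDD :=
  min_eq_left ((N.inClass_ccu_iff k hr).2 h)

lemma txPower_of_lt (k : Fin K) {r : ℝ} (h : N.edgeRadius k < r) : N.txPower k r = N.pU :=
  min_eq_right (le_of_not_ge fun h' =>
    h.not_ge ((N.inClass_ccu_iff k ((N.edgeRadius_pos k).le.trans h.le)).1 h'))

lemma txPower_pos (k : Fin K) {r : ℝ} (hr : 0 < r) : 0 < N.txPower k r :=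
  lt_min (mul_pos (N.rho_pos k) (Real.rpow_pos_of_pos hr _)) N.pU_pos

@[fun_prop]
lemma measurable_txPower (k : Fin K) : Measurable (N.txPower k) := by
  unfold txPower; fun_prop

/-- Rate of the serving distance. -/
noncomputable def rate (k : Fin K) : ℝ := Real.pi * N.lamBar k

lemma rate_pos (k : Fin K) : 0 < N.rate k := mul_pos Real.pi_pos (N.lamBar_pos k)

lemma probCEU_eq (k : Fin K) :
    N.probCEU k = Real.exp (-(N.rate k * N.edgeRadius k ^ 2)) := by
  rw [probCEU, edgeRadius_sq, rate]

/-- Law of the serving distance of a user of tier `k`. -/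
noncomputable def distLaw (k : Fin K) : Measure ℝ := rayleigh (N.rate k)

instance (k : Fin K) : IsProbabilityMeasure (N.distLaw k) :=
  isProbabilityMeasure_rayleigh (N.rate_pos k)

/-- Law of the transmit power of a user of tier `k`. -/
noncomputable def powerLaw (k : Fin K) : Measure ℝ := (N.distLaw k).map (N.txPower k)

instance (k : Fin K) : IsProbabilityMeasure (N.powerLaw k) :=
  Measure.isProbabilityMeasure_map (N.measurable_txPower k).aemeasurable

lemma distLaw_pos (k : Fin K) : ∀ᵐ r ∂N.distLaw k, 0 < r := by
  have h := rayleigh_Iic_zero (N.rate k)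
  filter_upwards [measure_eq_zero_iff_ae_notMem.1 h] with r hr
  simpa using hr

lemma powerLaw_pos (k : Fin K) : ∀ᵐ p ∂N.powerLaw k, 0 < p := by
  rw [powerLaw, ae_map_iff (N.measurable_txPower k).aemeasurable measurableSet_Ioi]
  filter_upwards [N.distLaw_pos k] with r hr using N.txPower_pos k hr

/-- Density of the serving distance. -/
noncomputable def distDensity (k : Fin K) (r : ℝ) : ℝ :=
  2 * N.rate k * r * Real.exp (-(N.rate k * r ^ 2))

lemma distDensity_nonneg (k : Fin K) {r : ℝ} (hr : 0 ≤ r) : 0 ≤ N.distDensity k r := by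
  have := N.rate_pos k
  unfold distDensity; positivity

lemma continuous_distDensity (k : Fin K) : Continuous (N.distDensity k) := by
  unfold distDensity; fun_prop

lemma lintegral_distLaw (k : Fin K) {g : ℝ → ℝ≥0∞} (hg : Measurable g) :
    ∫⁻ r, g r ∂N.distLaw k =
      (∫⁻ r in Set.Ioc 0 (N.edgeRadius k), ENNReal.ofReal (N.distDensity k r) * g r) +
      ∫⁻ r in Set.Ioi (N.edgeRadius k), ENNReal.ofReal (N.distDensity k r) * g r := by
  rw [distLaw, lintegral_rayleigh hg, ← Set.Ioc_union_Ioi_eq_Ioi (N.edgeRadius_pos k).le,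
    lintegral_union measurableSet_Ioi (Set.Ioc_disjoint_Ioi le_rfl)]
  rfl

lemma lintegral_Ioi_distDensity (k : Fin K) :
    ∫⁻ r in Set.Ioi (N.edgeRadius k), ENNReal.ofReal (N.distDensity k r) =
      ENNReal.ofReal (N.probCEU k) := by
  rw [probCEU_eq, ← lintegral_Ioi_rayleigh (N.rate_pos k) (N.edgeRadius_pos k).le]
  rfl

lemma probCEU_pos (k : Fin K) : 0 < N.probCEU k := Real.exp_pos _

lemma probCEU_lt_one (k : Fin K) : N.probCEU k < 1 := by
  rw [probCEU_eq, Real.exp_lt_one_iff]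
  have := N.rate_pos k
  have := N.edgeRadius_pos k
  have : 0 < N.rate k * N.edgeRadius k ^ 2 := by positivity
  linarith

lemma probCCU_pos (k : Fin K) : 0 < N.probCCU k := sub_pos.2 (N.probCEU_lt_one k)

lemma lintegral_Ioc_distDensity (k : Fin K) :
    ∫⁻ r in Set.Ioc 0 (N.edgeRadius k), ENNReal.ofReal (N.distDensity k r) =
      ENNReal.ofReal (N.probCCU k) := by
  have h := N.lintegral_distLaw k (g := fun _ => 1) measurable_const
  simp only [lintegral_const, measure_univ, mul_one, lintegral_Ioi_distDensity] at h
  rw [probCCU, ENNReal.ofReal_sub _ (N.probCEU_pos k).le, ENNReal.ofReal_one, h,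
    ENNReal.add_sub_cancel_right ENNReal.ofReal_ne_top]

lemma lintegral_powerLaw (k : Fin K) {g : ℝ → ℝ≥0∞} (hg : Measurable g) :
    ∫⁻ p, g p ∂N.powerLaw k =
      (∫⁻ r in Set.Ioc 0 (N.edgeRadius k),
        ENNReal.ofReal (N.distDensity k r) * g (N.rho k * r ^ N.etaDD)) +
      g N.pU * ENNReal.ofReal (N.probCEU k) := by
  rw [powerLaw, lintegral_map hg (N.measurable_txPower k),
    N.lintegral_distLaw k (g := fun r => g (N.txPower k r)) (by fun_prop)]
  congr 1
  · refine setLIntegral_congr_fun measurableSet_Ioc fun r hr => ?_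
    simp only [N.txPower_of_le k hr.1.le hr.2]
  · rw [← lintegral_Ioi_distDensity, mul_comm, ← lintegral_mul_const _ (by
      exact (N.continuous_distDensity k).measurable.ennreal_ofReal)]
    refine setLIntegral_congr_fun measurableSet_Ioi fun r hr => ?_
    simp only [N.txPower_of_lt k hr]

/-- The bound `C` on `[0, pU]` makes the real integral in `powerMean` an honest one, so that it can
be exchanged with the extended one. -/
lemma lintegral_powerLaw_ofReal (k : Fin K) {g : ℝ → ℝ} (hg : Measurable g)
    (h0 : ∀ p, 0 ≤ p → 0 ≤ g p) {C : ℝ} (hC : ∀ p, 0 ≤ p → p ≤ N.pU → g p ≤ C) :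
    ∫⁻ p, ENNReal.ofReal (g p) ∂N.powerLaw k = ENNReal.ofReal (N.powerMean k g) := by
  have hR := N.edgeRadius_pos k
  have hρ := N.rho_pos k
  have hmem : ∀ r ∈ Set.Ioc 0 (N.edgeRadius k),
      0 ≤ N.rho k * r ^ N.etaDD ∧ N.rho k * r ^ N.etaDD ≤ N.pU := fun r hr =>
    ⟨by have := hr.1; positivity, (N.inClass_ccu_iff k hr.1.le).2 hr.2⟩
  have hnn : ∀ r ∈ Set.Ioc 0 (N.edgeRadius k),
      0 ≤ g (N.rho k * r ^ N.etaDD) * N.distDensity k r := fun r hr =>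
    mul_nonneg (h0 _ (hmem r hr).1) (N.distDensity_nonneg k hr.1.le)
  have hint : IntegrableOn (fun r => g (N.rho k * r ^ N.etaDD) * N.distDensity k r)
      (Set.Ioc 0 (N.edgeRadius k)) := by
    have hd : IntegrableOn (N.distDensity k) (Set.Ioc 0 (N.edgeRadius k)) :=
      (N.continuous_distDensity k).integrableOn_Ioc
    refine (hd.const_mul C).mono' ?_ ?_
    · exact ((hg.comp (by fun_prop)).mul
        (N.continuous_distDensity k).measurable).aestronglyMeasurable
    · refine (ae_restrict_iff' measurableSet_Ioc).2 (ae_of_all _ fun r hr => ?_)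
      rw [Real.norm_of_nonneg (hnn r hr)]
      exact mul_le_mul_of_nonneg_right (hC _ (hmem r hr).1 (hmem r hr).2)
        (N.distDensity_nonneg k hr.1.le)
  rw [N.lintegral_powerLaw k hg.ennreal_ofReal, powerMean,
    intervalIntegral.integral_of_le hR.le, ENNReal.ofReal_add, ← ENNReal.ofReal_mul
    (h0 _ N.pU_pos.le)]
  · congr 1
    have e : ∀ r, g (N.rho k * r ^ N.etaDD) *
        (2 * Real.pi * N.lamBar k * r * Real.exp (-(Real.pi * N.lamBar k * r ^ 2))) =
        g (N.rho k * r ^ N.etaDD) * N.distDensity k r := by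
      intro r; rw [distDensity, rate]; ring
    simp_rw [e]
    rw [ofReal_integral_eq_lintegral_ofReal hint
      ((ae_restrict_iff' measurableSet_Ioc).2 (ae_of_all _ hnn))]
    refine setLIntegral_congr_fun measurableSet_Ioc fun r hr => ?_
    rw [ENNReal.ofReal_mul (h0 _ (hmem r hr).1), mul_comm]
  · refine integral_nonneg_of_ae
      ((ae_restrict_iff' measurableSet_Ioc).2 (ae_of_all _ fun r hr => ?_))
    have := hnn r hr
    rw [distDensity, rate] at this
    convert! this using 1
    ring
  · exact mul_nonneg (h0 _ N.pU_pos.le) (N.probCEU_pos k).le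

/-- The substitution `u = rate * r ^ 2` produces the incomplete gamma integral; `r ^ (η z)` becomes
`u ^ w` with `w = z η / 2`, up to a power of the rate. -/
lemma powerMean_rpow (k : Fin K) {z : ℝ} (hz : 0 ≤ z) :
    N.powerMean k (fun p => p ^ z) = N.powerMoment k z := by
  have hb := N.rate_pos k
  have hR := N.edgeRadius_pos k
  have hη := N.etaDD_pos
  set w := z * N.etaDD / 2 with hw
  have hw0 : 0 ≤ w := by positivity
  rw [powerMean, powerMoment, ← edgeRadius_sq]
  change _ = N.rho k ^ z * lowerGamma (w + 1) (N.rate k * N.edgeRadius k ^ 2) / N.rate k ^ w +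
    N.pU ^ z * Real.exp (-(N.rate k * N.edgeRadius k ^ 2))
  rw [← probCEU_eq]
  congr 1
  have hsub := intervalIntegral.integral_comp_mul_deriv (a := 0) (b := N.edgeRadius k)
    (f := fun r => N.rate k * r ^ 2) (f' := fun r => N.rate k * (2 * r))
    (g := fun u => N.rho k ^ z / N.rate k ^ w * (u ^ w * Real.exp (-u)))
    (fun r _ => by simpa using (hasDerivAt_pow 2 r).const_mul (N.rate k))
    (by fun_prop)
    (continuous_const.mul ((Real.continuous_rpow_const hw0).mul (by fun_prop)))
  rw [intervalIntegral.integral_const_mul] at hsub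
  have hl : lowerGamma (w + 1) (N.rate k * N.edgeRadius k ^ 2) =
      ∫ u in N.rate k * 0 ^ 2..N.rate k * N.edgeRadius k ^ 2, u ^ w * Real.exp (-u) := by
    rw [lowerGamma, add_sub_cancel_right]; simp
  rw [hl, mul_div_right_comm, ← hsub]
  refine intervalIntegral.integral_congr fun r hr => ?_
  rw [Set.uIcc_of_le hR.le] at hr
  have hr0 := hr.1
  simp only [Function.comp_apply]
  have e1 : (N.rate k * r ^ 2) ^ w = N.rate k ^ w * r ^ (N.etaDD * z) := by
    rw [Real.mul_rpow hb.le (by positivity), ← Real.rpow_natCast, ← Real.rpow_mul hr0]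
    congr 2
    rw [hw]; push_cast; ring
  have e2 : (N.rho k * r ^ N.etaDD) ^ z = N.rho k ^ z * r ^ (N.etaDD * z) := by
    rw [Real.mul_rpow (N.rho_pos k).le (by positivity), ← Real.rpow_mul hr0]
  have hbw := (Real.rpow_pos_of_pos hb w).ne'
  rw [e1, e2, show Real.pi * N.lamBar k * r ^ 2 = N.rate k * r ^ 2 from rfl]
  field_simp
  rw [rate]; ring

lemma lintegral_powerLaw_rpow (k : Fin K) {z : ℝ} (hz : 0 ≤ z) :
    ∫⁻ p, ENNReal.ofReal (p ^ z) ∂N.powerLaw k = ENNReal.ofReal (N.powerMoment k z) := by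
  rw [← N.powerMean_rpow k hz]
  exact N.lintegral_powerLaw_ofReal k (by fun_prop) (fun p hp => Real.rpow_nonneg hp _)
    (C := N.pU ^ z) fun p hp hpu => Real.rpow_le_rpow hp hpu hz

lemma powerMoment_nonneg (k : Fin K) (z : ℝ) : 0 ≤ N.powerMoment k z := by
  rw [powerMoment]
  have h1 : 0 ≤ lowerGamma (z * N.etaDD / 2 + 1)
      (Real.pi * N.lamBar k * (N.pU / N.rho k) ^ (2 / N.etaDD)) := by
    rw [lowerGamma, ← edgeRadius_sq]
    have := N.rate_pos k
    refine intervalIntegral.integral_nonneg (mul_nonneg this.le (sq_nonneg _)) fun t ht => ?_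
    have := ht.1
    positivity
  have := N.rho_pos k
  have := N.pU_pos
  have := N.lamBar_pos k
  positivity

/-! ### Closed forms of the interference transforms -/

/-- Laplace transform of a field of interfering UEs, in terms of the radial integral. -/
noncomputable def ueTransform (η : ℝ) (c : UserClass) (k : Fin K) (s r : ℝ) : ℝ≥0∞ :=
  expNeg (ENNReal.ofReal (N.lam k) * ∫⁻ p, ENNReal.ofReal (2 * Real.pi) *
    radial η (N.protectionRadius c η k p r) (s * p) ∂N.powerLaw k)

/-- With radius `a = (p / ρ) ^ (1 / η)` the argument `s p a ^ (-η)` is `ρ s`, free of `p`, while `a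
^ (2 - η) p` is proportional to `p ^ (2 / η)`. Only the moment of order `2 / η` remains. -/
lemma ueTransform_ccu {η : ℝ} (hη : 2 < η) (k : Fin K) {s : ℝ} (hs : 0 ≤ s) (r : ℝ) :
    N.ueTransform η .ccu k s r = ENNReal.ofReal (N.ltUECentre η k s) := by
  have hη0 : 0 < η := by linarith
  have hρ := N.rho_pos k
  set C := N.rho k ^ (1 - 2 / η) / (η - 2) * s * hypF η (N.rho k * s) with hC
  have hη2 : 0 < η - 2 := by linarith
  have hF := hypF_nonneg hη (mul_nonneg hρ.le hs)
  have hC0 : 0 ≤ C := by positivity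
  have hpt : ∀ᵐ p ∂N.powerLaw k, ENNReal.ofReal (2 * Real.pi) *
      radial η (N.protectionRadius .ccu η k p r) (s * p) =
      ENNReal.ofReal (2 * Real.pi * C) * ENNReal.ofReal (p ^ (2 / η)) := by
    filter_upwards [N.powerLaw_pos k] with p hp
    have ha : 0 < (p / N.rho k) ^ (1 / η) := Real.rpow_pos_of_pos (div_pos hp hρ) _
    change _ * radial η ((p / N.rho k) ^ (1 / η)) (s * p) = _
    rw [radial_eq hη ha (mul_nonneg hs hp.le), ← ENNReal.ofReal_mul (by positivity),
      ← ENNReal.ofReal_mul (by positivity)]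
    congr 1
    have e1 : ((p / N.rho k) ^ (1 / η)) ^ (-η) = N.rho k / p := by
      rw [← Real.rpow_mul (div_pos hp hρ).le]
      have : 1 / η * -η = -1 := by field_simp
      rw [this, Real.rpow_neg_one, inv_div]
    have e2 : ((p / N.rho k) ^ (1 / η)) ^ (2 - η) * p = N.rho k ^ (1 - 2 / η) * p ^ (2 / η) := by
      rw [← Real.rpow_mul (div_pos hp hρ).le, Real.div_rpow hp.le hρ.le]
      have h1 : 1 / η * (2 - η) = 2 / η - 1 := by field_simp
      have h2 : 1 - 2 / η = -(2 / η - 1) := by ring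
      rw [h1, h2, Real.rpow_neg hρ.le, Real.rpow_sub_one hp.ne']
      field_simp
    rw [e1, show s * p * (N.rho k / p) = N.rho k * s by field_simp, hC]
    calc _ = 2 * Real.pi * (((p / N.rho k) ^ (1 / η)) ^ (2 - η) * p) * s / (η - 2) *
          hypF η (N.rho k * s) := by ring
      _ = _ := by rw [e2]; ring
  rw [ueTransform, lintegral_congr_ae hpt, lintegral_const_mul _ (by fun_prop),
    N.lintegral_powerLaw_rpow k (by positivity), ← ENNReal.ofReal_mul (by positivity),
    ← ENNReal.ofReal_mul (N.lam_pos k).le, expNeg_ofReal, ltUECentre]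
  · congr 2; rw [hC]; ring
  · have := N.powerMoment_nonneg k (2 / η)
    have := N.lam_pos k
    positivity

/-- The radius `r` does not depend on the power, so `p` stays in the hypergeometric argument and the
mean is kept as it is. -/
lemma ueTransform_ceu {η : ℝ} (hη : 2 < η) (k : Fin K) {s r : ℝ} (hs : 0 ≤ s) (hr : 0 < r) :
    N.ueTransform η .ceu k s r = ENNReal.ofReal (N.ltUEEdge η k s r) := by
  have hη2 : 0 < η - 2 := by linarith
  set g : ℝ → ℝ := fun p =>
    r ^ (2 - η) * p * s * hyp2F1 1 (1 - 2 / η) (2 - 2 / η) (-(p * s * r ^ (-η))) with hg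
  have hz : ∀ p, 0 ≤ p → 0 ≤ p * s * r ^ (-η) := fun p hp => by positivity
  have hg0 : ∀ p, 0 ≤ p → 0 ≤ g p := fun p hp =>
    mul_nonneg (by positivity) (hypF_nonneg hη (hz p hp))
  have hgm : Measurable g :=
    (by fun_prop : Measurable fun p : ℝ => r ^ (2 - η) * p * s).mul
      ((measurable_hypF hη).comp (by fun_prop : Measurable fun p : ℝ => p * s * r ^ (-η)))
  have hgC : ∀ p, 0 ≤ p → p ≤ N.pU → g p ≤ r ^ (2 - η) * N.pU * s := fun p hp hpu =>
    (mul_le_of_le_one_right (by positivity) (hypF_le_one hη (hz p hp))).trans (by gcongr)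
  have hpt : ∀ᵐ p ∂N.powerLaw k, ENNReal.ofReal (2 * Real.pi) *
      radial η (N.protectionRadius .ceu η k p r) (s * p) =
      ENNReal.ofReal (2 * Real.pi / (η - 2)) * ENNReal.ofReal (g p) := by
    filter_upwards [N.powerLaw_pos k] with p hp
    change _ * radial η r (s * p) = _
    rw [radial_eq hη hr (mul_nonneg hs hp.le), ← ENNReal.ofReal_mul (by positivity),
      ← ENNReal.ofReal_mul (by positivity)]
    congr 1
    simp only [hg, hypF]
    rw [mul_comm s p]; ring
  have h := N.lintegral_powerLaw_ofReal k hgm hg0 hgC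
  rw [ueTransform, lintegral_congr_ae hpt, lintegral_const_mul _ (by fun_prop), h,
    ← ENNReal.ofReal_mul (by positivity), ← ENNReal.ofReal_mul (N.lam_pos k).le, expNeg_ofReal,
    ltUEEdge]
  · congr 2; ring
  · have := N.lam_pos k
    have : 0 ≤ N.powerMean k g := by
      rw [powerMean]
      refine add_nonneg (intervalIntegral.integral_nonneg (N.edgeRadius_pos k).le fun x hx => ?_)
        (mul_nonneg (hg0 _ N.pU_pos.le) (N.probCEU_pos k).le)
      have hx0 := hx.1
      have := N.lamBar_pos k
      have := N.rho_pos k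
      exact mul_nonneg (hg0 _ (by positivity)) (by positivity)
    positivity

/-- Tangent line bound for the concave function `p ↦ p y / (1 + p y)`. -/
lemma kernel_le_tangent {η s m p x : ℝ} (hs : 0 ≤ s) (hp : 0 ≤ p) (hx : 0 ≤ x) :
    kernel η (s * p) x * (1 + s * m * x ^ (-η)) ^ 2 ≤
      s * x ^ (-η) * p + (s * m * x ^ (-η)) ^ 2 := by
  have hc : 0 ≤ s * x ^ (-η) := mul_nonneg hs (Real.rpow_nonneg hx _)
  have e1 : s * p * x ^ (-η) = (s * x ^ (-η)) * p := by ring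
  have e2 : s * m * x ^ (-η) = (s * x ^ (-η)) * m := by ring
  rw [kernel, e1, e2]
  set c := s * x ^ (-η)
  have h1 : 0 < 1 + c * p := by positivity
  rw [div_mul_eq_mul_div, div_le_iff₀ h1]
  -- The difference of the two sides is exactly `(c p - c m) ^ 2`.
  nlinarith [sq_nonneg (c * p - c * m)]

/-- Jensen's inequality through the tangent at the mean power `m`: an affine bound integrates to its
value at `m`, where it touches the kernel. -/
lemma lintegral_kernel_le (k : Fin K) {η s x : ℝ} (hs : 0 ≤ s) (hx : 0 ≤ x) :
    ∫⁻ p, ENNReal.ofReal (kernel η (s * p) x) ∂N.powerLaw k ≤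
      ENNReal.ofReal (kernel η (s * N.powerMoment k 1) x) := by
  set m := N.powerMoment k 1 with hm
  have hm0 : 0 ≤ m := N.powerMoment_nonneg k 1
  have hc : 0 ≤ s * x ^ (-η) := mul_nonneg hs (Real.rpow_nonneg hx _)
  set d := (1 + s * m * x ^ (-η)) ^ 2 with hd
  have hmx : 0 ≤ s * m * x ^ (-η) := by
    have := mul_nonneg hc hm0
    linarith [this, show s * x ^ (-η) * m = s * m * x ^ (-η) by ring]
  have hd0 : 0 < d := by positivity
  have h1 : ∀ᵐ p ∂N.powerLaw k, ENNReal.ofReal (kernel η (s * p) x) ≤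
      ENNReal.ofReal (s * x ^ (-η) / d) * ENNReal.ofReal (p ^ (1 : ℝ)) +
        ENNReal.ofReal ((s * m * x ^ (-η)) ^ 2 / d) := by
    filter_upwards [N.powerLaw_pos k] with p hp
    rw [Real.rpow_one, ← ENNReal.ofReal_mul (by positivity),
      ← ENNReal.ofReal_add (by positivity) (by positivity)]
    refine ENNReal.ofReal_le_ofReal ?_
    rw [div_mul_eq_mul_div, ← add_div, le_div_iff₀ hd0]
    exact kernel_le_tangent hs hp.le hx
  refine (lintegral_mono_ae h1).trans (le_of_eq ?_)
  rw [lintegral_add_right _ measurable_const, lintegral_const_mul _ (by fun_prop),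
    N.lintegral_powerLaw_rpow k zero_le_one, lintegral_const, measure_univ, mul_one, ← hm,
    ← ENNReal.ofReal_mul (by positivity), ← ENNReal.ofReal_add (by positivity) (by positivity)]
  congr 1
  have : 1 + s * m * x ^ (-η) ≠ 0 := by positivity
  rw [kernel, hd]
  field_simp

/-- After exchanging the power and radial integrals, Jensen's inequality applies at every radius.
The simplified exponent is larger, hence the transform smaller. -/
lemma ltUEEdgeSimple_le {η : ℝ} (hη : 2 < η) (k : Fin K) {s r : ℝ} (hs : 0 ≤ s) (hr : 0 < r) :
    N.ltUEEdgeSimple η k s r ≤ N.ltUEEdge η k s r := by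
  have hη2 : 0 < η - 2 := by linarith
  set m := N.powerMoment k 1 with hm
  have hm0 : 0 ≤ m := N.powerMoment_nonneg k 1
  have h1 : ENNReal.ofReal (N.ltUEEdgeSimple η k s r) =
      expNeg (ENNReal.ofReal (N.lam k) * (ENNReal.ofReal (2 * Real.pi) * radial η r (s * m))) := by
    have hF := hypF_nonneg hη (z := s * m * r ^ (-η)) (by positivity)
    have := N.lam_pos k
    rw [radial_eq hη hr (by positivity), ← ENNReal.ofReal_mul (by positivity),
      ← ENNReal.ofReal_mul this.le, expNeg_ofReal (by positivity), ltUEEdgeSimple, ← hm]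
    congr 2
    rw [hypF, mul_comm s m]; ring
  have h2 : ∫⁻ p, radial η r (s * p) ∂N.powerLaw k ≤ radial η r (s * m) := by
    simp only [radial]
    rw [lintegral_lintegral_swap]
    · refine setLIntegral_mono' measurableSet_Ioi fun x hx => ?_
      have hx0 : 0 < x := hr.trans hx
      simp_rw [ENNReal.ofReal_mul hx0.le]
      rw [lintegral_const_mul _ (by unfold kernel; fun_prop)]
      gcongr
      exact N.lintegral_kernel_le k hs hx0.le
    · unfold kernel; fun_prop
  have h3 : ENNReal.ofReal (N.ltUEEdgeSimple η k s r) ≤ ENNReal.ofReal (N.ltUEEdge η k s r) := by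
    rw [h1, ← N.ueTransform_ceu hη k hs hr, ueTransform]
    refine expNeg_antitone ?_
    gcongr
    rw [lintegral_const_mul']
    · gcongr
      exact h2
    · exact ENNReal.ofReal_ne_top
  exact (ENNReal.ofReal_le_ofReal_iff (Real.exp_pos _).le).1 h3

/-- There is no protection region, so the radial integral starts at `0`. The sine is positive
because `2 π / η < π`. -/
lemma bsAtBS_transform (k : Fin K) {s : ℝ} (hs : 0 ≤ s) :
    expNeg (ENNReal.ofReal (N.lam k) * (ENNReal.ofReal (2 * Real.pi) *
      radial N.etaDU 0 (s * N.pD k))) = ENNReal.ofReal (N.ltBSatBS k s) := by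
  have hη := N.etaDU_gt
  have hη0 : 0 < N.etaDU := by linarith
  have := N.lam_pos k
  have := N.pD_pos k
  have hsin : 0 < Real.sin (2 * Real.pi / N.etaDU) := by
    refine Real.sin_pos_of_pos_of_lt_pi (by positivity) ?_
    rw [div_lt_iff₀ hη0]; nlinarith [Real.pi_pos]
  rw [radial_zero hη (by positivity), ← ENNReal.ofReal_mul (by positivity),
    ← ENNReal.ofReal_mul (by positivity), expNeg_ofReal (by positivity), ltBSatBS]
  congr 2; ring

lemma bsAtUE_transform (i k : Fin K) {s r : ℝ} (hs : 0 ≤ s) (hr : 0 < r) :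
    expNeg (ENNReal.ofReal (N.lam k) * (ENNReal.ofReal (2 * Real.pi) *
      radial N.etaDD (r * N.tau i / N.tau k) (s * N.pD k))) =
      ENNReal.ofReal (N.ltBSatUE i k s r) := by
  have hη := N.etaDD_gt
  have := N.lam_pos k
  have := N.pD_pos k
  have := N.tau_pos i
  have := N.tau_pos k
  have hη2 : 0 < N.etaDD - 2 := by linarith
  set a := r * N.tau i / N.tau k with ha
  have ha0 : 0 < a := by positivity
  have hF := hypF_nonneg hη (z := s * N.pD k * a ^ (-N.etaDD)) (by positivity)
  rw [radial_eq hη ha0 (by positivity), ← ENNReal.ofReal_mul (by positivity),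
    ← ENNReal.ofReal_mul (by positivity), expNeg_ofReal (by positivity), ltBSatUE, ← ha]
  congr 2
  rw [hypF, show s * N.pD k * a ^ (-N.etaDD) = a ^ (-N.etaDD) * N.pD k * s by ring]
  ring

end Network

/-! ### Fading in logarithmic form -/

/-- `log (1 + y)`, so that `expNeg (fadeLog y) = 1 / (1 + y)`. -/
noncomputable def fadeLog (y : ℝ) : ℝ≥0∞ := ENNReal.ofReal (Real.log (1 + y))

@[fun_prop]
lemma measurable_fadeLog : Measurable fadeLog := by unfold fadeLog; fun_prop

lemma expNeg_fadeLog {y : ℝ} (hy : 0 ≤ y) : expNeg (fadeLog y) = ENNReal.ofReal ((1 + y)⁻¹) := by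
  rw [fadeLog, expNeg_ofReal (Real.log_nonneg (by linarith)), Real.exp_neg,
    Real.exp_log (by linarith)]

/-- The Laplace transform of the gain is `1 / (1 + l)`; averaging a fading gain thus replaces the
received power `l` by `log (1 + l)` in the exponent. -/
lemma markLog_expMeasure {l : ℝ} (hl : 0 ≤ l) :
    markLog (expMeasure 1) (fun (l h : ℝ) => ENNReal.ofReal (l * h)) l = fadeLog l := by
  have h := lintegral_expNeg_expMeasure zero_le_one hl
  simp only [ENNReal.ofReal_one, one_mul] at h
  rw [markLog, h, ← expNeg_fadeLog hl, negLog_expNeg]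

lemma one_sub_expNeg_fadeLog {η y x : ℝ} (hy : 0 ≤ y) (hx : 0 ≤ x) :
    1 - expNeg (fadeLog (y * x ^ (-η))) = ENNReal.ofReal (kernel η y x) := by
  have : 0 ≤ y * x ^ (-η) := mul_nonneg hy (Real.rpow_nonneg hx _)
  rw [expNeg_fadeLog this, ← one_sub_kernel hy hx, ENNReal.ofReal_sub _ (by positivity),
    ENNReal.ofReal_one]

lemma measurable_kernel (η y : ℝ) : Measurable (kernel η y) := by unfold kernel; fun_prop

lemma lintegral_kernel_plane {η y a : ℝ} (ha : 0 ≤ a) :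
    ∫⁻ x in {x : Plane | a < ‖x‖}, ENNReal.ofReal (kernel η y ‖x‖) =
      ENNReal.ofReal (2 * Real.pi) * radial η a y := by
  have hk := measurable_kernel η y
  rw [setLIntegral_norm_plane (g := fun x => ENNReal.ofReal (kernel η y x)) (by fun_prop) ha,
    radial, ← lintegral_const_mul _ (by fun_prop)]
  refine setLIntegral_congr_fun measurableSet_Ioi fun r hr => ?_
  have hr0 : 0 < r := ha.trans_lt hr
  rw [ENNReal.ofReal_mul (by positivity), ENNReal.ofReal_mul hr0.le, mul_assoc]

namespace Elements

/-! ### The sources of randomness -/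

section Sources

variable {K : ℕ} {Ω : Type*} {mΩ : MeasurableSpace Ω} {μ : Measure Ω} {N : Network K}
  {E : Elements K Ω}

/-- The σ-algebra generated by a set of sources. -/
@[reducible] def sig (E : Elements K Ω) (T : Set (Source K)) : MeasurableSpace Ω := ⨆ s ∈ T, E.sigma s

lemma sigma_le_sig {T : Set (Source K)} {s : Source K} (h : s ∈ T) : E.sigma s ≤ E.sig T :=
  le_iSup₂ (f := fun s _ => E.sigma s) s h

lemma sig_mono {T T' : Set (Source K)} (h : T ⊆ T') : E.sig T ≤ E.sig T' :=
  biSup_mono h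

lemma IsModel.sigma_le (hE : E.IsModel N μ) (s : Source K) : E.sigma s ≤ mΩ := by
  cases s with
  | bsAtUE k => exact iSup_le fun n => ((hE.bsAtUE_ppp k).measurable n).comap_le
  | bsAtBS k => exact iSup_le fun n => ((hE.bsAtBS_ppp k).measurable n).comap_le
  | ue k => exact iSup_le fun n => ((hE.ue_ppp k).measurable n).comap_le
  | uePower k n => exact (hE.uePower_meas k n).comap_le
  | bsFading k n => exact (hE.bsFading_meas k n).comap_le
  | ueFading k n => exact (hE.ueFading_meas k n).comap_le
  | linkFading => exact hE.linkFading_meas.comap_le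
  | selfInterference => exact hE.selfInterference_meas.comap_le
  | mateDist i => exact (hE.mateDist_meas i).comap_le
  | mateAngle => exact hE.mateAngle_meas.comap_le
  | mateFading => exact hE.mateFading_meas.comap_le

lemma IsModel.sig_le (hE : E.IsModel N μ) (T : Set (Source K)) : E.sig T ≤ mΩ :=
  iSup₂_le fun s _ => hE.sigma_le s

lemma IsModel.indep_sig (hE : E.IsModel N μ) {T T' : Set (Source K)} (h : Disjoint T T') :
    Indep (E.sig T) (E.sig T') μ :=
  indep_iSup_of_disjoint hE.sigma_le hE.indep h

lemma IsModel.indep_sig_sigma (hE : E.IsModel N μ) {T : Set (Source K)} {s : Source K}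
    (h : s ∉ T) : Indep (E.sig T) (E.sigma s) μ :=
  indep_of_indep_of_le_right (hE.indep_sig (Set.disjoint_singleton_right.2 h))
    (sigma_le_sig (Set.mem_singleton s))

variable {T : Set (Source K)}

lemma measurable_bsAtUE {k : Fin K} (h : .bsAtUE k ∈ T) (n : ℕ) :
    Measurable[E.sig T] (E.bsAtUE k n) :=
  measurable_iff_comap_le.2 (le_trans (le_iSup
    (fun n => MeasurableSpace.comap (E.bsAtUE k n) inferInstance) n) (sigma_le_sig h))

lemma measurable_bsAtBS {k : Fin K} (h : .bsAtBS k ∈ T) (n : ℕ) :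
    Measurable[E.sig T] (E.bsAtBS k n) :=
  measurable_iff_comap_le.2 (le_trans (le_iSup
    (fun n => MeasurableSpace.comap (E.bsAtBS k n) inferInstance) n) (sigma_le_sig h))

lemma measurable_ue {k : Fin K} (h : .ue k ∈ T) (n : ℕ) : Measurable[E.sig T] (E.ue k n) :=
  measurable_iff_comap_le.2 (le_trans (le_iSup
    (fun n => MeasurableSpace.comap (E.ue k n) inferInstance) n) (sigma_le_sig h))

lemma measurable_uePower {k : Fin K} {n : ℕ} (h : .uePower k n ∈ T) :
    Measurable[E.sig T] (E.uePower k n) :=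
  measurable_iff_comap_le.2 (sigma_le_sig h)

lemma measurable_bsFading {k : Fin K} {n : ℕ} (h : .bsFading k n ∈ T) :
    Measurable[E.sig T] (E.bsFading k n) :=
  measurable_iff_comap_le.2 (sigma_le_sig h)

lemma measurable_ueFading {k : Fin K} {n : ℕ} (h : .ueFading k n ∈ T) :
    Measurable[E.sig T] (E.ueFading k n) :=
  measurable_iff_comap_le.2 (sigma_le_sig h)

lemma measurable_selfInterference (h : .selfInterference ∈ T) :
    Measurable[E.sig T] E.selfInterference :=
  measurable_iff_comap_le.2 (sigma_le_sig h)

lemma measurable_mateDist {i : Fin K} (h : .mateDist i ∈ T) : Measurable[E.sig T] (E.mateDist i) :=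
  measurable_iff_comap_le.2 (sigma_le_sig h)

lemma measurable_mateAngle (h : .mateAngle ∈ T) : Measurable[E.sig T] E.mateAngle :=
  measurable_iff_comap_le.2 (sigma_le_sig h)

lemma measurable_mateFading (h : .mateFading ∈ T) : Measurable[E.sig T] E.mateFading :=
  measurable_iff_comap_le.2 (sigma_le_sig h)

lemma measurable_nearest_sig {k : Fin K} (h : .bsAtUE k ∈ T) :
    Measurable[E.sig T] (E.nearest k) :=
  @measurable_nearestDist Ω (E.sig T) _ (measurable_bsAtUE h)

lemma IsModel.measurable_nearest (hE : E.IsModel N μ) (k : Fin K) : Measurable (E.nearest k) :=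
  measurable_nearestDist (hE.bsAtUE_ppp k).measurable

/-- Functions of disjoint groups of sources are independent. -/
lemma IsModel.lintegral_prod_sig [IsProbabilityMeasure μ] (hE : E.IsModel N μ) {ι : Type*}
    (lab : Source K → ι)
    {f : ι → Ω → ℝ≥0∞} (hf : ∀ j, Measurable[E.sig (lab ⁻¹' {j})] (f j)) (s : Finset ι) :
    ∫⁻ ω, ∏ j ∈ s, f j ω ∂μ = ∏ j ∈ s, ∫⁻ ω, f j ω ∂μ := by
  classical
  induction s using Finset.induction_on with
  | empty => simp
  | insert a s ha ih =>
    simp_rw [Finset.prod_insert ha]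
    rw [lintegral_mul_eq_lintegral_mul_lintegral_of_independent_measurableSpace
      (hE.sig_le (lab ⁻¹' {a})) (hE.sig_le (lab ⁻¹' s)) _ (hf a), ih]
    · refine Finset.measurable_fun_prod _ fun j hj => (hf j).mono (sig_mono ?_) le_rfl
      exact Set.preimage_mono (by simpa using hj)
    · refine hE.indep_sig (Disjoint.preimage _ ?_)
      simpa using ha

/-- Conditioning on the serving distance `R`, whose group of sources is `j₀`. -/
lemma IsModel.lintegral_groups [IsProbabilityMeasure μ] (hE : E.IsModel N μ) {ι : Type*}
    [Fintype ι] (lab : Source K → ι) {Y : ι → ℝ → Ω → ℝ≥0∞}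
    (hY : ∀ j, Measurable[(inferInstance : MeasurableSpace ℝ).prod (E.sig (lab ⁻¹' {j}))]
      (Function.uncurry (Y j))) {j₀ : ι} (hj₀ : ∀ r ω, Y j₀ r ω = 1) {Z : Ω → ℝ≥0∞} {R : Ω → ℝ}
    (hZ : Measurable[E.sig (lab ⁻¹' {j₀})] Z) (hR : Measurable[E.sig (lab ⁻¹' {j₀})] R) :
    ∫⁻ ω, Z ω * ∏ j, Y j (R ω) ω ∂μ = ∫⁻ ω, Z ω * ∏ j, ∫⁻ ω', Y j (R ω) ω' ∂μ ∂μ := by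
  classical
  -- The factor of the group `j₀` is one and drops out of the product, so the other factors are
  -- independent of `Z` and `R`, which may be frozen.
  have hind : Indep (E.sig (lab ⁻¹' {j₀})) (E.sig (lab ⁻¹' {j₀}ᶜ)) μ :=
    hE.indep_sig (Disjoint.preimage _ disjoint_compl_right)
  have hle : ∀ j, j ≠ j₀ → E.sig (lab ⁻¹' {j}) ≤ E.sig (lab ⁻¹' {j₀}ᶜ) := fun j hj =>
    sig_mono (Set.preimage_mono (Set.singleton_subset_iff.2 hj))
  have hp : ∀ r ω, ∏ j, Y j r ω = ∏ j ∈ Finset.univ.erase j₀, Y j r ω := fun r ω =>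
    (Finset.prod_erase (f := fun j => Y j r ω) _ (hj₀ r ω)).symm
  have hfr := lintegral_freeze (μ := μ) (hE.sig_le _) (hE.sig_le (lab ⁻¹' {j₀}ᶜ)) hind
    (A := fun ω => (Z ω, R ω)) (hZ.prodMk hR)
    (F := fun a ω => a.1 * ∏ j ∈ Finset.univ.erase j₀, Y j a.2 ω) (by
      refine Measurable.mul (measurable_fst.comp measurable_fst)
        (Finset.measurable_fun_prod _ fun j hj => ?_)
      have h1 := (hY j).mono (sup_le_sup le_rfl
        (MeasurableSpace.comap_mono (hle j (Finset.ne_of_mem_erase hj)))) le_rfl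
      exact Measurable.comp (g := Function.uncurry (Y j))
        (f := fun p : (ℝ≥0∞ × ℝ) × Ω => (p.1.2, p.2)) h1
        ((measurable_snd.comp measurable_fst).prodMk measurable_snd))
  simp_rw [hp]
  rw [hfr]
  have hsec : ∀ j r, Measurable[E.sig (lab ⁻¹' {j})] (Y j r) := fun j r =>
    Measurable.comp (g := Function.uncurry (Y j)) (f := fun ω => (r, ω)) (hY j)
      (@measurable_prodMk_left ℝ Ω _ (E.sig (lab ⁻¹' {j})) r)
  refine lintegral_congr fun ω => ?_
  rw [lintegral_const_mul _ (Finset.measurable_fun_prod _ fun j _ =>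
    (hsec j _).mono (hE.sig_le _) le_rfl), hE.lintegral_prod_sig lab (fun j => hsec j (R ω))]
  congr 1
  refine Finset.prod_erase _ ?_
  simp [hj₀]

end Sources

/-! ### Interference as a function of the serving distance -/

section Fields

variable {K : ℕ} {Ω : Type*} (E : Elements K Ω) (N : Network K)

open Classical in
/-- Interference of the UEs of tier `k`, if the serving distance is `r`. -/
noncomputable def ueField (η : ℝ) (c : UserClass) (k : Fin K) (r : ℝ) (ω : Ω) : ℝ≥0∞ :=
  ∑' n, if N.protectionRadius c η k (E.uePower k n ω) r < ‖E.ue k n ω‖ then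
    ENNReal.ofReal (E.uePower k n ω * E.ueFading k n ω * ‖E.ue k n ω‖ ^ (-η)) else 0

lemma interfUE_eq (η : ℝ) (c : UserClass) (i k : Fin K) (ω : Ω) :
    E.interfUE N η c i k ω = E.ueField N η c k (E.nearest i ω) ω := rfl

/-- Intra-cell interference, if the serving distance is `r`. -/
noncomputable def mateField (T : FDCellular.Topology) (i : Fin K) (r : ℝ) (ω : Ω) : ℝ≥0∞ :=
  match T with
  | .twoNode => 0
  | .threeNode => ENNReal.ofReal (N.txPower i (E.mateDist i ω) * E.mateFading ω *
      (E.mateDist i ω ^ 2 + r ^ 2 -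
        2 * r * E.mateDist i ω * Real.cos (E.mateAngle ω)) ^ (-N.etaUD / 2))

lemma interfIntraCell_eq (T : FDCellular.Topology) (i : Fin K) (ω : Ω) :
    E.interfIntraCell N T i ω = E.mateField N T i (E.nearest i ω) ω := by
  cases T <;> rfl

/-- Self-interference at the test UE, if the serving distance is `r`. -/
noncomputable def selfField (T : FDCellular.Topology) (i : Fin K) (r : ℝ) (ω : Ω) : ℝ :=
  match T with
  | .twoNode => N.betaD * E.selfInterference ω * N.txPower i r * N.crossFactor .dl i i
  | .threeNode => 0

lemma selfInterfDL_eq (T : FDCellular.Topology) (i : Fin K) (ω : Ω) :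
    E.selfInterfDL N T i ω = E.selfField N T i (E.nearest i ω) ω := by
  cases T <;> rfl

/-- Interference of all BSs of tier `k` on the test UE. -/
noncomputable def bsField (k : Fin K) (ω : Ω) : ℝ≥0∞ :=
  ∑' n, ENNReal.ofReal (N.pD k * E.bsFading k n ω * ‖E.bsAtUE k n ω‖ ^ (-N.etaDD))

lemma interfBSatUE_of_ne {i k : Fin K} (h : k ≠ i) (ω : Ω) :
    E.interfBSatUE N i k ω = E.bsField N k ω := by
  simp [interfBSatUE, bsField, h]

/-- Association of the test UE with tier `i` at distance `r`, as far as tier `k` is concerned. -/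
noncomputable def assocFactor (i k : Fin K) (r : ℝ) (ω : Ω) : ℝ≥0∞ :=
  if k = i then 1 else if N.tau i * r < N.tau k * E.nearest k ω then 1 else 0

/-- At a frozen serving distance the association event is a product of conditions on single tiers,
and these are independent. -/
lemma prod_assocFactor (i : Fin K) (ω : Ω) :
    ∏ k, E.assocFactor N i k (E.nearest i ω) ω = (E.associated N i).indicator 1 ω := by
  by_cases h : ω ∈ E.associated N i
  · rw [Set.indicator_of_mem h]
    refine Finset.prod_eq_one fun k _ => ?_
    rw [assocFactor]
    split_ifs with h1 h2
    · rfl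
    · rfl
    · exact absurd (h k h1) h2
  · rw [Set.indicator_of_notMem h]
    simp only [associated, Set.mem_ofPred_eq, not_forall] at h
    obtain ⟨k, hk, hk'⟩ := h
    exact Finset.prod_eq_zero (Finset.mem_univ k) (by rw [assocFactor, if_neg hk, if_neg hk'])

variable {E} {N} [m : MeasurableSpace Ω]

lemma measurable_ueField (η : ℝ) (c : UserClass) {k : Fin K} (hx : ∀ n, Measurable (E.ue k n))
    (hp : ∀ n, Measurable (E.uePower k n)) (hh : ∀ n, Measurable (E.ueFading k n)) :
    Measurable fun q : ℝ × Ω => E.ueField N η c k q.1 q.2 := by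
  refine Measurable.tsum fun n => Measurable.ite (measurableSet_lt ?_ ?_) ?_ measurable_const
  · have := hp n
    cases c <;> unfold Network.protectionRadius <;> fun_prop
  · exact ((hx n).comp measurable_snd).norm
  · have h1 := (hx n).norm
    have h2 := hp n
    have h3 := hh n
    fun_prop

lemma measurable_mateField (T : FDCellular.Topology) {i : Fin K} (hd : Measurable (E.mateDist i))
    (ha : Measurable E.mateAngle) (hh : Measurable E.mateFading) :
    Measurable fun q : ℝ × Ω => E.mateField N T i q.1 q.2 := by
  cases T
  · exact measurable_const
  · unfold mateField
    fun_prop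

lemma measurable_selfField (T : FDCellular.Topology) (i : Fin K)
    (hs : Measurable E.selfInterference) :
    Measurable fun q : ℝ × Ω => E.selfField N T i q.1 q.2 := by
  cases T
  · unfold selfField
    fun_prop
  · exact measurable_const

lemma measurable_interfBSatUE {i k : Fin K} (hx : ∀ n, Measurable (E.bsAtUE k n))
    (hi : Measurable (E.nearest i)) (hh : ∀ n, Measurable (E.bsFading k n)) :
    Measurable (E.interfBSatUE N i k) := by
  refine Measurable.tsum fun n => Measurable.ite ?_ measurable_const ?_
  · by_cases h : k = i
    · simp only [h, true_and]
      subst h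
      exact measurableSet_eq_fun (hx n).norm hi
    · simp [h]
  · have h1 := (hx n).norm
    have h3 := hh n
    fun_prop

lemma measurable_bsField {k : Fin K} (hx : ∀ n, Measurable (E.bsAtUE k n))
    (hh : ∀ n, Measurable (E.bsFading k n)) : Measurable (E.bsField N k) := by
  refine Measurable.tsum fun n => ?_
  have h1 := (hx n).norm
  have h3 := hh n
  fun_prop

lemma measurable_interfBSatBS {k : Fin K} (hx : ∀ n, Measurable (E.bsAtBS k n))
    (hh : ∀ n, Measurable (E.bsFading k n)) : Measurable (E.interfBSatBS N k) := by
  refine Measurable.tsum fun n => ?_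
  have h1 := (hx n).norm
  have h3 := hh n
  fun_prop

lemma measurable_assocFactor (i : Fin K) {k : Fin K} (hk : Measurable (E.nearest k)) :
    Measurable fun q : ℝ × Ω => E.assocFactor N i k q.1 q.2 := by
  unfold assocFactor
  by_cases h : k = i
  · simp [h]
  · simp only [h, if_false]
    exact Measurable.ite (measurableSet_lt (by fun_prop) (by fun_prop)) measurable_const
      measurable_const

end Fields

end Elements

/-! ### Void probabilities and the law of the serving distance -/

namespace Network

variable {K : ℕ} (N : Network K)

/-- Probability that no BS of tier `k` prevents the association with tier `i` at distance `r`. -/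
noncomputable def voidProb (i k : Fin K) (r : ℝ) : ℝ≥0∞ :=
  if k = i then 1 else
    ENNReal.ofReal (Real.exp (-(Real.pi * N.lam k * (r * N.tau i / N.tau k) ^ 2)))

/-- The exponents add up to `π r ^ 2 ∑ λ_k τ_i ^ 2 / τ_k ^ 2`, which is `rate * r ^ 2`. The term of
tier `i`, absent from the void probabilities, is supplied by the density of the nearest distance. -/
lemma density_mul_prod_voidProb (i : Fin K) {r : ℝ} (hr : 0 ≤ r) :
    ENNReal.ofReal (2 * (Real.pi * N.lam i) * r * Real.exp (-(Real.pi * N.lam i * r ^ 2))) *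
      ∏ k, N.voidProb i k r =
      ENNReal.ofReal (N.lam i / N.lamBar i) * ENNReal.ofReal (N.distDensity i r) := by
  set e : Fin K → ℝ := fun k =>
    Real.exp (-(Real.pi * N.lam k * (r * N.tau i / N.tau k) ^ 2)) with he
  have hb := N.lamBar_pos i
  have hl := N.lam_pos i
  have h1 : ENNReal.ofReal (e i) * ∏ k, N.voidProb i k r = ∏ k, ENNReal.ofReal (e k) := by
    have h2 : ENNReal.ofReal (e i) = ∏ k, if k = i then ENNReal.ofReal (e k) else 1 := by simp
    rw [h2, ← Finset.prod_mul_distrib]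
    refine Finset.prod_congr rfl fun k _ => ?_
    rw [voidProb]
    split_ifs <;> simp [he]
  have h3 : ∏ k, ENNReal.ofReal (e k) = ENNReal.ofReal (Real.exp (-(N.rate i * r ^ 2))) := by
    rw [← ENNReal.ofReal_prod_of_nonneg fun k _ => (Real.exp_pos _).le, ← Real.exp_sum]
    congr 2
    rw [Finset.sum_neg_distrib, neg_inj, rate, lamBar, Finset.mul_sum, Finset.sum_mul]
    exact Finset.sum_congr rfl fun k _ => by ring
  have h4 : e i = Real.exp (-(Real.pi * N.lam i * r ^ 2)) := by
    have := (N.tau_pos i).ne'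
    rw [he]; simp only; congr 2; field_simp
  rw [← h4, ENNReal.ofReal_mul (by positivity), mul_assoc, h1, h3,
    ← ENNReal.ofReal_mul (by positivity), ← ENNReal.ofReal_mul (by positivity)]
  congr 1
  rw [distDensity, rate]
  field_simp

/-- Change from the nearest distance to the serving distance. -/
lemma lintegral_mul_prod_voidProb (i : Fin K) {f : ℝ → ℝ≥0∞} (hf : Measurable f) :
    ∫⁻ r, f r * ∏ k, N.voidProb i k r ∂rayleigh (Real.pi * N.lam i) =
      ENNReal.ofReal (N.lam i / N.lamBar i) * ∫⁻ r, f r ∂N.distLaw i := by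
  have hv : Measurable fun r => ∏ k, N.voidProb i k r := by
    refine Finset.measurable_fun_prod _ fun k _ => ?_
    unfold voidProb
    split_ifs <;> fun_prop
  rw [distLaw, lintegral_rayleigh (φ := fun r => f r * ∏ k, N.voidProb i k r) (hf.mul hv),
    lintegral_rayleigh hf, ← lintegral_const_mul]
  · refine setLIntegral_congr_fun measurableSet_Ioi fun r hr => ?_
    change _ = ENNReal.ofReal (N.lam i / N.lamBar i) *
      (ENNReal.ofReal (N.distDensity i r) * f r)
    rw [← mul_assoc (ENNReal.ofReal (N.lam i / N.lamBar i)), ← N.density_mul_prod_voidProb i (le_of_lt hr)]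
    ring
  · fun_prop

end Network

/-! ### Grouping of the independent sources, and the association event -/

namespace Elements

section Model

variable {K : ℕ} {Ω : Type*} {mΩ : MeasurableSpace Ω} {μ : Measure Ω} {N : Network K}
  {E : Elements K Ω}

/-- Groups of sources: for each tier, the BSs around the test UE, the interfering UEs and the BSs
around the test BS; the test link, the self-interference and the second UE of the cell. -/
abbrev Group (K : ℕ) : Type := (Fin K × Fin 3) ⊕ Fin 3

/-- Group of a source, in the analysis of link `v`. -/
def label (v : Link) : Source K → Group K
  | .bsAtUE k => .inl (k, 0)
  | .ue k => .inl (k, 1)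
  | .uePower k _ => .inl (k, 1)
  | .ueFading k _ => .inl (k, 1)
  | .bsAtBS k => .inl (k, 2)
  | .bsFading k _ => match v with
    | .dl => .inl (k, 0)
    | .ul => .inl (k, 2)
  | .linkFading => .inr 0
  | .selfInterference => .inr 1
  | .mateDist _ => .inr 2
  | .mateAngle => .inr 2
  | .mateFading => .inr 2

/-- σ-algebra of a group of sources. -/
@[reducible] def groupSig (E : Elements K Ω) (v : Link) (g : Group K) : MeasurableSpace Ω :=
  E.sig (label v ⁻¹' {g})

/-- Joint measurability in the serving distance and the sources of a group. -/
def GroupMeasurable (E : Elements K Ω) (v : Link) (g : Group K) (F : ℝ → Ω → ℝ≥0∞) : Prop :=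
  Measurable[(inferInstance : MeasurableSpace ℝ).prod (E.groupSig v g)] (Function.uncurry F)

lemma groupMeasurable_one (v : Link) (g : Group K) : E.GroupMeasurable v g fun _ _ => 1 :=
  measurable_const

lemma IsModel.measurable_lintegral (hE : E.IsModel N μ) [IsProbabilityMeasure μ] {v : Link}
    {g : Group K} {F : ℝ → Ω → ℝ≥0∞} (hF : E.GroupMeasurable v g F) :
    Measurable fun r => ∫⁻ ω, F r ω ∂μ := by
  have : Measurable (Function.uncurry F) := Measurable.mono hF
    (sup_le_sup le_rfl (MeasurableSpace.comap_mono (hE.sig_le _))) le_rfl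
  exact this.lintegral_prod_right'

/-- The BSs of tier `i` around the test UE are the conditioning group: they determine `R` and may
enter `Z`. This is why the factor `A i` has to be trivial. -/
lemma IsModel.lintegral_network [IsProbabilityMeasure μ] (hE : E.IsModel N μ) (v : Link)
    (i : Fin K) {A B C : Fin K → ℝ → Ω → ℝ≥0∞} {S M : ℝ → Ω → ℝ≥0∞}
    (hA : ∀ k, E.GroupMeasurable v (.inl (k, 0)) (A k))
    (hB : ∀ k, E.GroupMeasurable v (.inl (k, 1)) (B k))
    (hC : ∀ k, E.GroupMeasurable v (.inl (k, 2)) (C k))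
    (hS : E.GroupMeasurable v (.inr 1) S) (hM : E.GroupMeasurable v (.inr 2) M)
    (hAi : ∀ r ω, A i r ω = 1) {Z : Ω → ℝ≥0∞} {R : Ω → ℝ}
    (hZ : Measurable[E.groupSig v (.inl (i, 0))] Z)
    (hR : Measurable[E.groupSig v (.inl (i, 0))] R) :
    ∫⁻ ω, Z ω * ((∏ k, A k (R ω) ω * B k (R ω) ω * C k (R ω) ω) * (S (R ω) ω * M (R ω) ω)) ∂μ =
      ∫⁻ ω, Z ω * ((∏ k, (∫⁻ ω', A k (R ω) ω' ∂μ) * (∫⁻ ω', B k (R ω) ω' ∂μ) *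
        (∫⁻ ω', C k (R ω) ω' ∂μ)) *
        ((∫⁻ ω', S (R ω) ω' ∂μ) * (∫⁻ ω', M (R ω) ω' ∂μ))) ∂μ := by
  have h := hE.lintegral_groups (label v)
    (Y := Sum.elim (fun p => ![A p.1, B p.1, C p.1] p.2) ![fun _ _ => 1, S, M]) (by
      rintro (⟨k, a⟩ | b)
      · fin_cases a
        · exact hA k
        · exact hB k
        · exact hC k
      · fin_cases b
        · exact groupMeasurable_one v _
        · exact hS
        · exact hM) (j₀ := .inl (i, 0)) hAi hZ hR
  simpa [Fintype.prod_sum_type, Fintype.prod_prod_type, Fin.prod_univ_three] using h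

lemma mem_label {v : Link} {s : Source K} {g : Group K} (h : label v s = g) :
    s ∈ label v ⁻¹' {g} := h

lemma groupMeasurable_assocFactor (v : Link) (i k : Fin K) :
    E.GroupMeasurable v (.inl (k, 0)) (E.assocFactor N i k) :=
  @measurable_assocFactor K Ω E N (E.groupSig v (.inl (k, 0))) i k
    (measurable_nearest_sig (mem_label rfl))

lemma IsModel.measure_lt_nearest [IsProbabilityMeasure μ] (hE : E.IsModel N μ) (k : Fin K)
    {t : ℝ} (ht : 0 ≤ t) :
    μ {ω | t < E.nearest k ω} = ENNReal.ofReal (Real.exp (-(Real.pi * N.lam k * t ^ 2))) := by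
  rw [← rayleigh_Ioi (mul_pos Real.pi_pos (N.lam_pos k)) ht,
    ← (hE.bsAtUE_ppp k).map_nearestDist (N.lam_pos k),
    Measure.map_apply (measurable_nearestDist (hE.bsAtUE_ppp k).measurable) measurableSet_Ioi]
  rfl

lemma lt_nearest_iff (i k : Fin K) (r : ℝ) (ω : Ω) :
    N.tau i * r < N.tau k * E.nearest k ω ↔ r * N.tau i / N.tau k < E.nearest k ω := by
  rw [div_lt_iff₀' (N.tau_pos k), mul_comm r]

lemma IsModel.lintegral_assocFactor [IsProbabilityMeasure μ] (hE : E.IsModel N μ) (i k : Fin K)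
    {r : ℝ} (hr : 0 ≤ r) : ∫⁻ ω, E.assocFactor N i k r ω ∂μ = N.voidProb i k r := by
  unfold assocFactor Network.voidProb
  by_cases h : k = i
  · simp [h]
  · have ht : 0 ≤ r * N.tau i / N.tau k :=
      div_nonneg (mul_nonneg hr (N.tau_pos i).le) (N.tau_pos k).le
    simp only [h, if_false]
    rw [← hE.measure_lt_nearest k ht, ← lintegral_indicator_one
      (measurableSet_lt measurable_const (hE.measurable_nearest k))]
    refine lintegral_congr fun ω => ?_
    simp only [lt_nearest_iff, Set.indicator_apply, Set.mem_ofPred_eq, Pi.one_apply]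

lemma IsModel.lintegral_nearest [IsProbabilityMeasure μ] (hE : E.IsModel N μ) (i : Fin K)
    {f : ℝ → ℝ≥0∞} (hf : Measurable f) :
    ∫⁻ ω, f (E.nearest i ω) ∂μ = ∫⁻ r, f r ∂rayleigh (Real.pi * N.lam i) := by
  rw [← (hE.bsAtUE_ppp i).map_nearestDist (N.lam_pos i),
    lintegral_map hf (measurable_nearestDist (hE.bsAtUE_ppp i).measurable)]
  rfl

lemma rayleigh_pos (b : ℝ) : ∀ᵐ r ∂rayleigh b, 0 < r := by
  filter_upwards [measure_eq_zero_iff_ae_notMem.1 (rayleigh_Iic_zero b)] with r hr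
  simpa using hr

/-- Law of the serving distance. -/
lemma IsModel.lintegral_associated [IsProbabilityMeasure μ] (hE : E.IsModel N μ) (i : Fin K)
    {f : ℝ → ℝ≥0∞} (hf : Measurable f) :
    ∫⁻ ω, f (E.nearest i ω) * (E.associated N i).indicator 1 ω ∂μ =
      ENNReal.ofReal (N.lam i / N.lamBar i) * ∫⁻ r, f r ∂N.distLaw i := by
  have hR : Measurable[E.groupSig .ul (.inl (i, 0))] (E.nearest i) :=
    measurable_nearest_sig (mem_label rfl)
  have h := hE.lintegral_network .ul i (A := E.assocFactor N i) (B := fun _ _ _ => 1)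
    (C := fun _ _ _ => 1) (S := fun _ _ => 1) (M := fun _ _ => 1)
    (fun k => groupMeasurable_assocFactor .ul i k)
    (fun k => groupMeasurable_one _ _) (fun k => groupMeasurable_one _ _)
    (groupMeasurable_one _ _) (groupMeasurable_one _ _)
    (fun r ω => by simp [assocFactor]) (hf.comp hR) hR
  simp only [mul_one, prod_assocFactor, lintegral_const, measure_univ, Function.comp_apply] at h
  have hm : ∀ k, Measurable fun r => ∫⁻ ω, E.assocFactor N i k r ω ∂μ := fun k =>
    hE.measurable_lintegral (groupMeasurable_assocFactor .ul i k)
  rw [h, hE.lintegral_nearest i (f := fun r => f r * ∏ k, ∫⁻ ω, E.assocFactor N i k r ω ∂μ)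
    (hf.mul (Finset.measurable_fun_prod _ fun k _ => hm k)), ← N.lintegral_mul_prod_voidProb i hf]
  refine lintegral_congr_ae ?_
  filter_upwards [rayleigh_pos _] with r hr
  simp_rw [hE.lintegral_assocFactor i _ hr.le]

lemma IsModel.measurableSet_associated (hE : E.IsModel N μ) (i : Fin K) :
    MeasurableSet (E.associated N i) := by
  have : E.associated N i = ⋂ k, ⋂ (_ : k ≠ i),
      {ω | N.tau i * E.nearest i ω < N.tau k * E.nearest k ω} := by
    ext ω; simp [associated]
  rw [this]
  exact MeasurableSet.iInter fun k => MeasurableSet.iInter fun _ => measurableSet_lt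
    ((hE.measurable_nearest i).const_mul _) ((hE.measurable_nearest k).const_mul _)

/-- The joint measure with the association event is a multiple of `distLaw`; taking all of `ℝ`
identifies the multiple as the association probability, which normalization removes. The laws of the
interferers' powers and of the second UE's distance thereby become explicit. -/
lemma IsModel.cond_associated_map [IsProbabilityMeasure μ] (hE : E.IsModel N μ) (i : Fin K) :
    (μ[|E.associated N i]).map (E.nearest i) = N.distLaw i := by
  have hms := hE.measurableSet_associated i
  have hmn := hE.measurable_nearest i
  have hpos : 0 < N.lam i / N.lamBar i := div_pos (N.lam_pos i) (N.lamBar_pos i)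
  have key : ∀ B : Set ℝ, MeasurableSet B → μ (E.associated N i ∩ E.nearest i ⁻¹' B) =
      ENNReal.ofReal (N.lam i / N.lamBar i) * N.distLaw i B := by
    intro B hB
    have h := hE.lintegral_associated i (f := B.indicator 1) (measurable_one.indicator hB)
    rw [lintegral_indicator_one hB] at h
    rw [← h, ← lintegral_indicator_one (hms.inter (hmn hB))]
    refine lintegral_congr fun ω => ?_
    by_cases h1 : ω ∈ E.associated N i <;> by_cases h2 : E.nearest i ω ∈ B <;>
      simp [h1, h2]
  refine Measure.ext fun B hB => ?_
  have huniv := key Set.univ MeasurableSet.univ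
  rw [Set.preimage_univ, Set.inter_univ, measure_univ, mul_one] at huniv
  rw [Measure.map_apply hmn hB, cond_apply hms, key B hB, huniv, ← mul_assoc,
    ENNReal.inv_mul_cancel (by simpa using hpos) ENNReal.ofReal_ne_top, one_mul]

lemma IsModel.uePower_map [IsProbabilityMeasure μ] (hE : E.IsModel N μ) (k : Fin K) (n : ℕ) :
    μ.map (E.uePower k n) = N.powerLaw k := by
  rw [hE.uePower_law, Network.powerLaw, ← hE.cond_associated_map k,
    Measure.map_map (N.measurable_txPower k) (hE.measurable_nearest k)]
  rfl

/-! ### Laplace transforms of the interference terms -/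

/-- Marks that come from a sequence of sources are integrated out. -/
lemma IsModel.lintegral_marks [IsProbabilityMeasure μ] (hE : E.IsModel N μ) {α β : Type*}
    [MeasurableSpace α] [MeasurableSpace β] {T : Set (Source K)} {src : ℕ → Source K}
    (hinj : Function.Injective src) (hsrc : ∀ n, src n ∉ T) {M : ℕ → Ω → β}
    (hσ : ∀ n, E.sigma (src n) = MeasurableSpace.comap (M n) inferInstance)
    {ν : Measure β} [IsProbabilityMeasure ν] (hM : ∀ n, Measurable (M n))
    (hlaw : ∀ n, μ.map (M n) = ν)
    {A : ℕ → Ω → α} (hA : ∀ n, Measurable[E.sig T] (A n))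
    {f : α → β → ℝ≥0∞} (hf : Measurable (Function.uncurry f))
    {Z : Ω → ℝ≥0∞} (hZ : Measurable[E.sig T] Z) (hZ1 : ∀ ω, Z ω ≤ 1) :
    ∫⁻ ω, Z ω * expNeg (∑' n, f (A n ω) (M n ω)) ∂μ =
      ∫⁻ ω, Z ω * expNeg (∑' n, markLog ν f (A n ω)) ∂μ := by
  -- The filtration adds to `T` the sources of the marks before `n`. It contains those marks and is
  -- independent of the `n`-th one by injectivity of `src`.
  refine lintegral_mul_expNeg_tsum_marks (H := fun n => E.sig (T ∪ src '' Set.Iio n))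
    (fun n => hE.sig_le _) (fun n => sig_mono Set.subset_union_left) hM ?_ ?_ hlaw hA hf hZ hZ1
  · intro n k hk
    rw [measurable_iff_comap_le, ← hσ k]
    exact sigma_le_sig (Or.inr ⟨k, hk, rfl⟩)
  · intro n
    rw [← hσ n]
    refine hE.indep_sig_sigma ?_
    rintro (h | ⟨k, hk, hkn⟩)
    · exact hsrc n h
    · exact (ne_of_lt hk) (hinj hkn)

/-- Exponential fading gains are integrated out. -/
lemma IsModel.lintegral_fading [IsProbabilityMeasure μ] (hE : E.IsModel N μ)
    {T : Set (Source K)} {src : ℕ → Source K}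
    (hinj : Function.Injective src) (hsrc : ∀ n, src n ∉ T) {h : ℕ → Ω → ℝ}
    (hσ : ∀ n, E.sigma (src n) = MeasurableSpace.comap (h n) inferInstance)
    (hM : ∀ n, Measurable (h n)) (hlaw : ∀ n, μ.map (h n) = expMeasure 1)
    {L : ℕ → Ω → ℝ} (hL : ∀ n, Measurable[E.sig T] (L n)) (hL0 : ∀ n ω, 0 ≤ L n ω)
    {Z : Ω → ℝ≥0∞} (hZ : Measurable[E.sig T] Z) (hZ1 : ∀ ω, Z ω ≤ 1) :
    ∫⁻ ω, Z ω * expNeg (∑' n, ENNReal.ofReal (L n ω * h n ω)) ∂μ =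
      ∫⁻ ω, Z ω * expNeg (∑' n, fadeLog (L n ω)) ∂μ := by
  rw [hE.lintegral_marks hinj hsrc hσ hM hlaw hL (f := fun l h => ENNReal.ofReal (l * h))
    (by unfold Function.uncurry; fun_prop) hZ hZ1]
  simp_rw [markLog_expMeasure (hL0 _ _)]

/-- The fading is averaged first; the Laplace functional is then applied to a function of the
positions alone. -/
lemma IsModel.lintegral_interfBSatBS [IsProbabilityMeasure μ] (hE : E.IsModel N μ) (k : Fin K)
    {s : ℝ} (hs : 0 ≤ s) :
    ∫⁻ ω, expNeg (ENNReal.ofReal s * E.interfBSatBS N k ω) ∂μ =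
      ENNReal.ofReal (N.ltBSatBS k s) := by
  have hp := N.pD_pos k
  have h0 : ∀ ω, ENNReal.ofReal s * E.interfBSatBS N k ω = ∑' n, ENNReal.ofReal
      (s * N.pD k * ‖E.bsAtBS k n ω‖ ^ (-N.etaDU) * E.bsFading k n ω) := by
    intro ω
    rw [interfBSatBS, ← ENNReal.tsum_mul_left]
    refine tsum_congr fun n => ?_
    rw [← ENNReal.ofReal_mul hs]; congr 1; ring
  have hX := fun n => (measurable_bsAtBS (E := E) (Set.mem_singleton (Source.bsAtBS k)) n)
  have h1 := hE.lintegral_fading (T := {.bsAtBS k}) (src := fun n => .bsFading k n)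
    (fun a b h => by simpa using h) (fun n => by simp) (fun n => rfl) (hE.bsFading_meas k)
    (hE.bsFading_law k) (L := fun n ω => s * N.pD k * ‖E.bsAtBS k n ω‖ ^ (-N.etaDU))
    (fun n => Measurable.comp (g := fun x : Plane => s * N.pD k * ‖x‖ ^ (-N.etaDU))
      (f := E.bsAtBS k n) (by fun_prop) (hX n)) (fun n ω => by positivity)
    (Z := fun _ => 1) measurable_const (fun _ => le_rfl)
  simp only [one_mul] at h1
  simp_rw [h0]
  rw [h1, (hE.bsAtBS_ppp k).lintegral_expNeg_tsum (N.lam_pos k).le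
    (v := fun x => fadeLog (s * N.pD k * ‖x‖ ^ (-N.etaDU))) (by fun_prop),
    ← N.bsAtBS_transform k hs, ← lintegral_kernel_plane le_rfl]
  congr 2
  -- Removing the origin from the plane costs nothing and makes the integral a radial one with inner
  -- radius `0`.
  have hz : ∀ᵐ x : Plane, x ∈ {x : Plane | 0 < ‖x‖} := by
    have : ∀ᵐ x : Plane, x ≠ 0 := by simp [ae_iff]
    filter_upwards [this] with x hx
    simpa using hx
  rw [Measure.restrict_eq_self_of_ae_mem hz]
  exact lintegral_congr fun x => one_sub_expNeg_fadeLog (by positivity) (norm_nonneg x)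

/-- Association and interference depend on the same points, so they are not independent. The
association event says that the disc of radius `r τ_i / τ_k` is empty, and the Laplace functional on
a void event yields both factors together. -/
lemma IsModel.lintegral_bsField [IsProbabilityMeasure μ] (hE : E.IsModel N μ) {i k : Fin K}
    (hki : k ≠ i) {s r : ℝ} (hs : 0 ≤ s) (hr : 0 < r) :
    ∫⁻ ω, E.assocFactor N i k r ω * expNeg (ENNReal.ofReal s * E.bsField N k ω) ∂μ =
      N.voidProb i k r * ENNReal.ofReal (N.ltBSatUE i k s r) := by
  have hp := N.pD_pos k
  have ht : 0 ≤ r * N.tau i / N.tau k :=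
    div_nonneg (mul_nonneg hr.le (N.tau_pos i).le) (N.tau_pos k).le
  have h0 : ∀ ω, ENNReal.ofReal s * E.bsField N k ω = ∑' n, ENNReal.ofReal
      (s * N.pD k * ‖E.bsAtUE k n ω‖ ^ (-N.etaDD) * E.bsFading k n ω) := by
    intro ω
    rw [bsField, ← ENNReal.tsum_mul_left]
    refine tsum_congr fun n => ?_
    rw [← ENNReal.ofReal_mul hs]; congr 1; ring
  have hX := fun n => (measurable_bsAtUE (E := E) (Set.mem_singleton (Source.bsAtUE k)) n)
  have hn := measurable_nearest_sig (E := E) (Set.mem_singleton (Source.bsAtUE k))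
  have hZ : ∀ ω, E.assocFactor N i k r ω =
      {ω | r * N.tau i / N.tau k < nearestDist (E.bsAtUE k) ω}.indicator 1 ω := by
    intro ω
    rw [assocFactor, if_neg hki]
    simp only [lt_nearest_iff, Set.indicator_apply, Set.mem_ofPred_eq, Pi.one_apply]
    rfl
  have h1 := hE.lintegral_fading (T := {.bsAtUE k}) (src := fun n => .bsFading k n)
    (fun a b h => by simpa using h) (fun n => by simp) (fun n => rfl) (hE.bsFading_meas k)
    (hE.bsFading_law k) (L := fun n ω => s * N.pD k * ‖E.bsAtUE k n ω‖ ^ (-N.etaDD))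
    (fun n => Measurable.comp (g := fun x : Plane => s * N.pD k * ‖x‖ ^ (-N.etaDD))
      (f := E.bsAtUE k n) (by fun_prop) (hX n)) (fun n ω => by positivity)
    (Z := {ω | r * N.tau i / N.tau k < nearestDist (E.bsAtUE k) ω}.indicator 1)
    (Measurable.comp (g := (Set.Ioi (r * N.tau i / N.tau k)).indicator (1 : ℝ → ℝ≥0∞))
      (f := nearestDist (E.bsAtUE k)) (measurable_one.indicator measurableSet_Ioi) hn)
    (fun ω => Set.indicator_le_self' (by simp) ω)
  simp_rw [h0, hZ]
  rw [h1, (hE.bsAtUE_ppp k).lintegral_lt_nearestDist (N.lam_pos k) ht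
    (v := fun x => fadeLog (s * N.pD k * ‖x‖ ^ (-N.etaDD))) (by fun_prop), Network.voidProb,
    if_neg hki, ← N.bsAtUE_transform i k hs hr, ← lintegral_kernel_plane ht]
  congr 3
  exact lintegral_congr fun x => one_sub_expNeg_fadeLog (by positivity) (norm_nonneg x)

/-- Received power of a BS of the serving tier at `x`, relative to the power received from the
serving BS at distance `r`, without fading. -/
noncomputable def relPower (N : Network K) (i : Fin K) (κ r : ℝ) (x : Plane) : ℝ :=
  κ * |r| ^ N.etaDD * N.pD i * ‖x‖ ^ (-N.etaDD)

lemma relPower_nonneg (N : Network K) (i : Fin K) {κ : ℝ} (hκ : 0 ≤ κ) (r : ℝ) (x : Plane) :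
    0 ≤ relPower N i κ r x := by
  have hp := N.pD_pos i
  unfold relPower
  positivity

lemma measurable_relPower (N : Network K) (i : Fin K) (κ : ℝ) :
    Measurable fun q : ℝ × Plane => relPower N i κ q.1 q.2 := by
  unfold relPower; fun_prop

/-- Together with continuity in `r`, this is what the refinement of the distance cells requires of
the weight. The absolute value in `relPower` keeps the weight nonnegative and continuous on the
whole line. -/
lemma monotoneOn_fadeLog_relPower (N : Network K) (i : Fin K) {κ : ℝ} (hκ : 0 ≤ κ) (x : Plane) :
    MonotoneOn (fun r => fadeLog (relPower N i κ r x)) (Set.Ici 0) := by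
  have hp := N.pD_pos i
  have hη := N.etaDD_pos
  intro a ha b hb hab
  have ha' : (0 : ℝ) ≤ a := ha
  have h1 := relPower_nonneg N i hκ a x
  refine ENNReal.ofReal_le_ofReal (Real.log_le_log (by positivity) ?_)
  have : |a| ≤ |b| := by rw [abs_of_nonneg ha', abs_of_nonneg (ha'.trans hab)]; exact hab
  unfold relPower
  gcongr

lemma continuous_fadeLog_relPower (N : Network K) (i : Fin K) {κ : ℝ} (hκ : 0 ≤ κ) (x : Plane) :
    Continuous fun r => fadeLog (relPower N i κ r x) := by
  have hη := N.etaDD_pos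
  refine ENNReal.continuous_ofReal.comp (Continuous.log ?_ fun r => ?_)
  · unfold relPower
    exact continuous_const.add ((((continuous_abs.rpow_const
      fun _ => Or.inr hη.le).const_mul _).mul_const _).mul_const _)
  · have := relPower_nonneg N i hκ r x
    positivity

/-- No point is closer than the nearest distance, so dropping those at exactly that distance amounts
to the strict indicator `r < ‖x‖`. -/
lemma interfBSatUE_serving (i : Fin K) {κ : ℝ} (hκ : 0 ≤ κ) (ω : Ω) :
    ENNReal.ofReal (κ * |E.nearest i ω| ^ N.etaDD) * E.interfBSatUE N i i ω =
      ∑' n, ENNReal.ofReal ({q : ℝ × Plane | q.1 < ‖q.2‖}.indicator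
        (fun q => relPower N i κ q.1 q.2) (E.nearest i ω, E.bsAtUE i n ω) *
          E.bsFading i n ω) := by
  rw [interfBSatUE, ← ENNReal.tsum_mul_left]
  refine tsum_congr fun n => ?_
  have hle : E.nearest i ω ≤ ‖E.bsAtUE i n ω‖ := nearestDist_le ω n
  by_cases h : ‖E.bsAtUE i n ω‖ = E.nearest i ω
  · rw [if_pos ⟨rfl, h⟩, Set.indicator_of_notMem (by simp [h])]
    simp
  · rw [if_neg fun h' => h h'.2, Set.indicator_of_mem
      (show (E.nearest i ω, E.bsAtUE i n ω) ∈ {q : ℝ × Plane | q.1 < ‖q.2‖} from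
        lt_of_le_of_ne hle (Ne.symm h)), ← ENNReal.ofReal_mul (by positivity), relPower]
    congr 1; ring

lemma fadeLog_indicator_relPower (N : Network K) (i : Fin K) (κ r : ℝ) (x : Plane) :
    fadeLog ({q : ℝ × Plane | q.1 < ‖q.2‖}.indicator (fun q => relPower N i κ q.1 q.2) (r, x)) =
      outside (fun r x => fadeLog (relPower N i κ r x)) r r x := by
  by_cases h : r < ‖x‖
  · rw [outside, Set.indicator_of_mem (by exact h), Set.indicator_of_mem (by exact h)]
  · rw [outside, Set.indicator_of_notMem (by exact h), Set.indicator_of_notMem (by exact h)]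
    simp [fadeLog]

/-- For `k = i` the exclusion radius `r τ_i / τ_k` is the serving distance itself. -/
lemma outsideLaplace_relPower (N : Network K) (i : Fin K) {κ r : ℝ} (hκ : 0 ≤ κ) (hr : 0 < r) :
    outsideLaplace (N.lam i) (fun r x => fadeLog (relPower N i κ r x)) r r =
      ENNReal.ofReal (N.ltBSatUE i i (κ * |r| ^ N.etaDD) r) := by
  have hp := N.pD_pos i
  rw [← N.bsAtUE_transform i i (by positivity) hr, mul_div_cancel_right₀ _ (N.tau_pos i).ne',
    ← lintegral_kernel_plane hr.le, outsideLaplace,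
    ← lintegral_indicator (measurableSet_lt measurable_const measurable_norm)]
  congr 2
  refine lintegral_congr fun x => ?_
  by_cases h : r < ‖x‖
  · rw [outside, Set.indicator_of_mem (by exact h), Set.indicator_of_mem (by exact h)]
    exact one_sub_expNeg_fadeLog (by positivity) (norm_nonneg x)
  · rw [outside, Set.indicator_of_notMem (by exact h), Set.indicator_of_notMem (by exact h),
      expNeg_zero, tsub_self]

end Model

end Elements

/-! ### Interference of the serving tier -/

namespace Elements

section Model

variable {K : ℕ} {Ω : Type*} {mΩ : MeasurableSpace Ω} {μ : Measure Ω} {N : Network K}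
  {E : Elements K Ω}

/-- Interference of the serving tier, jointly with the serving distance. -/
lemma IsModel.lintegral_servingTier [IsProbabilityMeasure μ] (hE : E.IsModel N μ) (i : Fin K)
    {κ : ℝ} (hκ : 0 ≤ κ) {φ : ℝ → ℝ≥0∞} (hφ : Measurable φ) (hφ1 : ∀ r, φ r ≤ 1) :
    ∫⁻ ω, φ (E.nearest i ω) *
        expNeg (ENNReal.ofReal (κ * |E.nearest i ω| ^ N.etaDD) * E.interfBSatUE N i i ω) ∂μ =
      ∫⁻ r, φ r * ENNReal.ofReal (N.ltBSatUE i i (κ * |r| ^ N.etaDD) r)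
        ∂rayleigh (Real.pi * N.lam i) := by
  have hX := fun n => (measurable_bsAtUE (E := E) (Set.mem_singleton (Source.bsAtUE i)) n)
  have hn := measurable_nearest_sig (E := E) (Set.mem_singleton (Source.bsAtUE i))
  have hW := measurable_relPower N i κ
  set L : ℕ → Ω → ℝ := fun n ω => {q : ℝ × Plane | q.1 < ‖q.2‖}.indicator
    (fun q => relPower N i κ q.1 q.2) (E.nearest i ω, E.bsAtUE i n ω) with hLdef
  have hL : ∀ n, Measurable[E.sig {Source.bsAtUE i}] (L n) := fun n =>
    Measurable.comp (g := {q : ℝ × Plane | q.1 < ‖q.2‖}.indicator fun q =>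
      relPower N i κ q.1 q.2) (f := fun ω => (E.nearest i ω, E.bsAtUE i n ω))
      (hW.indicator (measurableSet_lt (by fun_prop) (by fun_prop))) (hn.prodMk (hX n))
  have hL0 : ∀ n ω, 0 ≤ L n ω := fun n ω =>
    Set.indicator_nonneg (fun q _ => relPower_nonneg N i hκ q.1 q.2) _
  have hZ : Measurable[E.sig {Source.bsAtUE i}] fun ω => φ (E.nearest i ω) :=
    Measurable.comp (g := φ) hφ hn
  have h1 := hE.lintegral_fading (src := fun n => .bsFading i n)
    (fun a b h => by simpa using h) (fun n => by simp) (fun n => rfl) (hE.bsFading_meas i)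
    (hE.bsFading_law i) hL hL0 hZ (fun ω => hφ1 _)
  simp_rw [interfBSatUE_serving i hκ]
  rw [h1]
  simp_rw [hLdef, fadeLog_indicator_relPower]
  -- Without fading, the exponent is a function of the points and of the nearest distance, and the
  -- joint law of the nearest point and the others applies.
  have h3 := (hE.bsAtUE_ppp i).lintegral_nearestDist_outside (N.lam_pos i)
    (W := fun r x => fadeLog (relPower N i κ r x)) (measurable_fadeLog.comp hW)
    (monotoneOn_fadeLog_relPower N i hκ) (continuous_fadeLog_relPower N i hκ) hφ
  refine h3.trans (lintegral_congr_ae ?_)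
  filter_upwards [rayleigh_pos _] with r hr
  rw [outsideLaplace_relPower N i hκ hr]

end Model

end Elements

/-! ### Path loss and protection regions of the interfering users -/

namespace Network

variable {K : ℕ} (N : Network K)

lemma protectionRadius_nonneg (c : UserClass) (η : ℝ) (k : Fin K) {p r : ℝ} (hp : 0 ≤ p)
    (hr : 0 ≤ r) : 0 ≤ N.protectionRadius c η k p r := by
  cases c
  · exact Real.rpow_nonneg (div_nonneg hp (N.rho_pos k).le) _
  · exact hr

lemma measurable_protectionRadius (c : UserClass) (η : ℝ) (k : Fin K) (r : ℝ) :
    Measurable fun p => N.protectionRadius c η k p r := by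
  cases c <;> unfold protectionRadius <;> fun_prop

/-- Power received from a UE of tier `k` at `x` with power `p`, without fading, scaled by `s`. -/
noncomputable def uePathLoss (η : ℝ) (c : UserClass) (k : Fin K) (s r : ℝ) (x : Plane) (p : ℝ) :
    ℝ :=
  {q : Plane × ℝ | N.protectionRadius c η k q.2 r < ‖q.1‖}.indicator
    -- The positive part makes the path loss nonnegative for every `p`; powers are almost surely
    -- positive, so it changes nothing in law.
    (fun q => s * max q.2 0 * ‖q.1‖ ^ (-η)) (x, p)

lemma uePathLoss_nonneg (η : ℝ) (c : UserClass) (k : Fin K) {s : ℝ} (hs : 0 ≤ s) (r : ℝ)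
    (x : Plane) (p : ℝ) : 0 ≤ N.uePathLoss η c k s r x p :=
  Set.indicator_nonneg (fun q _ => by positivity) _

lemma measurable_uePathLoss (η : ℝ) (c : UserClass) (k : Fin K) (s r : ℝ) :
    Measurable (Function.uncurry (N.uePathLoss η c k s r)) := by
  have h := N.measurable_protectionRadius c η k r
  exact Measurable.indicator (by fun_prop) (measurableSet_lt (h.comp measurable_snd) (by fun_prop))

lemma lintegral_one_sub_uePathLoss (η : ℝ) (c : UserClass) (k : Fin K) {s r : ℝ} (hs : 0 ≤ s)
    (hr : 0 ≤ r) {p : ℝ} (hp : 0 < p) :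
    ∫⁻ x, (1 - expNeg (fadeLog (N.uePathLoss η c k s r x p))) =
      ENNReal.ofReal (2 * Real.pi) * radial η (N.protectionRadius c η k p r) (s * p) := by
  rw [← lintegral_kernel_plane (N.protectionRadius_nonneg c η k hp.le hr),
    ← lintegral_indicator (measurableSet_lt measurable_const measurable_norm)]
  refine lintegral_congr fun x => ?_
  by_cases h : N.protectionRadius c η k p r < ‖x‖
  · rw [uePathLoss, Set.indicator_of_mem (by exact h), Set.indicator_of_mem (by exact h),
      max_eq_left hp.le]
    exact one_sub_expNeg_fadeLog (by positivity) (norm_nonneg x)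
  · rw [uePathLoss, Set.indicator_of_notMem (by exact h), Set.indicator_of_notMem (by exact h)]
    simp [fadeLog, expNeg_zero]

/-- One minus the average over the power is the average of one minus the transform. Tonelli then
moves the area integral inside, where it is radial for each power. -/
lemma expNeg_markLog_uePathLoss (η : ℝ) (c : UserClass) (k : Fin K) {s r : ℝ} (hs : 0 ≤ s)
    (hr : 0 ≤ r) :
    expNeg (ENNReal.ofReal (N.lam k) * ∫⁻ x, (1 - expNeg (markLog (N.powerLaw k)
      (fun x p => fadeLog (N.uePathLoss η c k s r x p)) x))) = N.ueTransform η c k s r := by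
  have hm : Measurable (Function.uncurry fun (x : Plane) p =>
      1 - expNeg (fadeLog (N.uePathLoss η c k s r x p))) :=
    measurable_const.sub (measurable_expNeg.comp (measurable_fadeLog.comp
      (N.measurable_uePathLoss η c k s r)))
  have hsub : ∀ x, 1 - expNeg (markLog (N.powerLaw k)
      (fun x p => fadeLog (N.uePathLoss η c k s r x p)) x) =
      ∫⁻ p, (1 - expNeg (fadeLog (N.uePathLoss η c k s r x p))) ∂N.powerLaw k := by
    intro x
    rw [expNeg_markLog, lintegral_sub]
    · simp
    · exact measurable_expNeg.comp (measurable_fadeLog.comp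
        ((N.measurable_uePathLoss η c k s r).comp measurable_prodMk_left))
    · refine ne_top_of_le_ne_top ENNReal.one_ne_top
        ((lintegral_mono fun p => expNeg_le_one _).trans ?_)
      simp
    · exact ae_of_all _ fun p => expNeg_le_one _
  simp_rw [hsub]
  rw [lintegral_lintegral_swap hm.aemeasurable, ueTransform]
  congr 2
  refine lintegral_congr_ae ?_
  filter_upwards [N.powerLaw_pos k] with p hp
  exact N.lintegral_one_sub_uePathLoss η c k hs hr hp

end Network

/-! ### Transforms of the user interference and of the self-interference -/

namespace Elements

section Model

variable {K : ℕ} {Ω : Type*} {mΩ : MeasurableSpace Ω} {μ : Measure Ω} {N : Network K}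
  {E : Elements K Ω}

lemma ueField_eq_tsum {η : ℝ} (c : UserClass) (k : Fin K) {s : ℝ} (hs : 0 ≤ s) (r : ℝ) {ω : Ω}
    (hω : ∀ n, 0 < E.uePower k n ω) :
    ENNReal.ofReal s * E.ueField N η c k r ω = ∑' n, ENNReal.ofReal
      (N.uePathLoss η c k s r (E.ue k n ω) (E.uePower k n ω) * E.ueFading k n ω) := by
  rw [ueField, ← ENNReal.tsum_mul_left]
  refine tsum_congr fun n => ?_
  by_cases h : N.protectionRadius c η k (E.uePower k n ω) r < ‖E.ue k n ω‖
  · rw [if_pos h, Network.uePathLoss, Set.indicator_of_mem (by exact h), ← ENNReal.ofReal_mul hs,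
      max_eq_left (hω n).le]
    congr 1; ring
  · rw [if_neg h, Network.uePathLoss, Set.indicator_of_notMem (by exact h)]
    simp

/-- Fading is averaged given positions and powers, then powers given positions, and the Laplace
functional of the positions comes last. This order is needed because the protection region depends
on the power of the individual interferer. -/
lemma IsModel.lintegral_ueField [IsProbabilityMeasure μ] (hE : E.IsModel N μ) (η : ℝ)
    (c : UserClass) (k : Fin K) {s r : ℝ} (hs : 0 ≤ s) (hr : 0 ≤ r) :
    ∫⁻ ω, expNeg (ENNReal.ofReal s * E.ueField N η c k r ω) ∂μ = N.ueTransform η c k s r := by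
  have hpos : ∀ᵐ ω ∂μ, ∀ n, 0 < E.uePower k n ω := by
    refine ae_all_iff.2 fun n => ae_of_ae_map (hE.uePower_meas k n).aemeasurable ?_
    rw [hE.uePower_map]
    exact N.powerLaw_pos k
  have h0 : ∫⁻ ω, expNeg (ENNReal.ofReal s * E.ueField N η c k r ω) ∂μ =
      ∫⁻ ω, (1 : Ω → ℝ≥0∞) ω * expNeg (∑' n, ENNReal.ofReal
        (N.uePathLoss η c k s r (E.ue k n ω) (E.uePower k n ω) * E.ueFading k n ω)) ∂μ := by
    refine lintegral_congr_ae ?_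
    filter_upwards [hpos] with ω hω
    rw [ueField_eq_tsum c k hs r hω, Pi.one_apply, one_mul]
  have hm := N.measurable_uePathLoss η c k s r
  set L : ℕ → Ω → ℝ := fun n ω => N.uePathLoss η c k s r (E.ue k n ω) (E.uePower k n ω) with hLdef
  set T : Set (Source K) := {s | s = .ue k ∨ ∃ n, s = .uePower k n} with hT
  have hL : ∀ n, Measurable[E.sig T] (L n) := fun n =>
    Measurable.comp (g := Function.uncurry (N.uePathLoss η c k s r))
      (f := fun ω => (E.ue k n ω, E.uePower k n ω)) hm
      ((measurable_ue (Or.inl rfl) n).prodMk (measurable_uePower (Or.inr ⟨n, rfl⟩)))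
  have hL0 : ∀ n ω, 0 ≤ L n ω := fun n ω => N.uePathLoss_nonneg η c k hs r _ _
  have h1 := hE.lintegral_fading (T := T) (src := fun n => .ueFading k n)
    (fun a b h => by simpa using h) (fun n => by simp [hT]) (fun n => rfl) (hE.ueFading_meas k)
    (hE.ueFading_law k) hL hL0 (Z := 1) measurable_const (fun ω => le_rfl)
  have hA : ∀ n, Measurable[E.sig {Source.ue k}] (E.ue k n) := measurable_ue rfl
  have hf : Measurable (Function.uncurry fun x p => fadeLog (N.uePathLoss η c k s r x p)) :=
    measurable_fadeLog.comp hm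
  have h2 := hE.lintegral_marks (T := {Source.ue k}) (src := fun n => .uePower k n)
    (fun a b h => by simpa using h) (fun n => by simp) (M := E.uePower k) (fun n => rfl)
    (ν := N.powerLaw k) (hE.uePower_meas k) (hE.uePower_map k) hA hf (Z := 1) measurable_const
    (fun ω => le_rfl)
  rw [h0, h1, hLdef, h2]
  simp_rw [Pi.one_apply, one_mul]
  rw [(hE.ue_ppp k).lintegral_expNeg_tsum (N.lam_pos k).le
    (v := markLog (N.powerLaw k) fun x p => fadeLog (N.uePathLoss η c k s r x p))
    (measurable_markLog hf), N.expNeg_markLog_uePathLoss η c k hs hr]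

/-! ### Self-interference and intra-cell interference -/

lemma _root_.FDCellular.Network.lintegral_siLaw (N : Network K) {a : ℝ} (ha : 0 ≤ a) :
    ∫⁻ h, expNeg (ENNReal.ofReal (a * h)) ∂N.siLaw =
      ENNReal.ofReal (∫ h, Real.exp (-(a * h)) ∂N.siLaw) := by
  have := N.siLaw_prob
  rw [ofReal_integral_eq_lintegral_ofReal]
  · refine lintegral_congr_ae ?_
    filter_upwards [N.siLaw_nonneg] with h hh
    rw [expNeg_ofReal (by positivity)]
  · refine Integrable.of_bound (C := 1) (by fun_prop) ?_
    filter_upwards [N.siLaw_nonneg] with h hh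
    rw [Real.norm_of_nonneg (Real.exp_pos _).le, Real.exp_le_one_iff]
    have : 0 ≤ a * h := by positivity
    linarith
  · exact ae_of_all _ fun h => (Real.exp_pos _).le

lemma IsModel.lintegral_selfInterference (hE : E.IsModel N μ) {a : ℝ} (ha : 0 ≤ a) :
    ∫⁻ ω, expNeg (ENNReal.ofReal (a * E.selfInterference ω)) ∂μ =
      ENNReal.ofReal (∫ h, Real.exp (-(a * h)) ∂N.siLaw) := by
  rw [← N.lintegral_siLaw ha, ← hE.selfInterference_law, lintegral_map (by fun_prop)
    hE.selfInterference_meas]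

lemma _root_.FDCellular.Network.crossFactor_nonneg (N : Network K) (v : Link) (i k : Fin K) :
    0 ≤ N.crossFactor v i k := by unfold Network.crossFactor; positivity

lemma _root_.FDCellular.Network.intraFactor_nonneg (N : Network K) (v : Link) (i k : Fin K) :
    0 ≤ N.intraFactor v i k := by unfold Network.intraFactor; positivity

lemma IsModel.lintegral_selfInterfUL (hE : E.IsModel N μ) (i : Fin K) {x : ℝ} (hx : 0 ≤ x) :
    ∫⁻ ω, expNeg (ENNReal.ofReal x * ENNReal.ofReal (E.selfInterfUL N i ω)) ∂μ =
      ENNReal.ofReal (N.siFactorUL i x) := by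
  have h1 := N.crossFactor_nonneg .ul i i
  have h2 := N.pD_pos i
  have h3 := N.betaU_pos i
  have h := hE.lintegral_selfInterference
    (a := x * N.betaU i * N.pD i * N.crossFactor .ul i i) (by positivity)
  refine Eq.trans (lintegral_congr fun ω => ?_) (h.trans ?_)
  · rw [← ENNReal.ofReal_mul hx, selfInterfUL]
    congr 2; ring
  · rw [Network.siFactorUL]
    congr 2
    funext h; congr 1; ring

lemma IsModel.lintegral_selfField [IsProbabilityMeasure μ] (hE : E.IsModel N μ)
    (T : FDCellular.Topology) (i : Fin K) {x r : ℝ} (hx : 0 ≤ x) (hr : 0 < r) :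
    ∫⁻ ω, expNeg (ENNReal.ofReal x * ENNReal.ofReal (E.selfField N T i r ω)) ∂μ =
      ENNReal.ofReal (N.siFactorDL T i (x * N.txPower i r)) := by
  cases T
  · have h1 := N.crossFactor_nonneg .dl i i
    have h2 := N.txPower_pos i hr
    have h3 := N.betaD_pos
    have h := hE.lintegral_selfInterference
      (a := x * N.txPower i r * N.betaD * N.crossFactor .dl i i) (by positivity)
    refine Eq.trans (lintegral_congr fun ω => ?_) (h.trans ?_)
    · rw [← ENNReal.ofReal_mul hx, selfField]
      congr 2; ring
    · simp only [Network.siFactorDL]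
      congr 2
      funext h; congr 1; ring
  · simp [selfField, Network.siFactorDL, expNeg_zero]

end Model

end Elements

lemma ofReal_setIntegral_eq_lintegral {s : Set ℝ} (hs : MeasurableSet s) {f : ℝ → ℝ}
    (hf : AEStronglyMeasurable f (volume.restrict s)) (h0 : ∀ r ∈ s, 0 ≤ f r)
    (hfin : ∫⁻ r in s, ENNReal.ofReal (f r) ≠ ∞) :
    ENNReal.ofReal (∫ r in s, f r) = ∫⁻ r in s, ENNReal.ofReal (f r) := by
  rw [integral_eq_lintegral_of_nonneg_ae ((ae_restrict_iff' hs).2 (ae_of_all _ h0)) hf,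
    ENNReal.ofReal_toReal hfin]

/-! ### Averages over the second user of the cell -/

namespace Network

variable {K : ℕ} (N : Network K)

/-- Multiplying by the class probability undoes the conditioning on the class. -/
lemma probCCU_mul_densCCU (k : Fin K) {r : ℝ} (hr : r ∈ Set.Icc 0 (N.edgeRadius k)) :
    N.probCCU k * N.densCCU k r = N.distDensity k r := by
  have h := (N.probCCU_pos k).ne'
  rw [densCCU, Set.indicator_of_mem hr]
  change N.probCCU k * (_ / N.probCCU k) = _
  rw [mul_div_cancel₀ _ h, distDensity, rate]
  ring

lemma probCEU_mul_densCEU (k : Fin K) {r : ℝ} (hr : N.edgeRadius k < r) :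
    N.probCEU k * N.densCEU k r = N.distDensity k r := by
  rw [densCEU, Set.indicator_of_mem (by exact hr), Real.exp_add, probCEU, distDensity, rate]
  set a := Real.pi * N.lamBar k * (N.pU / N.rho k) ^ (2 / N.etaDD)
  have : Real.exp (-a) * Real.exp a = 1 := by rw [← Real.exp_add]; simp
  linear_combination (2 * Real.pi * N.lamBar k * r *
    Real.exp (-(Real.pi * N.lamBar k * r ^ 2))) * this

/-- Transform of the interference of the second UE of the cell at distance `d` from the BS and
angle `a`, averaged over the fading. -/
noncomputable def mateKernel (i : Fin K) (s ro d a : ℝ) : ℝ :=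
  (1 + s * (N.txPower i d * (d ^ 2 + ro ^ 2 - 2 * ro * d * Real.cos a) ^ (-N.etaUD / 2)))⁻¹

/-- The expression is at least `(d - r) ^ 2`, since the cosine is at most one. -/
lemma cosine_law_nonneg {d r : ℝ} (hd : 0 ≤ d) (hr : 0 ≤ r) (a : ℝ) :
    0 ≤ d ^ 2 + r ^ 2 - 2 * r * d * Real.cos a := by
  nlinarith [sq_nonneg (d - r), mul_nonneg (mul_nonneg hr hd) (sub_nonneg.2 (Real.cos_le_one a))]

lemma mateKernel_arg_nonneg (i : Fin K) {s ro d : ℝ} (hs : 0 ≤ s) (hro : 0 ≤ ro) (hd : 0 < d)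
    (a : ℝ) : 0 ≤ s *
      (N.txPower i d * (d ^ 2 + ro ^ 2 - 2 * ro * d * Real.cos a) ^ (-N.etaUD / 2)) :=
  mul_nonneg hs (mul_nonneg (N.txPower_pos i hd).le
    (Real.rpow_nonneg (cosine_law_nonneg hd.le hro a) _))

lemma mateKernel_nonneg (i : Fin K) {s ro d : ℝ} (hs : 0 ≤ s) (hro : 0 ≤ ro) (hd : 0 < d)
    (a : ℝ) : 0 ≤ N.mateKernel i s ro d a := by
  have := N.mateKernel_arg_nonneg i hs hro hd a
  unfold mateKernel; positivity

lemma mateKernel_le_one (i : Fin K) {s ro d : ℝ} (hs : 0 ≤ s) (hro : 0 ≤ ro) (hd : 0 < d)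
    (a : ℝ) : N.mateKernel i s ro d a ≤ 1 := by
  have := N.mateKernel_arg_nonneg i hs hro hd a
  exact inv_le_one_of_one_le₀ (by linarith)

lemma measurable_mateKernel (i : Fin K) (s ro : ℝ) :
    Measurable (Function.uncurry (N.mateKernel i s ro)) := by
  unfold mateKernel Function.uncurry; fun_prop

lemma measurable_ofReal_mateKernel (i : Fin K) (s ro : ℝ) :
    Measurable (Function.uncurry fun d a => ENNReal.ofReal (N.mateKernel i s ro d a)) := by
  unfold mateKernel Function.uncurry; fun_prop

/-- Average of `mateKernel` over the angle. -/
noncomputable def mateMean (i : Fin K) (s ro d : ℝ) : ℝ :=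
  (∫ a in N.delta..Real.pi, N.mateKernel i s ro d a) / (Real.pi - N.delta)

lemma measurable_mateMean (i : Fin K) (s ro : ℝ) : Measurable (N.mateMean i s ro) := by
  have h := (N.measurable_mateKernel i s ro).stronglyMeasurable.integral_prod_right
    (ν := volume.restrict (Set.Ioc N.delta Real.pi))
  unfold mateMean
  simp_rw [intervalIntegral.integral_of_le N.delta_lt.le]
  exact h.measurable.div_const _

lemma integrableOn_mateKernel (i : Fin K) {s ro d : ℝ} (hs : 0 ≤ s) (hro : 0 ≤ ro) (hd : 0 < d) :
    IntegrableOn (N.mateKernel i s ro d) (Set.Ioc N.delta Real.pi) := by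
  refine Integrable.of_bound (C := 1)
    ((N.measurable_mateKernel i s ro).comp measurable_prodMk_left).aestronglyMeasurable
    (ae_of_all _ fun a => ?_)
  rw [Real.norm_of_nonneg (N.mateKernel_nonneg i hs hro hd a)]
  exact N.mateKernel_le_one i hs hro hd a

lemma mateMean_nonneg (i : Fin K) {s ro d : ℝ} (hs : 0 ≤ s) (hro : 0 ≤ ro) (hd : 0 < d) :
    0 ≤ N.mateMean i s ro d :=
  div_nonneg (intervalIntegral.integral_nonneg N.delta_lt.le fun a _ =>
    N.mateKernel_nonneg i hs hro hd a) (sub_pos.2 N.delta_lt).le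

lemma mateMean_le_one (i : Fin K) {s ro d : ℝ} (hs : 0 ≤ s) (hro : 0 ≤ ro) (hd : 0 < d) :
    N.mateMean i s ro d ≤ 1 := by
  rw [mateMean, div_le_one (sub_pos.2 N.delta_lt), intervalIntegral.integral_of_le N.delta_lt.le]
  refine (setIntegral_mono_on (N.integrableOn_mateKernel i hs hro hd)
    (integrableOn_const (by simp)) measurableSet_Ioc
    fun a _ => N.mateKernel_le_one i hs hro hd a).trans ?_
  simp [N.delta_lt.le]

lemma lintegral_mateKernel (i : Fin K) {s ro d : ℝ} (hs : 0 ≤ s) (hro : 0 ≤ ro) (hd : 0 < d) :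
    ∫⁻ a, ENNReal.ofReal (N.mateKernel i s ro d a) ∂volume[|Set.Icc N.delta Real.pi] =
      ENNReal.ofReal (N.mateMean i s ro d) := by
  have hpos := sub_pos.2 N.delta_lt
  rw [ProbabilityTheory.cond, lintegral_smul_measure, Real.volume_Icc,
    restrict_Ioc_eq_restrict_Icc.symm, ← ofReal_integral_eq_lintegral_ofReal
    (N.integrableOn_mateKernel i hs hro hd)
    (ae_of_all _ fun a => N.mateKernel_nonneg i hs hro hd a), mateMean,
    intervalIntegral.integral_of_le N.delta_lt.le, ENNReal.ofReal_div_of_pos hpos, smul_eq_mul,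
    mul_comm, ENNReal.div_eq_inv_mul, mul_comm]

/-- On `[0, edgeRadius]` the second UE inverts its channel, so its power is `ρ d ^ η`. The bound
`mateMean ≤ 1` gives the finiteness that turns the extended integral into the stated real one. -/
lemma lintegral_mateMean_Ioc (i : Fin K) {s ro : ℝ} (hs : 0 ≤ s) (hro : 0 ≤ ro) :
    ∫⁻ d in Set.Ioc 0 (N.edgeRadius i),
        ENNReal.ofReal (N.distDensity i d) * ENNReal.ofReal (N.mateMean i s ro d) =
      ENNReal.ofReal (∫ r in (0 : ℝ)..N.edgeRadius i, (∫ a in N.delta..Real.pi,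
        N.probCCU i * N.densCCU i r / (1 + s * N.rho i * r ^ N.etaDD *
          (r ^ 2 + ro ^ 2 - 2 * ro * r * Real.cos a) ^ (-N.etaUD / 2))) /
          (Real.pi - N.delta)) := by
  have hm : Measurable fun r => N.distDensity i r * N.mateMean i s ro r :=
    (N.continuous_distDensity i).measurable.mul (N.measurable_mateMean i s ro)
  have he : ∀ r ∈ Set.Ioc 0 (N.edgeRadius i), (∫ a in N.delta..Real.pi,
        N.probCCU i * N.densCCU i r / (1 + s * N.rho i * r ^ N.etaDD *
          (r ^ 2 + ro ^ 2 - 2 * ro * r * Real.cos a) ^ (-N.etaUD / 2))) /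
          (Real.pi - N.delta) = N.distDensity i r * N.mateMean i s ro r := by
    intro r hr
    rw [N.probCCU_mul_densCCU i ⟨hr.1.le, hr.2⟩, mateMean, ← mul_div_assoc,
      ← intervalIntegral.integral_const_mul]
    congr 2
    funext a
    rw [mateKernel, N.txPower_of_le i hr.1.le hr.2, div_eq_mul_inv]
    congr 3; ring
  have he' : ∀ d ∈ Set.Ioc 0 (N.edgeRadius i),
      ENNReal.ofReal (N.distDensity i d) * ENNReal.ofReal (N.mateMean i s ro d) =
      ENNReal.ofReal (N.distDensity i d * N.mateMean i s ro d) := fun d hd =>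
    (ENNReal.ofReal_mul (N.distDensity_nonneg i hd.1.le)).symm
  rw [intervalIntegral.integral_of_le (N.edgeRadius_pos i).le,
    setIntegral_congr_fun measurableSet_Ioc he, ofReal_setIntegral_eq_lintegral measurableSet_Ioc
    hm.aestronglyMeasurable, setLIntegral_congr_fun measurableSet_Ioc he']
  · exact fun r hr => mul_nonneg (N.distDensity_nonneg i hr.1.le)
      (N.mateMean_nonneg i hs hro hr.1)
  · refine ne_top_of_le_ne_top (b := ENNReal.ofReal (N.probCCU i)) ENNReal.ofReal_ne_top ?_
    rw [← lintegral_Ioc_distDensity]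
    refine setLIntegral_mono' measurableSet_Ioc fun r hr => ENNReal.ofReal_le_ofReal ?_
    exact mul_le_of_le_one_right (N.distDensity_nonneg i hr.1.le)
      (N.mateMean_le_one i hs hro hr.1)

/-- Beyond the edge radius the power is truncated to `pU`. -/
lemma lintegral_mateMean_Ioi (i : Fin K) {s ro : ℝ} (hs : 0 ≤ s) (hro : 0 ≤ ro) :
    ∫⁻ d in Set.Ioi (N.edgeRadius i),
        ENNReal.ofReal (N.distDensity i d) * ENNReal.ofReal (N.mateMean i s ro d) =
      ENNReal.ofReal (∫ r in Set.Ioi (N.edgeRadius i), (∫ a in N.delta..Real.pi,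
        N.probCEU i * N.densCEU i r / (1 + s * N.pU *
          (r ^ 2 + ro ^ 2 - 2 * ro * r * Real.cos a) ^ (-N.etaUD / 2))) /
          (Real.pi - N.delta)) := by
  have hm : Measurable fun r => N.distDensity i r * N.mateMean i s ro r :=
    (N.continuous_distDensity i).measurable.mul (N.measurable_mateMean i s ro)
  have hR := N.edgeRadius_pos i
  have he : ∀ r ∈ Set.Ioi (N.edgeRadius i), (∫ a in N.delta..Real.pi,
        N.probCEU i * N.densCEU i r / (1 + s * N.pU *
          (r ^ 2 + ro ^ 2 - 2 * ro * r * Real.cos a) ^ (-N.etaUD / 2))) /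
          (Real.pi - N.delta) = N.distDensity i r * N.mateMean i s ro r := by
    intro r hr
    rw [N.probCEU_mul_densCEU i hr, mateMean, ← mul_div_assoc,
      ← intervalIntegral.integral_const_mul]
    congr 2
    funext a
    rw [mateKernel, N.txPower_of_lt i hr, div_eq_mul_inv]
    congr 3; ring
  have he' : ∀ d ∈ Set.Ioi (N.edgeRadius i),
      ENNReal.ofReal (N.distDensity i d) * ENNReal.ofReal (N.mateMean i s ro d) =
      ENNReal.ofReal (N.distDensity i d * N.mateMean i s ro d) := fun d hd =>
    (ENNReal.ofReal_mul (N.distDensity_nonneg i (hR.trans hd).le)).symm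
  rw [setIntegral_congr_fun measurableSet_Ioi he, ofReal_setIntegral_eq_lintegral measurableSet_Ioi
    hm.aestronglyMeasurable, setLIntegral_congr_fun measurableSet_Ioi he']
  · exact fun r hr => mul_nonneg (N.distDensity_nonneg i (hR.trans hr).le)
      (N.mateMean_nonneg i hs hro (hR.trans hr))
  · refine ne_top_of_le_ne_top (b := ENNReal.ofReal (N.probCEU i)) ENNReal.ofReal_ne_top ?_
    rw [← lintegral_Ioi_distDensity]
    refine setLIntegral_mono' measurableSet_Ioi fun r hr => ENNReal.ofReal_le_ofReal ?_
    exact mul_le_of_le_one_right (N.distDensity_nonneg i (hR.trans hr).le)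
      (N.mateMean_le_one i hs hro (hR.trans hr))

lemma ltIntraCell_ccu_nonneg (i : Fin K) {s ro : ℝ} (hs : 0 ≤ s) (hro : 0 ≤ ro) :
    0 ≤ ∫ r in (0 : ℝ)..N.edgeRadius i, (∫ a in N.delta..Real.pi,
      N.probCCU i * N.densCCU i r / (1 + s * N.rho i * r ^ N.etaDD *
        (r ^ 2 + ro ^ 2 - 2 * ro * r * Real.cos a) ^ (-N.etaUD / 2))) / (Real.pi - N.delta) := by
  refine intervalIntegral.integral_nonneg (N.edgeRadius_pos i).le fun r hr =>
    div_nonneg (intervalIntegral.integral_nonneg N.delta_lt.le fun a _ => ?_)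
      (sub_pos.2 N.delta_lt).le
  rw [N.probCCU_mul_densCCU i hr]
  have h1 := N.distDensity_nonneg i hr.1
  have h2 := cosine_law_nonneg hr.1 hro a
  have h3 := N.rho_pos i
  have h4 := hr.1
  positivity

lemma ltIntraCell_ceu_nonneg (i : Fin K) {s ro : ℝ} (hs : 0 ≤ s) (hro : 0 ≤ ro) :
    0 ≤ ∫ r in Set.Ioi (N.edgeRadius i), (∫ a in N.delta..Real.pi,
      N.probCEU i * N.densCEU i r / (1 + s * N.pU *
        (r ^ 2 + ro ^ 2 - 2 * ro * r * Real.cos a) ^ (-N.etaUD / 2))) / (Real.pi - N.delta) := by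
  refine setIntegral_nonneg measurableSet_Ioi fun r hr =>
    div_nonneg (intervalIntegral.integral_nonneg N.delta_lt.le fun a _ => ?_)
      (sub_pos.2 N.delta_lt).le
  rw [N.probCEU_mul_densCEU i hr]
  have hr0 : 0 < r := (N.edgeRadius_pos i).trans hr
  have h1 := N.distDensity_nonneg i hr0.le
  have h2 := cosine_law_nonneg hr0.le hro a
  have h3 := N.pU_pos
  positivity

lemma ltIntraCell_nonneg (T : FDCellular.Topology) (i k : Fin K) {s ro : ℝ} (hs : 0 ≤ s)
    (hro : 0 ≤ ro) : 0 ≤ N.ltIntraCell T i k ro s := by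
  cases T
  · exact zero_le_one
  · simp only [ltIntraCell]
    split_ifs
    · exact add_nonneg (N.ltIntraCell_ccu_nonneg i hs hro) (N.ltIntraCell_ceu_nonneg i hs hro)
    · exact zero_le_one

lemma ltIntraCell_of_ne (T : FDCellular.Topology) {i k : Fin K} (h : k ≠ i) (s ro : ℝ) :
    N.ltIntraCell T i k ro s = 1 := by
  cases T
  · rfl
  · simp [ltIntraCell, h.symm]

lemma lintegral_mateMean (i : Fin K) {s ro : ℝ} (hs : 0 ≤ s) (hro : 0 ≤ ro) :
    ∫⁻ d, ENNReal.ofReal (N.mateMean i s ro d) ∂N.distLaw i =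
      ENNReal.ofReal (N.ltIntraCell .threeNode i i ro s) := by
  rw [N.lintegral_distLaw i (N.measurable_mateMean i s ro).ennreal_ofReal,
    N.lintegral_mateMean_Ioc i hs hro, N.lintegral_mateMean_Ioi i hs hro,
    ← ENNReal.ofReal_add (N.ltIntraCell_ccu_nonneg i hs hro) (N.ltIntraCell_ceu_nonneg i hs hro),
    ltIntraCell]
  simp

end Network

/-! ### Transform of the intra-cell interference -/

namespace Elements

section Model

variable {K : ℕ} {Ω : Type*} {mΩ : MeasurableSpace Ω} {μ : Measure Ω} {N : Network K}
  {E : Elements K Ω}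

lemma IsModel.indepFun_of_sig (hE : E.IsModel N μ) {α β : Type*} [MeasurableSpace α]
    [MeasurableSpace β] {T T' : Set (Source K)} (h : Disjoint T T') {f : Ω → α} {g : Ω → β}
    (hf : Measurable[E.sig T] f) (hg : Measurable[E.sig T'] g) : IndepFun f g μ :=
  indep_of_indep_of_le_left (indep_of_indep_of_le_right (hE.indep_sig h)
    (measurable_iff_comap_le.1 hg)) (measurable_iff_comap_le.1 hf)

/-- Averaging over the fading gives `mateKernel`, over the angle `mateMean`, over the distance the
two-part formula. The three are independent. -/
lemma IsModel.lintegral_mateField [IsProbabilityMeasure μ] (hE : E.IsModel N μ)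
    (T : FDCellular.Topology) (i : Fin K) {s r : ℝ} (hs : 0 ≤ s) (hr : 0 ≤ r) :
    ∫⁻ ω, expNeg (ENNReal.ofReal s * E.mateField N T i r ω) ∂μ =
      ENNReal.ofReal (N.ltIntraCell T i i r s) := by
  cases T
  · simp [mateField, Network.ltIntraCell, expNeg_zero]
  · set q : ℝ × ℝ → ℝ := fun p => N.txPower i p.1 *
      (p.1 ^ 2 + r ^ 2 - 2 * r * p.1 * Real.cos p.2) ^ (-N.etaUD / 2) with hq
    have hqm : Measurable q := by rw [hq]; fun_prop
    have hG : Measurable (Function.uncurry fun (p : ℝ × ℝ) (h : ℝ) =>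
        expNeg (ENNReal.ofReal s * ENNReal.ofReal (q p * h))) := by
      unfold Function.uncurry
      have : Measurable fun z : (ℝ × ℝ) × ℝ => q z.1 * z.2 :=
        (hqm.comp measurable_fst).mul measurable_snd
      fun_prop
    have hd : Measurable (E.mateDist i) := hE.mateDist_meas i
    have ha := hE.mateAngle_meas
    have hlaw : μ.map (E.mateDist i) = N.distLaw i := by
      rw [hE.mateDist_law, hE.cond_associated_map]
    have hpos : ∀ᵐ ω ∂μ, 0 < E.mateDist i ω := by
      refine ae_of_ae_map hd.aemeasurable ?_
      rw [hlaw]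
      exact N.distLaw_pos i
    have i1 : IndepFun (fun ω => (E.mateDist i ω, E.mateAngle ω)) E.mateFading μ :=
      hE.indepFun_of_sig (T := {s | s = .mateDist i ∨ s = .mateAngle}) (T' := {.mateFading})
        (by simp) ((measurable_mateDist (Or.inl rfl)).prodMk (measurable_mateAngle (Or.inr rfl)))
        (measurable_mateFading rfl)
    have i2 : IndepFun (E.mateDist i) E.mateAngle μ :=
      hE.indepFun_of_sig (T := {.mateDist i}) (T' := {.mateAngle})
        (by simp) (measurable_mateDist rfl) (measurable_mateAngle rfl)
    have e0 : ∀ ω, E.mateField N .threeNode i r ω =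
        ENNReal.ofReal (q (E.mateDist i ω, E.mateAngle ω) * E.mateFading ω) := by
      intro ω
      simp only [mateField, hq]
      congr 1; ring
    simp_rw [e0]
    rw [lintegral_of_indepFun i1 (hd.prodMk ha) hE.mateFading_meas hG]
    have e1 : ∀ᵐ ω ∂μ, ∫⁻ ω', expNeg (ENNReal.ofReal s *
        ENNReal.ofReal (q (E.mateDist i ω, E.mateAngle ω) * E.mateFading ω')) ∂μ =
        ENNReal.ofReal (N.mateKernel i s r (E.mateDist i ω) (E.mateAngle ω)) := by
      filter_upwards [hpos] with ω hω
      have hq0 : 0 ≤ q (E.mateDist i ω, E.mateAngle ω) :=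
        mul_nonneg (N.txPower_pos i hω).le
          (Real.rpow_nonneg (Network.cosine_law_nonneg hω.le hr _) _)
      rw [← lintegral_map (μ := μ) (f := fun h => expNeg (ENNReal.ofReal s *
        ENNReal.ofReal (q (E.mateDist i ω, E.mateAngle ω) * h))) (by fun_prop) hE.mateFading_meas,
        hE.mateFading_law, lintegral_expNeg_expMeasure hs hq0]
      rfl
    have e2 : ∀ᵐ ω ∂μ, ∫⁻ ω', ENNReal.ofReal (N.mateKernel i s r (E.mateDist i ω)
        (E.mateAngle ω')) ∂μ = ENNReal.ofReal (N.mateMean i s r (E.mateDist i ω)) := by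
      filter_upwards [hpos] with ω hω
      rw [← lintegral_map (μ := μ) (f := fun a =>
        ENNReal.ofReal (N.mateKernel i s r (E.mateDist i ω) a))
        (N.measurable_ofReal_mateKernel i s r).of_uncurry_left ha, hE.mateAngle_law,
        N.lintegral_mateKernel i hs hr hω]
    rw [lintegral_congr_ae e1,
      lintegral_of_indepFun i2 hd ha (N.measurable_ofReal_mateKernel i s r),
      lintegral_congr_ae e2, ← lintegral_map (μ := μ)
      (f := fun d => ENNReal.ofReal (N.mateMean i s r d))
      (N.measurable_mateMean i s r).ennreal_ofReal hd, hlaw, N.lintegral_mateMean i hs hr]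

end Model

end Elements

lemma expNeg_ofReal_mul_sum {ι : Type*} (s : Finset ι) {σ : ℝ} (hσ : 0 ≤ σ) (I : ι → ℝ≥0∞)
    (a : ι → ℝ) : expNeg (ENNReal.ofReal σ * ∑ k ∈ s, I k * ENNReal.ofReal (a k)) =
      ∏ k ∈ s, expNeg (ENNReal.ofReal (σ * a k) * I k) := by
  rw [Finset.mul_sum, expNeg_sum]
  refine Finset.prod_congr rfl fun k _ => ?_
  rw [ENNReal.ofReal_mul hσ]
  congr 1; ring

lemma measurable_expNeg_mul {Ω : Type*} [MeasurableSpace Ω] {σ : ℝ → ℝ} (hσ : Measurable σ)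
    {F : ℝ → Ω → ℝ≥0∞} (hF : Measurable (Function.uncurry F)) :
    Measurable (Function.uncurry fun r ω => expNeg (ENNReal.ofReal (σ r) * F r ω)) :=
  measurable_expNeg.comp (((hσ.comp measurable_fst).ennreal_ofReal).mul hF)

/-! ### Measurability of the interference terms with respect to their groups -/

namespace Elements

section Model

variable {K : ℕ} {Ω : Type*} {mΩ : MeasurableSpace Ω} {μ : Measure Ω} {N : Network K}
  {E : Elements K Ω}

lemma GroupMeasurable.expNeg_mul {v : Link} {g : Group K} {σ : ℝ → ℝ} (hσ : Measurable σ)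
    {F : ℝ → Ω → ℝ≥0∞} (hF : E.GroupMeasurable v g F) :
    E.GroupMeasurable v g fun r ω => expNeg (ENNReal.ofReal (σ r) * F r ω) :=
  @measurable_expNeg_mul Ω (E.groupSig v g) σ hσ F hF

lemma GroupMeasurable.mul {v : Link} {g : Group K} {F G : ℝ → Ω → ℝ≥0∞}
    (hF : E.GroupMeasurable v g F) (hG : E.GroupMeasurable v g G) :
    E.GroupMeasurable v g fun r ω => F r ω * G r ω :=
  Measurable.mul hF hG

lemma groupMeasurable_of_measurable {v : Link} {g : Group K} {F : Ω → ℝ≥0∞}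
    (hF : Measurable[E.groupSig v g] F) : E.GroupMeasurable v g fun _ ω => F ω :=
  Measurable.comp (g := F) (f := fun q : ℝ × Ω => q.2) hF
    (@measurable_snd ℝ Ω _ (E.groupSig v g))

lemma groupMeasurable_ueField (v : Link) (η : ℝ) (c : UserClass) (k : Fin K) :
    E.GroupMeasurable v (.inl (k, 1)) (E.ueField N η c k) :=
  @measurable_ueField K Ω E N (E.groupSig v (.inl (k, 1))) η c k
    (measurable_ue (mem_label rfl)) (fun _ => measurable_uePower (mem_label rfl))
    (fun _ => measurable_ueFading (mem_label rfl))

lemma groupMeasurable_interfBSatBS (k : Fin K) :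
    E.GroupMeasurable .ul (.inl (k, 2)) fun _ => E.interfBSatBS N k :=
  groupMeasurable_of_measurable (@measurable_interfBSatBS K Ω E N (E.groupSig .ul (.inl (k, 2))) k
    (measurable_bsAtBS (mem_label rfl)) (fun _ => measurable_bsFading (mem_label rfl)))

lemma groupMeasurable_bsField (k : Fin K) :
    E.GroupMeasurable .dl (.inl (k, 0)) fun _ => E.bsField N k :=
  groupMeasurable_of_measurable (@measurable_bsField K Ω E N (E.groupSig .dl (.inl (k, 0))) k
    (measurable_bsAtUE (mem_label rfl)) (fun _ => measurable_bsFading (mem_label rfl)))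

lemma groupMeasurable_mateField (T : FDCellular.Topology) (i : Fin K) :
    E.GroupMeasurable .dl (.inr 2) (E.mateField N T i) :=
  @measurable_mateField K Ω E N (E.groupSig .dl (.inr 2)) T i (measurable_mateDist (mem_label rfl))
    (measurable_mateAngle (mem_label rfl)) (measurable_mateFading (mem_label rfl))

lemma groupMeasurable_selfField (T : FDCellular.Topology) (i : Fin K) :
    E.GroupMeasurable .dl (.inr 1) fun r ω => ENNReal.ofReal (E.selfField N T i r ω) :=
  ENNReal.measurable_ofReal.comp (@measurable_selfField K Ω E N (E.groupSig .dl (.inr 1)) T i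
    (measurable_selfInterference (mem_label rfl)))

lemma measurable_selfInterfUL (i : Fin K) [MeasurableSpace Ω] (h : Measurable E.selfInterference) :
    Measurable fun ω => ENNReal.ofReal (E.selfInterfUL N i ω) := by
  unfold selfInterfUL; fun_prop

lemma groupMeasurable_selfInterfUL (i : Fin K) :
    E.GroupMeasurable .ul (.inr 1) fun _ ω => ENNReal.ofReal (E.selfInterfUL N i ω) :=
  groupMeasurable_of_measurable (@measurable_selfInterfUL K Ω N E i (E.groupSig .ul (.inr 1))
    (measurable_selfInterference (mem_label rfl)))

/-! ### Fading of the test link -/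

/-- The fading gain of the test link is integrated out. -/
lemma IsModel.lintegral_link [IsProbabilityMeasure μ] (hE : E.IsModel N μ) {θ : ℝ} (hθ : 0 < θ)
    {φ D : Ω → ℝ≥0∞} {b : Ω → ℝ} (hφ : Measurable[E.sig {.linkFading}ᶜ] φ)
    (hD : Measurable[E.sig {.linkFading}ᶜ] D) (hb : Measurable[E.sig {.linkFading}ᶜ] b)
    (hb0 : ∀ᵐ ω ∂μ, 0 < b ω) :
    ∫⁻ ω, φ ω * {ω | ENNReal.ofReal θ ≤ ENNReal.ofReal (b ω * E.linkFading ω) / D ω}.indicator 1 ω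
      ∂μ = ∫⁻ ω, φ ω * expNeg (ENNReal.ofReal (θ / b ω) * D ω) ∂μ := by
  have hle := hE.sig_le {Source.linkFading}ᶜ
  have hA : Measurable[E.sig {.linkFading}ᶜ] fun ω => (φ ω, b ω, D ω) := hφ.prodMk (hb.prodMk hD)
  have hY : Measurable[E.sig {.linkFading}] E.linkFading :=
    measurable_iff_comap_le.2 (sigma_le_sig (E := E) (Set.mem_singleton Source.linkFading))
  have hind : IndepFun (fun ω => (φ ω, b ω, D ω)) E.linkFading μ :=
    hE.indepFun_of_sig disjoint_compl_left hA hY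
  have hset : MeasurableSet {q : (ℝ≥0∞ × ℝ × ℝ≥0∞) × ℝ |
      ENNReal.ofReal θ ≤ ENNReal.ofReal (q.1.2.1 * q.2) / q.1.2.2} :=
    measurableSet_le measurable_const (by fun_prop)
  have hG : Measurable (Function.uncurry fun (a : ℝ≥0∞ × ℝ × ℝ≥0∞) (h : ℝ) =>
      a.1 * {q : (ℝ≥0∞ × ℝ × ℝ≥0∞) × ℝ |
        ENNReal.ofReal θ ≤ ENNReal.ofReal (q.1.2.1 * q.2) / q.1.2.2}.indicator 1 (a, h)) :=
    (measurable_fst.comp measurable_fst).mul (measurable_one.indicator hset)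
  refine (lintegral_of_indepFun hind (hA.mono hle le_rfl) hE.linkFading_meas hG).trans ?_
  refine lintegral_congr_ae ?_
  filter_upwards [hb0] with ω hω
  have hsec : MeasurableSet {h : ℝ | ENNReal.ofReal θ ≤ ENNReal.ofReal (b ω * h) / D ω} :=
    measurableSet_le measurable_const (by fun_prop)
  have h1 := lintegral_map (μ := μ) (f := fun h : ℝ => φ ω *
    {h : ℝ | ENNReal.ofReal θ ≤ ENNReal.ofReal (b ω * h) / D ω}.indicator 1 h)
    ((measurable_one.indicator hsec).const_mul _) hE.linkFading_meas
  refine h1.symm.trans ?_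
  rw [hE.linkFading_law, lintegral_const_mul _ (measurable_one.indicator hsec),
    lintegral_indicator_one hsec, expMeasure_le_div hθ hω]

lemma IsModel.nearest_pos [IsProbabilityMeasure μ] (hE : E.IsModel N μ) (i : Fin K) :
    ∀ᵐ ω ∂μ, 0 < E.nearest i ω :=
  (hE.bsAtUE_ppp i).nearestDist_pos (N.lam_pos i)

lemma measurable_associated [MeasurableSpace Ω] (i : Fin K) (h : ∀ k, Measurable (E.nearest k)) :
    Measurable ((E.associated N i).indicator (1 : Ω → ℝ≥0∞)) := by
  have : (E.associated N i).indicator (1 : Ω → ℝ≥0∞) =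
      fun ω => ∏ k, E.assocFactor N i k (E.nearest i ω) ω := by
    funext ω; exact (prod_assocFactor E N i ω).symm
  rw [this]
  exact Finset.measurable_fun_prod _ fun k _ =>
    (measurable_assocFactor (N := N) i (h k)).comp ((h i).prodMk measurable_id)

/-- Denominator of the SINR of the uplink. -/
noncomputable def denomUL (E : Elements K Ω) (N : Network K) (c : UserClass) (i : Fin K) (ω : Ω) :
    ℝ≥0∞ :=
  ∑ k, E.interfUE N N.etaDD c i k ω * ENNReal.ofReal (N.intraFactor .ul i k) +
    ∑ k, E.interfBSatBS N k ω * ENNReal.ofReal (N.crossFactor .ul i k) +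
    ENNReal.ofReal (E.selfInterfUL N i ω) + ENNReal.ofReal N.noise

/-- Denominator of the SINR of the downlink. -/
noncomputable def denomDL (E : Elements K Ω) (N : Network K) (T : FDCellular.Topology)
    (c : UserClass) (i : Fin K) (ω : Ω) : ℝ≥0∞ :=
  ∑ k, E.interfBSatUE N i k ω * ENNReal.ofReal (N.intraFactor .dl i k) +
    ∑ k, E.interfUE N N.etaUD c i k ω * ENNReal.ofReal (N.crossFactor .dl i k) +
    E.interfIntraCell N T i ω * ENNReal.ofReal (N.crossFactor .dl i i) +
    ENNReal.ofReal (E.selfInterfDL N T i ω) + ENNReal.ofReal N.noise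

/-- Measurability of all sources but the fading of the test link. -/
structure SourcesMeasurable (E : Elements K Ω) [MeasurableSpace Ω] : Prop where
  bsAtUE : ∀ k n, Measurable (E.bsAtUE k n)
  bsAtBS : ∀ k n, Measurable (E.bsAtBS k n)
  ue : ∀ k n, Measurable (E.ue k n)
  uePower : ∀ k n, Measurable (E.uePower k n)
  bsFading : ∀ k n, Measurable (E.bsFading k n)
  ueFading : ∀ k n, Measurable (E.ueFading k n)
  selfInterference : Measurable E.selfInterference
  mateDist : ∀ i, Measurable (E.mateDist i)
  mateAngle : Measurable E.mateAngle
  mateFading : Measurable E.mateFading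

/-- Measurability of the SINR denominators is proved once for an arbitrary σ-algebra on `Ω` and used
twice: for the ambient one, and for the one generated by everything but the link fading, which makes
the denominator independent of that gain. -/
lemma sourcesMeasurable_sig : @SourcesMeasurable K Ω E (E.sig {.linkFading}ᶜ) := by
  have hT : ∀ s : Source K, s ≠ .linkFading → s ∈ ({.linkFading}ᶜ : Set (Source K)) :=
    fun s hs => hs
  generalize ({.linkFading}ᶜ : Set (Source K)) = T at hT
  exact @SourcesMeasurable.mk K Ω E (E.sig T)
    (fun k => measurable_bsAtUE (hT _ nofun)) (fun k => measurable_bsAtBS (hT _ nofun))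
    (fun k => measurable_ue (hT _ nofun)) (fun k n => measurable_uePower (hT _ nofun))
    (fun k n => measurable_bsFading (hT _ nofun)) (fun k n => measurable_ueFading (hT _ nofun))
    (measurable_selfInterference (hT _ nofun)) (fun i => measurable_mateDist (hT _ nofun))
    (measurable_mateAngle (hT _ nofun)) (measurable_mateFading (hT _ nofun))

lemma IsModel.sourcesMeasurable (hE : E.IsModel N μ) : E.SourcesMeasurable where
  bsAtUE k := (hE.bsAtUE_ppp k).measurable
  bsAtBS k := (hE.bsAtBS_ppp k).measurable
  ue k := (hE.ue_ppp k).measurable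
  uePower := hE.uePower_meas
  bsFading := hE.bsFading_meas
  ueFading := hE.ueFading_meas
  selfInterference := hE.selfInterference_meas
  mateDist := hE.mateDist_meas
  mateAngle := hE.mateAngle_meas
  mateFading := hE.mateFading_meas

section Denominators

variable [m : MeasurableSpace Ω]

lemma SourcesMeasurable.nearest (h : E.SourcesMeasurable) (k : Fin K) : Measurable (E.nearest k) :=
  measurable_nearestDist (h.bsAtUE k)

lemma SourcesMeasurable.interfUE (h : E.SourcesMeasurable) (η : ℝ) (c : UserClass) (i k : Fin K) :
    Measurable (E.interfUE N η c i k) :=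
  (measurable_ueField (N := N) η c (h.ue k) (h.uePower k) (h.ueFading k)).comp
    ((h.nearest i).prodMk measurable_id)

lemma SourcesMeasurable.denomUL (h : E.SourcesMeasurable) (c : UserClass) (i : Fin K) :
    Measurable (E.denomUL N c i) := by
  unfold Elements.denomUL
  have h1 := fun k => h.interfUE (N := N) N.etaDD c i k
  have h2 := fun k => measurable_interfBSatBS (N := N) (h.bsAtBS k) (h.bsFading k)
  have h3 := measurable_selfInterfUL (N := N) i h.selfInterference
  exact (((Finset.measurable_fun_sum _ fun k _ => (h1 k).mul_const _).add
    (Finset.measurable_fun_sum _ fun k _ => (h2 k).mul_const _)).add h3).add measurable_const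

lemma SourcesMeasurable.interfIntraCell (h : E.SourcesMeasurable) (T : FDCellular.Topology)
    (i : Fin K) : Measurable (E.interfIntraCell N T i) := by
  have h1 := Measurable.comp (g := fun q : ℝ × Ω => E.mateField N T i q.1 q.2)
    (f := fun ω => (E.nearest i ω, ω))
    (measurable_mateField (N := N) T (h.mateDist i) h.mateAngle h.mateFading)
    ((h.nearest i).prodMk measurable_id)
  rw [funext (interfIntraCell_eq E N T i)]
  exact h1

lemma SourcesMeasurable.selfInterfDL (h : E.SourcesMeasurable) (T : FDCellular.Topology)
    (i : Fin K) : Measurable (E.selfInterfDL N T i) := by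
  have h1 := Measurable.comp (g := fun q : ℝ × Ω => E.selfField N T i q.1 q.2)
    (f := fun ω => (E.nearest i ω, ω)) (measurable_selfField (N := N) T i h.selfInterference)
    ((h.nearest i).prodMk measurable_id)
  rw [funext (selfInterfDL_eq E N T i)]
  exact h1

lemma SourcesMeasurable.denomDL (h : E.SourcesMeasurable) (T : FDCellular.Topology)
    (c : UserClass) (i : Fin K) : Measurable (E.denomDL N T c i) := by
  have h1 := fun k => h.interfUE (N := N) N.etaUD c i k
  have h2 := fun k => measurable_interfBSatUE (N := N) (h.bsAtUE k) (h.nearest i) (h.bsFading k)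
  have h3 := h.interfIntraCell (N := N) T i
  have h4 := h.selfInterfDL (N := N) T i
  exact ((((Finset.measurable_fun_sum _ fun k _ => (h2 k).mul_const _).add
    (Finset.measurable_fun_sum _ fun k _ => (h1 k).mul_const _)).add (h3.mul_const _)).add
    h4.ennreal_ofReal).add measurable_const

end Denominators

lemma IsModel.measurable_sinr (hE : E.IsModel N μ) (T : FDCellular.Topology) (v : Link)
    (c : UserClass) (i : Fin K) : Measurable (E.sinr N T v c i) := by
  have h := hE.sourcesMeasurable
  have h1 := h.nearest i
  have h2 := hE.linkFading_meas
  cases v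
  · have h3 := h.denomDL (N := N) T c i
    exact (by fun_prop : Measurable fun ω => ENNReal.ofReal (N.pD i * E.nearest i ω ^ (-N.etaDD) *
      E.linkFading ω)).div h3
  · have h3 := h.denomUL (N := N) c i
    exact (by fun_prop : Measurable fun ω => ENNReal.ofReal (N.txPower i (E.nearest i ω) *
      E.nearest i ω ^ (-N.etaDD) * E.linkFading ω)).div h3

end Model

end Elements

/-! ### Threshold scaled by the mean received power -/

namespace Network

variable {K : ℕ} (N : Network K)

/-- Ratio of the threshold to the mean received power, uplink. -/
noncomputable def scaleUL (i : Fin K) (θ r : ℝ) : ℝ := θ / (N.txPower i r * r ^ (-N.etaDD))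

/-- Ratio of the threshold to the mean received power, downlink. -/
noncomputable def scaleDL (i : Fin K) (θ r : ℝ) : ℝ := θ / N.pD i * |r| ^ N.etaDD

lemma measurable_scaleUL (i : Fin K) (θ : ℝ) : Measurable (N.scaleUL i θ) := by
  unfold scaleUL; fun_prop

lemma measurable_scaleDL (i : Fin K) (θ : ℝ) : Measurable (N.scaleDL i θ) := by
  unfold scaleDL; fun_prop

lemma scaleUL_nonneg (i : Fin K) {θ r : ℝ} (hθ : 0 < θ) (hr : 0 < r) : 0 ≤ N.scaleUL i θ r := by
  have := N.txPower_pos i hr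
  unfold scaleUL; positivity

lemma scaleDL_nonneg (i : Fin K) {θ : ℝ} (hθ : 0 < θ) (r : ℝ) : 0 ≤ N.scaleDL i θ r := by
  have := N.pD_pos i
  unfold scaleDL; positivity

lemma measurable_ltBSatUE (i k : Fin K) {σ : ℝ → ℝ} (hσ : Measurable σ) :
    Measurable fun r => N.ltBSatUE i k (σ r) r := by
  have h : Measurable fun r => hypF N.etaDD ((r * N.tau i / N.tau k) ^ (-N.etaDD) * N.pD k * σ r) :=
    (measurable_hypF N.etaDD_gt).comp (by fun_prop)
  unfold ltBSatUE
  exact Real.measurable_exp.comp ((by fun_prop : Measurable fun r =>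
    -2 * Real.pi * N.lam k / (N.etaDD - 2) * (r * N.tau i / N.tau k) ^ (2 - N.etaDD) * σ r *
      N.pD k).mul h)

end Network

namespace Elements

section Model

variable {K : ℕ} {Ω : Type*} {mΩ : MeasurableSpace Ω} {μ : Measure Ω} {N : Network K}
  {E : Elements K Ω}

lemma expNeg_denomUL (c : UserClass) (i : Fin K) {σ : ℝ} (hσ : 0 ≤ σ) (ω : Ω) :
    expNeg (ENNReal.ofReal σ * E.denomUL N c i ω) =
      (∏ k, expNeg (ENNReal.ofReal (σ * N.intraFactor .ul i k) *
        E.ueField N N.etaDD c k (E.nearest i ω) ω)) *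
      (∏ k, expNeg (ENNReal.ofReal (σ * N.crossFactor .ul i k) * E.interfBSatBS N k ω)) *
      expNeg (ENNReal.ofReal σ * ENNReal.ofReal (E.selfInterfUL N i ω)) *
      expNeg (ENNReal.ofReal σ * ENNReal.ofReal N.noise) := by
  rw [denomUL, mul_add, mul_add, mul_add, expNeg_add, expNeg_add, expNeg_add,
    expNeg_ofReal_mul_sum _ hσ, expNeg_ofReal_mul_sum _ hσ]
  simp_rw [interfUE_eq]

lemma measurable_nearest_mul_associated (E : Elements K Ω) (N : Network K) (i : Fin K)
    {φ : ℝ → ℝ≥0∞} (hφ : Measurable φ) : Measurable[E.sig {.linkFading}ᶜ] fun ω =>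
      φ (E.nearest i ω) * (E.associated N i).indicator 1 ω := by
  have hsrc := sourcesMeasurable_sig (E := E)
  generalize E.sig {.linkFading}ᶜ = m at hsrc
  exact (hφ.comp (hsrc.nearest i)).mul (measurable_associated (N := N) i hsrc.nearest)

lemma measurable_comp_nearest (E : Elements K Ω) (i : Fin K)
    {b : ℝ → ℝ} (hb : Measurable b) : Measurable[E.sig {.linkFading}ᶜ] fun ω =>
      b (E.nearest i ω) := by
  have hsrc := sourcesMeasurable_sig (E := E)
  generalize E.sig {.linkFading}ᶜ = m at hsrc
  exact hb.comp (hsrc.nearest i)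

lemma measurable_denomUL_sig (E : Elements K Ω) (N : Network K) (c : UserClass) (i : Fin K) :
    Measurable[E.sig {.linkFading}ᶜ] (E.denomUL N c i) := by
  have hsrc := sourcesMeasurable_sig (E := E)
  generalize E.sig {.linkFading}ᶜ = m at hsrc
  exact hsrc.denomUL c i

lemma measurable_denomDL_sig (E : Elements K Ω) (N : Network K) (T : FDCellular.Topology)
    (c : UserClass) (i : Fin K) : Measurable[E.sig {.linkFading}ᶜ] (E.denomDL N T c i) := by
  have hsrc := sourcesMeasurable_sig (E := E)
  generalize E.sig {.linkFading}ᶜ = m at hsrc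
  exact hsrc.denomDL T c i

lemma sinr_ul_eq (T : FDCellular.Topology) (c : UserClass) (i : Fin K) (ω : Ω) :
    E.sinr N T .ul c i ω = ENNReal.ofReal (N.txPower i (E.nearest i ω) *
      E.nearest i ω ^ (-N.etaDD) * E.linkFading ω) / E.denomUL N c i ω := rfl

lemma sinr_dl_eq (T : FDCellular.Topology) (c : UserClass) (i : Fin K) (ω : Ω) :
    E.sinr N T .dl c i ω = ENNReal.ofReal (N.pD i *
      E.nearest i ω ^ (-N.etaDD) * E.linkFading ω) / E.denomDL N T c i ω := rfl

lemma IsModel.lintegral_link_ul [IsProbabilityMeasure μ] (hE : E.IsModel N μ)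
    (T : FDCellular.Topology) (c : UserClass) (i : Fin K) {θ : ℝ} (hθ : 0 < θ) {φ : ℝ → ℝ≥0∞}
    (hφ : Measurable φ) :
    ∫⁻ ω, φ (E.nearest i ω) * (E.associated N i).indicator 1 ω *
        {ω | ENNReal.ofReal θ ≤ E.sinr N T .ul c i ω}.indicator 1 ω ∂μ =
      ∫⁻ ω, φ (E.nearest i ω) * (E.associated N i).indicator 1 ω *
        expNeg (ENNReal.ofReal (N.scaleUL i θ (E.nearest i ω)) * E.denomUL N c i ω) ∂μ := by
  have hb := measurable_comp_nearest E i
    (by fun_prop : Measurable fun r => N.txPower i r * r ^ (-N.etaDD))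
  have hpos : ∀ᵐ ω ∂μ, 0 < N.txPower i (E.nearest i ω) * E.nearest i ω ^ (-N.etaDD) := by
    filter_upwards [hE.nearest_pos i] with ω hω
    have := N.txPower_pos i hω
    positivity
  have hD := measurable_denomUL_sig E N c i
  have h := hE.lintegral_link hθ (measurable_nearest_mul_associated E N i hφ) hD hb hpos
  simp_rw [sinr_ul_eq]
  exact h

lemma IsModel.lintegral_link_dl [IsProbabilityMeasure μ] (hE : E.IsModel N μ)
    (T : FDCellular.Topology) (c : UserClass) (i : Fin K) {θ : ℝ} (hθ : 0 < θ) {φ : ℝ → ℝ≥0∞}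
    (hφ : Measurable φ) :
    ∫⁻ ω, φ (E.nearest i ω) * (E.associated N i).indicator 1 ω *
        {ω | ENNReal.ofReal θ ≤ E.sinr N T .dl c i ω}.indicator 1 ω ∂μ =
      ∫⁻ ω, φ (E.nearest i ω) * (E.associated N i).indicator 1 ω *
        expNeg (ENNReal.ofReal (N.scaleDL i θ (E.nearest i ω)) * E.denomDL N T c i ω) ∂μ := by
  have hb := measurable_comp_nearest E i
    (by fun_prop : Measurable fun r => N.pD i * r ^ (-N.etaDD))
  have hp := N.pD_pos i
  have hpos : ∀ᵐ ω ∂μ, 0 < N.pD i * E.nearest i ω ^ (-N.etaDD) := by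
    filter_upwards [hE.nearest_pos i] with ω hω
    positivity
  have hD := measurable_denomDL_sig E N T c i
  have h := hE.lintegral_link hθ (measurable_nearest_mul_associated E N i hφ) hD hb hpos
  simp_rw [sinr_dl_eq]
  rw [h]
  -- `scaleDL` contains `|r|`, so that it is nonnegative for every real `r`; for positive distances
  -- it is the ratio `θ / (P r ^ (-η))`.
  refine lintegral_congr_ae ?_
  filter_upwards [hE.nearest_pos i] with ω hω
  rw [Network.scaleDL, abs_of_pos hω, Real.rpow_neg hω.le, ← div_eq_mul_inv, div_div_eq_mul_div,
    div_mul_eq_mul_div]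

end Model

end Elements

/-! ### Conditional coverage of the uplink -/

namespace Elements

section Model

variable {K : ℕ} {Ω : Type*} {mΩ : MeasurableSpace Ω} {μ : Measure Ω} {N : Network K}
  {E : Elements K Ω}

/-- `f` is the conditional coverage probability at distance `r`. It is constructed as a product of
integrals over `Ω`, which are measurable in `r` on the whole line; the closed form is asserted only
for `r > 0`. -/
lemma IsModel.lintegral_sinr_ul [IsProbabilityMeasure μ] (hE : E.IsModel N μ)
    (T : FDCellular.Topology) (c : UserClass) (i : Fin K) {θ : ℝ} (hθ : 0 < θ) {φ : ℝ → ℝ≥0∞}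
    (hφ : Measurable φ) :
    ∃ f : ℝ → ℝ≥0∞, Measurable f ∧
      (∀ r, 0 < r → f r = expNeg (ENNReal.ofReal (N.scaleUL i θ r) * ENNReal.ofReal N.noise) *
        ((∏ k, N.ueTransform N.etaDD c k (N.scaleUL i θ r * N.intraFactor .ul i k) r *
          ENNReal.ofReal (N.ltBSatBS k (N.scaleUL i θ r * N.crossFactor .ul i k))) *
          ENNReal.ofReal (N.siFactorUL i (N.scaleUL i θ r)))) ∧
      ∫⁻ ω, φ (E.nearest i ω) * (E.associated N i).indicator 1 ω *
        {ω | ENNReal.ofReal θ ≤ E.sinr N T .ul c i ω}.indicator 1 ω ∂μ =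
        ENNReal.ofReal (N.lam i / N.lamBar i) * ∫⁻ r, φ r * f r ∂N.distLaw i := by
  have hσ := N.measurable_scaleUL i θ
  set n : ℝ → ℝ≥0∞ := fun r =>
    expNeg (ENNReal.ofReal (N.scaleUL i θ r) * ENNReal.ofReal N.noise) with hn
  have hnm : Measurable n := by fun_prop
  set A := E.assocFactor N i
  set B : Fin K → ℝ → Ω → ℝ≥0∞ := fun k r ω =>
    expNeg (ENNReal.ofReal (N.scaleUL i θ r * N.intraFactor .ul i k) * E.ueField N N.etaDD c k r ω)
    with hB
  set C : Fin K → ℝ → Ω → ℝ≥0∞ := fun k r ω =>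
    expNeg (ENNReal.ofReal (N.scaleUL i θ r * N.crossFactor .ul i k) * E.interfBSatBS N k ω)
    with hC
  set S : ℝ → Ω → ℝ≥0∞ := fun r ω =>
    expNeg (ENNReal.ofReal (N.scaleUL i θ r) * ENNReal.ofReal (E.selfInterfUL N i ω)) with hS
  have hAm : ∀ k, E.GroupMeasurable .ul (.inl (k, 0)) (A k) :=
    fun k => groupMeasurable_assocFactor .ul i k
  have hBm : ∀ k, E.GroupMeasurable .ul (.inl (k, 1)) (B k) := fun k =>
    (groupMeasurable_ueField .ul N.etaDD c k).expNeg_mul (hσ.mul_const _)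
  have hCm : ∀ k, E.GroupMeasurable .ul (.inl (k, 2)) (C k) := fun k =>
    (groupMeasurable_interfBSatBS k).expNeg_mul (hσ.mul_const _)
  have hSm : E.GroupMeasurable .ul (.inr 1) S := (groupMeasurable_selfInterfUL i).expNeg_mul hσ
  have hMm : E.GroupMeasurable .ul (.inr 2) fun _ _ => 1 := groupMeasurable_one _ _
  set f : ℝ → ℝ≥0∞ := fun r =>
    n r * ((∏ k, (∫⁻ ω, B k r ω ∂μ) * ∫⁻ ω, C k r ω ∂μ) * ∫⁻ ω, S r ω ∂μ) with hf
  have hfm : Measurable f := hnm.mul ((Finset.measurable_fun_prod _ fun k _ =>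
    (hE.measurable_lintegral (hBm k)).mul (hE.measurable_lintegral (hCm k))).mul
    (hE.measurable_lintegral hSm))
  refine ⟨f, hfm, fun r hr => ?_, ?_⟩
  · have h0 := N.scaleUL_nonneg i hθ hr
    simp only [hf, hB, hC, hS, hn]
    rw [hE.lintegral_selfInterfUL i h0]
    congr 2
    refine Finset.prod_congr rfl fun k _ => ?_
    rw [hE.lintegral_ueField N.etaDD c k (mul_nonneg h0 (N.intraFactor_nonneg _ _ _)) hr.le,
      hE.lintegral_interfBSatBS k (mul_nonneg h0 (N.crossFactor_nonneg _ _ _))]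
  refine (hE.lintegral_link_ul T c i hθ hφ).trans ?_
  have hR : Measurable[E.groupSig .ul (.inl (i, 0))] (E.nearest i) :=
    measurable_nearest_sig (mem_label rfl)
  have hZ : Measurable[E.groupSig .ul (.inl (i, 0))] fun ω =>
      φ (E.nearest i ω) * n (E.nearest i ω) :=
    Measurable.comp (g := fun r => φ r * n r) (hφ.mul hnm) hR
  have hnet := hE.lintegral_network .ul i hAm hBm hCm hSm hMm
    (fun r ω => by simp [A, assocFactor]) hZ hR
  have hpt : ∀ᵐ ω ∂μ, φ (E.nearest i ω) * (E.associated N i).indicator 1 ω *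
      expNeg (ENNReal.ofReal (N.scaleUL i θ (E.nearest i ω)) * E.denomUL N c i ω) =
      φ (E.nearest i ω) * n (E.nearest i ω) * ((∏ k, A k (E.nearest i ω) ω *
        B k (E.nearest i ω) ω * C k (E.nearest i ω) ω) * (S (E.nearest i ω) ω * 1)) := by
    filter_upwards [hE.nearest_pos i] with ω hω
    have h0 := N.scaleUL_nonneg i hθ hω
    have h1 := expNeg_denomUL (N := N) (E := E) c i h0 ω
    rw [h1, ← prod_assocFactor, Finset.prod_mul_distrib, Finset.prod_mul_distrib]
    simp only [A, hB, hC, hS, hn]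
    ring
  rw [lintegral_congr_ae hpt, hnet]
  have hF : Measurable fun r => φ r * n r * ((∏ k, (∫⁻ ω', A k r ω' ∂μ) * (∫⁻ ω', B k r ω' ∂μ) *
      (∫⁻ ω', C k r ω' ∂μ)) * ((∫⁻ ω', S r ω' ∂μ) * (∫⁻ _, 1 ∂μ))) :=
    (hφ.mul hnm).mul ((Finset.measurable_fun_prod _ fun k _ =>
      ((hE.measurable_lintegral (hAm k)).mul (hE.measurable_lintegral (hBm k))).mul
      (hE.measurable_lintegral (hCm k))).mul ((hE.measurable_lintegral hSm).mul_const _))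
  refine (hE.lintegral_nearest i hF).trans ?_
  -- In the uplink the BSs around the test UE enter only through the association, so their factors
  -- are pure void probabilities. These turn the nearest distance into the serving distance.
  have hchange := N.lintegral_mul_prod_voidProb i (f := fun r => φ r * f r) (hφ.mul hfm)
  rw [← hchange]
  refine lintegral_congr_ae ?_
  filter_upwards [rayleigh_pos _] with r hr
  have hA1 : ∀ k, ∫⁻ ω, A k r ω ∂μ = N.voidProb i k r := fun k =>
    hE.lintegral_assocFactor i k hr.le
  simp_rw [hA1, lintegral_one, measure_univ, mul_one, hf]
  simp_rw [mul_assoc, Finset.prod_mul_distrib]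
  ring

end Model

end Elements

/-! ### Conditional coverage of the downlink -/

namespace Elements

section Model

variable {K : ℕ} {Ω : Type*} {mΩ : MeasurableSpace Ω} {μ : Measure Ω} {N : Network K}
  {E : Elements K Ω}

lemma expNeg_denomDL (T : FDCellular.Topology) (c : UserClass) (i : Fin K) {σ : ℝ} (hσ : 0 ≤ σ)
    (ω : Ω) : expNeg (ENNReal.ofReal σ * E.denomDL N T c i ω) =
      (∏ k, expNeg (ENNReal.ofReal (σ * N.intraFactor .dl i k) * E.interfBSatUE N i k ω)) *
      (∏ k, expNeg (ENNReal.ofReal (σ * N.crossFactor .dl i k) *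
        E.ueField N N.etaUD c k (E.nearest i ω) ω)) *
      expNeg (ENNReal.ofReal (σ * N.crossFactor .dl i i) * E.mateField N T i (E.nearest i ω) ω) *
      expNeg (ENNReal.ofReal σ * ENNReal.ofReal (E.selfField N T i (E.nearest i ω) ω)) *
      expNeg (ENNReal.ofReal σ * ENNReal.ofReal N.noise) := by
  rw [denomDL, mul_add, mul_add, mul_add, mul_add, expNeg_add, expNeg_add, expNeg_add, expNeg_add,
    expNeg_ofReal_mul_sum _ hσ, expNeg_ofReal_mul_sum _ hσ, selfInterfDL_eq, interfIntraCell_eq,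
    ENNReal.ofReal_mul hσ, mul_comm (E.mateField N T i (E.nearest i ω) ω), mul_assoc]
  simp_rw [interfUE_eq, mul_assoc]

/-- Association and interference of the BSs of a tier other than the serving one. -/
noncomputable def bsFactor (E : Elements K Ω) (N : Network K) (i : Fin K) (θ : ℝ) (k : Fin K)
    (r : ℝ) (ω : Ω) : ℝ≥0∞ :=
  if k = i then 1 else E.assocFactor N i k r ω *
    expNeg (ENNReal.ofReal (N.scaleDL i θ r * N.intraFactor .dl i k) * E.bsField N k ω)

lemma groupMeasurable_bsFactor (i : Fin K) (θ : ℝ) (k : Fin K) :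
    E.GroupMeasurable .dl (.inl (k, 0)) (E.bsFactor N i θ k) := by
  unfold bsFactor
  by_cases h : k = i
  · simp only [h, if_true]
    exact groupMeasurable_one _ _
  · simp only [h, if_false]
    exact (groupMeasurable_assocFactor .dl i k).mul
      ((groupMeasurable_bsField k).expNeg_mul ((N.measurable_scaleDL i θ).mul_const _))

lemma bsFactor_le_one (i : Fin K) (θ : ℝ) (k : Fin K) (r : ℝ) (ω : Ω) :
    E.bsFactor N i θ k r ω ≤ 1 := by
  unfold bsFactor
  split_ifs
  · exact le_rfl
  · refine mul_le_one' ?_ (expNeg_le_one _)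
    unfold assocFactor
    split_ifs <;> simp

/-- The association condition of each other tier is paired with the interference of that tier, and
the serving tier is split off. -/
lemma associated_mul_prod_expNeg (i : Fin K) (θ : ℝ) (ω : Ω) :
    (E.associated N i).indicator 1 ω * ∏ k, expNeg (ENNReal.ofReal
        (N.scaleDL i θ (E.nearest i ω) * N.intraFactor .dl i k) * E.interfBSatUE N i k ω) =
      (∏ k, E.bsFactor N i θ k (E.nearest i ω) ω) *
        expNeg (ENNReal.ofReal (N.scaleDL i θ (E.nearest i ω) * N.intraFactor .dl i i) *
          E.interfBSatUE N i i ω) := by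
  have h : expNeg (ENNReal.ofReal (N.scaleDL i θ (E.nearest i ω) * N.intraFactor .dl i i) *
      E.interfBSatUE N i i ω) = ∏ k, if k = i then expNeg (ENNReal.ofReal
        (N.scaleDL i θ (E.nearest i ω) * N.intraFactor .dl i k) * E.interfBSatUE N i k ω)
        else 1 := by simp
  rw [h, ← prod_assocFactor, ← Finset.prod_mul_distrib, ← Finset.prod_mul_distrib]
  refine Finset.prod_congr rfl fun k _ => ?_
  by_cases hk : k = i
  · simp [hk, bsFactor, assocFactor]
  · simp only [hk, bsFactor, if_false, mul_one]
    rw [interfBSatUE_of_ne _ _ hk]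

lemma IsModel.lintegral_bsFactor [IsProbabilityMeasure μ] (hE : E.IsModel N μ) (i : Fin K)
    {θ : ℝ} (hθ : 0 < θ) (k : Fin K) {r : ℝ} (hr : 0 < r) :
    ∫⁻ ω, E.bsFactor N i θ k r ω ∂μ = N.voidProb i k r * if k = i then 1 else
      ENNReal.ofReal (N.ltBSatUE i k (N.scaleDL i θ r * N.intraFactor .dl i k) r) := by
  by_cases h : k = i
  · simp [h, bsFactor, Network.voidProb]
  · simp only [bsFactor, h, if_false]
    exact hE.lintegral_bsField h (mul_nonneg (N.scaleDL_nonneg i hθ r)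
      (N.intraFactor_nonneg _ _ _)) hr

lemma lintegral_le_one [IsProbabilityMeasure μ] {f : Ω → ℝ≥0∞} (hf : ∀ ω, f ω ≤ 1) :
    ∫⁻ ω, f ω ∂μ ≤ 1 :=
  (lintegral_mono hf).trans (by simp)

/-- The BSs of the serving tier both interfere and determine the distance, so they cannot be frozen
out. Their exponential stays in the prefactor `Z` while all other groups are averaged;
`lintegral_servingTier` evaluates it afterwards. -/
lemma IsModel.lintegral_sinr_dl [IsProbabilityMeasure μ] (hE : E.IsModel N μ)
    (T : FDCellular.Topology) (c : UserClass) (i : Fin K) {θ : ℝ} (hθ : 0 < θ) {φ : ℝ → ℝ≥0∞}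
    (hφ : Measurable φ) (hφ1 : ∀ r, φ r ≤ 1) :
    ∃ f : ℝ → ℝ≥0∞, Measurable f ∧
      (∀ r, 0 < r → f r = expNeg (ENNReal.ofReal (N.scaleDL i θ r) * ENNReal.ofReal N.noise) *
        ((∏ k, ENNReal.ofReal (N.ltBSatUE i k (N.scaleDL i θ r * N.intraFactor .dl i k) r) *
          N.ueTransform N.etaUD c k (N.scaleDL i θ r * N.crossFactor .dl i k) r) *
          (ENNReal.ofReal (N.siFactorDL T i (N.scaleDL i θ r * N.txPower i r)) *
          ENNReal.ofReal (N.ltIntraCell T i i r (N.scaleDL i θ r * N.crossFactor .dl i i))))) ∧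
      ∫⁻ ω, φ (E.nearest i ω) * (E.associated N i).indicator 1 ω *
        {ω | ENNReal.ofReal θ ≤ E.sinr N T .dl c i ω}.indicator 1 ω ∂μ =
        ENNReal.ofReal (N.lam i / N.lamBar i) * ∫⁻ r, φ r * f r ∂N.distLaw i := by
  have hσ := N.measurable_scaleDL i θ
  set n : ℝ → ℝ≥0∞ := fun r =>
    expNeg (ENNReal.ofReal (N.scaleDL i θ r) * ENNReal.ofReal N.noise) with hn
  have hnm : Measurable n := by fun_prop
  set A := E.bsFactor N i θ with hA
  set B : Fin K → ℝ → Ω → ℝ≥0∞ := fun k r ω =>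
    expNeg (ENNReal.ofReal (N.scaleDL i θ r * N.crossFactor .dl i k) * E.ueField N N.etaUD c k r ω)
    with hB
  set S : ℝ → Ω → ℝ≥0∞ := fun r ω =>
    expNeg (ENNReal.ofReal (N.scaleDL i θ r) * ENNReal.ofReal (E.selfField N T i r ω)) with hS
  set M : ℝ → Ω → ℝ≥0∞ := fun r ω =>
    expNeg (ENNReal.ofReal (N.scaleDL i θ r * N.crossFactor .dl i i) * E.mateField N T i r ω)
    with hM
  have hAm : ∀ k, E.GroupMeasurable .dl (.inl (k, 0)) (A k) :=
    fun k => groupMeasurable_bsFactor i θ k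
  have hBm : ∀ k, E.GroupMeasurable .dl (.inl (k, 1)) (B k) := fun k =>
    (groupMeasurable_ueField .dl N.etaUD c k).expNeg_mul (hσ.mul_const _)
  have hCm : ∀ k : Fin K, E.GroupMeasurable .dl (.inl (k, 2)) fun _ _ => 1 :=
    fun k => groupMeasurable_one _ _
  have hSm : E.GroupMeasurable .dl (.inr 1) S := (groupMeasurable_selfField T i).expNeg_mul hσ
  have hMm : E.GroupMeasurable .dl (.inr 2) M :=
    (groupMeasurable_mateField T i).expNeg_mul (hσ.mul_const _)
  have hGm : Measurable fun r => ∏ k,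
      ENNReal.ofReal (N.ltBSatUE i k (N.scaleDL i θ r * N.intraFactor .dl i k) r) :=
    Finset.measurable_fun_prod _ fun k _ =>
      (N.measurable_ltBSatUE i k (hσ.mul_const _)).ennreal_ofReal
  have hBi : Measurable fun r => ∏ k, ∫⁻ ω, B k r ω ∂μ :=
    Finset.measurable_fun_prod _ fun k _ => hE.measurable_lintegral (hBm k)
  have hSM : Measurable fun r => (∫⁻ ω, S r ω ∂μ) * ∫⁻ ω, M r ω ∂μ :=
    (hE.measurable_lintegral hSm).mul (hE.measurable_lintegral hMm)
  set f : ℝ → ℝ≥0∞ := fun r =>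
    n r * (((∏ k, ENNReal.ofReal
      (N.ltBSatUE i k (N.scaleDL i θ r * N.intraFactor .dl i k) r)) * ∏ k, ∫⁻ ω, B k r ω ∂μ) *
      ((∫⁻ ω, S r ω ∂μ) * ∫⁻ ω, M r ω ∂μ)) with hf
  have hfm : Measurable f := hnm.mul ((hGm.mul hBi).mul hSM)
  refine ⟨f, hfm, fun r hr => ?_, ?_⟩
  · have h0 := N.scaleDL_nonneg i hθ r
    simp only [hf, hB, hS, hM, hn]
    rw [hE.lintegral_selfField T i h0 hr,
      hE.lintegral_mateField T i (mul_nonneg h0 (N.crossFactor_nonneg _ _ _)) hr.le,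
      Finset.prod_mul_distrib]
    congr 3
    refine Finset.prod_congr rfl fun k _ => ?_
    rw [hE.lintegral_ueField N.etaUD c k (mul_nonneg h0 (N.crossFactor_nonneg _ _ _)) hr.le]
  refine (hE.lintegral_link_dl T c i hθ hφ).trans ?_
  have hR : Measurable[E.groupSig .dl (.inl (i, 0))] (E.nearest i) :=
    measurable_nearest_sig (mem_label rfl)
  have hI : Measurable[E.groupSig .dl (.inl (i, 0))] (E.interfBSatUE N i i) :=
    @measurable_interfBSatUE K Ω E N (E.groupSig .dl (.inl (i, 0))) i i
      (measurable_bsAtUE (mem_label rfl)) hR (fun _ => measurable_bsFading (mem_label rfl))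
  have hZ : Measurable[E.groupSig .dl (.inl (i, 0))] fun ω =>
      φ (E.nearest i ω) * n (E.nearest i ω) * expNeg (ENNReal.ofReal
        (N.scaleDL i θ (E.nearest i ω) * N.intraFactor .dl i i) * E.interfBSatUE N i i ω) :=
    Measurable.comp (g := fun q : ℝ × ℝ≥0∞ => φ q.1 * n q.1 * expNeg (ENNReal.ofReal
        (N.scaleDL i θ q.1 * N.intraFactor .dl i i) * q.2))
      (f := fun ω => (E.nearest i ω, E.interfBSatUE N i i ω)) (by fun_prop) (hR.prodMk hI)
  have hnet := hE.lintegral_network .dl i hAm hBm hCm hSm hMm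
    (fun r ω => by simp [A, bsFactor]) hZ hR
  have hpt : ∀ ω, φ (E.nearest i ω) * (E.associated N i).indicator 1 ω *
      expNeg (ENNReal.ofReal (N.scaleDL i θ (E.nearest i ω)) * E.denomDL N T c i ω) =
      φ (E.nearest i ω) * n (E.nearest i ω) * expNeg (ENNReal.ofReal
        (N.scaleDL i θ (E.nearest i ω) * N.intraFactor .dl i i) * E.interfBSatUE N i i ω) *
      ((∏ k, A k (E.nearest i ω) ω * B k (E.nearest i ω) ω * 1) *
        (S (E.nearest i ω) ω * M (E.nearest i ω) ω)) := by
    intro ω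
    have h2 := associated_mul_prod_expNeg (E := E) (N := N) i θ ω
    rw [expNeg_denomDL T c i (N.scaleDL_nonneg i hθ _) ω]
    simp only [mul_one, Finset.prod_mul_distrib, hA, hB, hS, hM, hn]
    calc _ = φ (E.nearest i ω) * (∏ k, expNeg (ENNReal.ofReal
          (N.scaleDL i θ (E.nearest i ω) * N.crossFactor .dl i k) *
            E.ueField N N.etaUD c k (E.nearest i ω) ω)) *
          expNeg (ENNReal.ofReal (N.scaleDL i θ (E.nearest i ω) * N.crossFactor .dl i i) *
            E.mateField N T i (E.nearest i ω) ω) *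
          expNeg (ENNReal.ofReal (N.scaleDL i θ (E.nearest i ω)) *
            ENNReal.ofReal (E.selfField N T i (E.nearest i ω) ω)) *
          expNeg (ENNReal.ofReal (N.scaleDL i θ (E.nearest i ω)) * ENNReal.ofReal N.noise) *
          ((E.associated N i).indicator 1 ω * ∏ k, expNeg (ENNReal.ofReal
            (N.scaleDL i θ (E.nearest i ω) * N.intraFactor .dl i k) *
              E.interfBSatUE N i k ω)) := by ring
      _ = _ := by rw [h2]; ring
  simp_rw [hpt]
  rw [hnet]
  set rest : ℝ → ℝ≥0∞ := fun r => (∏ k, (∫⁻ ω', A k r ω' ∂μ) * (∫⁻ ω', B k r ω' ∂μ) *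
      (∫⁻ _, 1 ∂μ)) * ((∫⁻ ω', S r ω' ∂μ) * (∫⁻ ω', M r ω' ∂μ)) with hrest
  have hrm : Measurable rest := (Finset.measurable_fun_prod _ fun k _ =>
      ((hE.measurable_lintegral (hAm k)).mul (hE.measurable_lintegral (hBm k))).mul_const _).mul hSM
  -- The averaged factors become part of the test function of the serving-tier identity, which has
  -- to be bounded by one.
  have hr1 : ∀ r, rest r ≤ 1 := fun r => mul_le_one' (Finset.prod_le_one' fun k _ =>
    mul_le_one' (mul_le_one' (lintegral_le_one fun ω => bsFactor_le_one i θ k r ω)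
      (lintegral_le_one fun ω => expNeg_le_one _)) (by simp))
    (mul_le_one' (lintegral_le_one fun ω => expNeg_le_one _)
      (lintegral_le_one fun ω => expNeg_le_one _))
  have hp := N.pD_pos i
  have hserv := hE.lintegral_servingTier i (κ := θ / N.pD i * N.intraFactor .dl i i)
    (mul_nonneg (div_pos hθ hp).le (N.intraFactor_nonneg _ _ _))
    (φ := fun r => φ r * n r * rest r) ((hφ.mul hnm).mul hrm)
    (fun r => mul_le_one' (mul_le_one' (hφ1 r) (expNeg_le_one _)) (hr1 r))
  have hscale : ∀ r : ℝ, θ / N.pD i * N.intraFactor .dl i i * |r| ^ N.etaDD =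
      N.scaleDL i θ r * N.intraFactor .dl i i := fun r => by
    rw [Network.scaleDL]; ring
  simp_rw [hscale] at hserv
  have hperm : ∀ ω, φ (E.nearest i ω) * n (E.nearest i ω) * expNeg (ENNReal.ofReal
        (N.scaleDL i θ (E.nearest i ω) * N.intraFactor .dl i i) * E.interfBSatUE N i i ω) *
        rest (E.nearest i ω) =
      φ (E.nearest i ω) * n (E.nearest i ω) * rest (E.nearest i ω) * expNeg (ENNReal.ofReal
        (N.scaleDL i θ (E.nearest i ω) * N.intraFactor .dl i i) * E.interfBSatUE N i i ω) :=
    fun ω => by ring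
  refine (lintegral_congr hperm).trans (hserv.trans ?_)
  have hchange := N.lintegral_mul_prod_voidProb i (f := fun r => φ r * f r) (hφ.mul hfm)
  rw [← hchange]
  refine lintegral_congr_ae ?_
  filter_upwards [rayleigh_pos _] with r hr
  -- The transform of the serving tier completes the product over the other tiers.
  have hprod : (∏ k, if k = i then (1 : ℝ≥0∞) else
      ENNReal.ofReal (N.ltBSatUE i k (N.scaleDL i θ r * N.intraFactor .dl i k) r)) *
      ENNReal.ofReal (N.ltBSatUE i i (N.scaleDL i θ r * N.intraFactor .dl i i) r) =
      ∏ k, ENNReal.ofReal (N.ltBSatUE i k (N.scaleDL i θ r * N.intraFactor .dl i k) r) := by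
    rw [← Finset.mul_prod_erase _ _ (Finset.mem_univ i), if_pos rfl, one_mul,
      ← Finset.mul_prod_erase _ (fun k => ENNReal.ofReal
        (N.ltBSatUE i k (N.scaleDL i θ r * N.intraFactor .dl i k) r)) (Finset.mem_univ i), mul_comm]
    congr 1
    exact Finset.prod_congr rfl fun k hk => if_neg (Finset.ne_of_mem_erase hk)
  have hA1 : ∀ k, ∫⁻ ω, A k r ω ∂μ = _ := fun k => hE.lintegral_bsFactor i hθ k hr
  simp only [hrest, hf, ← hprod, hA1, lintegral_one, measure_univ, mul_one,
    Finset.prod_mul_distrib]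
  ring

end Model

end Elements

/-! ### From conditional coverage to the outage probability -/

namespace Network

variable {K : ℕ} (N : Network K)

lemma setLIntegral_distLaw (i : Fin K) {S : Set ℝ} (hS : MeasurableSet S) (hS0 : S ⊆ Set.Ioi 0)
    {f : ℝ → ℝ≥0∞} (hf : Measurable f) :
    ∫⁻ r, S.indicator 1 r * f r ∂N.distLaw i =
      ∫⁻ r in S, ENNReal.ofReal (N.distDensity i r) * f r := by
  have hi : Measurable (S.indicator (1 : ℝ → ℝ≥0∞)) := measurable_one.indicator hS
  rw [distLaw, lintegral_rayleigh (φ := fun r => S.indicator 1 r * f r) (hi.mul hf),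
    ← lintegral_indicator hS, ← lintegral_indicator measurableSet_Ioi]
  refine lintegral_congr fun r => ?_
  by_cases h : r ∈ S
  · simp [h, Set.indicator_of_mem (hS0 h), distDensity]
  · simp [h]

end Network

namespace Elements

section Model

variable {K : ℕ} {Ω : Type*} {mΩ : MeasurableSpace Ω} {μ : Measure Ω} {N : Network K}
  {E : Elements K Ω}

/-- Outage probability from the law of the serving distance and the conditional coverage
probability `q`. -/
lemma IsModel.outage_eq [IsProbabilityMeasure μ] (hE : E.IsModel N μ) (T : FDCellular.Topology)
    (v : Link) (c : UserClass) (i : Fin K) {θ : ℝ} {S : Set ℝ} (hS : MeasurableSet S)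
    (hS0 : S ⊆ Set.Ioi 0) (hSc : ∀ r, 0 < r → (N.InClass c i r ↔ r ∈ S)) {P : ℝ} (hP : 0 < P)
    {dens : ℝ → ℝ} (hdens : ∀ r ∈ S, P * dens r = N.distDensity i r)
    (hPS : ∫⁻ r in S, ENNReal.ofReal (N.distDensity i r) = ENNReal.ofReal P)
    {f : ℝ → ℝ≥0∞} (hf : Measurable f) {q : ℝ → ℝ} (hq0 : ∀ r ∈ S, 0 ≤ q r)
    (hfq : ∀ r ∈ S, f r = ENNReal.ofReal (q r))
    (hX : ∫⁻ ω, S.indicator 1 (E.nearest i ω) * (E.associated N i).indicator 1 ω *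
        {ω | ENNReal.ofReal θ ≤ E.sinr N T v c i ω}.indicator 1 ω ∂μ =
        ENNReal.ofReal (N.lam i / N.lamBar i) * ∫⁻ r, S.indicator 1 r * f r ∂N.distLaw i) :
    IntegrableOn (fun r => dens r * q r) S ∧
      E.outage N μ T v c i θ = 1 - ∫ r in S, dens r * q r := by
  have hi : Measurable (S.indicator (1 : ℝ → ℝ≥0∞)) := measurable_one.indicator hS
  have hc : 0 < N.lam i / N.lamBar i := div_pos (N.lam_pos i) (N.lamBar_pos i)
  have hc0 : ENNReal.ofReal (N.lam i / N.lamBar i) ≠ 0 := by simpa using hc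
  have hms := hE.measurableSet_associated i
  have hmn := hE.measurable_nearest i
  have hB : MeasurableSet {ω | ENNReal.ofReal θ ≤ E.sinr N T v c i ω} :=
    measurableSet_le measurable_const (hE.measurable_sinr T v c i)
  set B := {ω | ENNReal.ofReal θ ≤ E.sinr N T v c i ω} with hBdef
  set U : Set Ω := E.associated N i ∩ E.nearest i ⁻¹' S with hU
  have hUm : MeasurableSet U := hms.inter (hmn hS)
  -- The class is described by `S` at positive distances only, and the nearest distance is almost
  -- surely positive.
  have hae : E.userEvent N c i =ᵐ[μ] U := by
    filter_upwards [hE.nearest_pos i] with ω hω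
    have : ω ∈ E.userEvent N c i ↔ ω ∈ U := by
      change (ω ∈ E.associated N i ∧ N.InClass c i (E.nearest i ω)) ↔
        (ω ∈ E.associated N i ∧ E.nearest i ω ∈ S)
      rw [hSc _ hω]
    exact propext this
  have hμU : μ U = ENNReal.ofReal (N.lam i / N.lamBar i) * ENNReal.ofReal P := by
    have h := hE.lintegral_associated i hi
    have h2 := N.setLIntegral_distLaw i hS hS0 (f := fun _ => 1) measurable_const
    simp only [mul_one] at h2
    rw [h2, hPS] at h
    rw [← h, ← lintegral_indicator_one hUm]
    refine lintegral_congr fun ω => ?_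
    by_cases h1 : ω ∈ E.associated N i <;> by_cases h2 : E.nearest i ω ∈ S <;> simp [hU, h1, h2]
  set X : ℝ≥0∞ := ∫⁻ r in S, ENNReal.ofReal (P * (dens r * q r)) with hXdef
  have hXf : ∫⁻ r, S.indicator 1 r * f r ∂N.distLaw i = X := by
    rw [N.setLIntegral_distLaw i hS hS0 hf]
    refine setLIntegral_congr_fun hS fun r hr => ?_
    rw [hfq r hr, ← ENNReal.ofReal_mul (N.distDensity_nonneg i (le_of_lt (hS0 hr))),
      ← hdens r hr, mul_assoc]
  have hμUB : μ (U ∩ B) = ENNReal.ofReal (N.lam i / N.lamBar i) * X := by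
    rw [← hXf, ← hX, ← lintegral_indicator_one (hUm.inter hB)]
    refine lintegral_congr fun ω => ?_
    by_cases h1 : ω ∈ E.associated N i <;> by_cases h2 : E.nearest i ω ∈ S <;>
      by_cases h3 : ω ∈ B <;> simp [hU, h1, h2, h3]
  -- `X` is, up to a positive constant, a probability; integrability of the formula follows without
  -- any estimate.
  have hXfin : X ≠ ∞ := by
    intro h
    rw [h, ENNReal.mul_top hc0] at hμUB
    exact measure_ne_top _ _ hμUB
  have hnn : ∀ r ∈ S, 0 ≤ P * (dens r * q r) := fun r hr => by
    rw [← mul_assoc, hdens r hr]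
    exact mul_nonneg (N.distDensity_nonneg i (le_of_lt (hS0 hr))) (hq0 r hr)
  -- Neither `dens` nor `q` is assumed measurable; on `S` the integrand coincides with one built
  -- from the measurable `f`.
  have hmeas : AEStronglyMeasurable (fun r => P * (dens r * q r)) (volume.restrict S) := by
    refine AEStronglyMeasurable.congr (f := fun r => N.distDensity i r * (f r).toReal)
      ((N.continuous_distDensity i).measurable.mul hf.ennreal_toReal).aestronglyMeasurable ?_
    filter_upwards [ae_restrict_mem hS] with r hr
    rw [hfq r hr, ENNReal.toReal_ofReal (hq0 r hr), ← hdens r hr, mul_assoc]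
  have hint : IntegrableOn (fun r => P * (dens r * q r)) S := by
    refine ⟨hmeas, ?_⟩
    rw [hasFiniteIntegral_iff_ofReal ((ae_restrict_iff' hS).2 (ae_of_all _ hnn))]
    exact lt_top_iff_ne_top.2 hXfin
  have hXint : X = ENNReal.ofReal (P * ∫ r in S, dens r * q r) := by
    rw [← integral_const_mul, ofReal_setIntegral_eq_lintegral hS hmeas hnn hXfin]
  have hI0 : 0 ≤ ∫ r in S, dens r * q r := by
    refine setIntegral_nonneg hS fun r hr => ?_
    exact (mul_nonneg_iff_of_pos_left hP).1 (hnn r hr)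
  refine ⟨?_, ?_⟩
  · have h := hint.const_mul P⁻¹
    refine h.congr (ae_of_all _ fun r => ?_)
    simp only
    rw [inv_mul_cancel_left₀ hP.ne']
  · have hU0 : μ U ≠ 0 := by
      rw [hμU]
      exact mul_ne_zero hc0 (by simpa using hP)
    have hcond : μ[|E.userEvent N c i] = μ[|U] := by
      rw [ProbabilityTheory.cond, ProbabilityTheory.cond, measure_congr hae,
        Measure.restrict_congr_set hae]
    have : IsProbabilityMeasure μ[|U] := cond_isProbabilityMeasure hU0
    have hcompl : {ω | E.sinr N T v c i ω < ENNReal.ofReal θ} = Bᶜ := by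
      ext ω; simp [hBdef]
    -- The association probability `λ_i / λ̄_i` and the class probability `P` cancel in the
    -- quotient.
    have hcB : μ[|U] B = ENNReal.ofReal (∫ r in S, dens r * q r) := by
      rw [cond_apply hUm, hμU, hμUB, hXint, ENNReal.ofReal_mul hP.le,
        ← mul_assoc (ENNReal.ofReal (N.lam i / N.lamBar i)), ← mul_assoc,
        ENNReal.inv_mul_cancel (mul_ne_zero hc0 (by simpa using hP))
          (ENNReal.mul_ne_top ENNReal.ofReal_ne_top ENNReal.ofReal_ne_top), one_mul]
    rw [outage, hcond, hcompl, probReal_compl_eq_one_sub hB, measureReal_def, hcB,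
      ENNReal.toReal_ofReal hI0]

end Model

end Elements

lemma expNeg_ofReal_mul_ofReal {x y : ℝ} (hx : 0 ≤ x) (hy : 0 ≤ y) :
    expNeg (ENNReal.ofReal x * ENNReal.ofReal y) = ENNReal.ofReal (Real.exp (-(x * y))) := by
  rw [← ENNReal.ofReal_mul hx, expNeg_ofReal (mul_nonneg hx hy)]

lemma prod_ofReal_mul_ofReal {ι : Type*} (s : Finset ι) {a b : ι → ℝ} (ha : ∀ k, 0 ≤ a k)
    (hb : ∀ k, 0 ≤ b k) :
    ∏ k ∈ s, ENNReal.ofReal (a k) * ENNReal.ofReal (b k) = ENNReal.ofReal (∏ k ∈ s, a k * b k) := by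
  rw [ENNReal.ofReal_prod_of_nonneg fun k _ => mul_nonneg (ha k) (hb k)]
  exact Finset.prod_congr rfl fun k _ => (ENNReal.ofReal_mul (ha k)).symm

/-! ### Closed forms of the conditional coverage -/

namespace Network

variable {K : ℕ} (N : Network K)

lemma ltUECentre_pos (η : ℝ) (k : Fin K) (s : ℝ) : 0 < N.ltUECentre η k s := Real.exp_pos _

lemma ltUEEdge_pos (η : ℝ) (k : Fin K) (s r : ℝ) : 0 < N.ltUEEdge η k s r := Real.exp_pos _

lemma ltUEEdgeSimple_pos (η : ℝ) (k : Fin K) (s r : ℝ) : 0 < N.ltUEEdgeSimple η k s r :=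
  Real.exp_pos _

lemma ltBSatBS_pos (k : Fin K) (s : ℝ) : 0 < N.ltBSatBS k s := Real.exp_pos _

lemma ltBSatUE_pos (i k : Fin K) (s r : ℝ) : 0 < N.ltBSatUE i k s r := Real.exp_pos _

lemma siFactorUL_nonneg (i : Fin K) (x : ℝ) : 0 ≤ N.siFactorUL i x :=
  integral_nonneg fun _ => (Real.exp_pos _).le

lemma siFactorDL_nonneg (T : FDCellular.Topology) (i : Fin K) (x : ℝ) :
    0 ≤ N.siFactorDL T i x := by
  cases T
  · exact integral_nonneg fun _ => (Real.exp_pos _).le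
  · exact zero_le_one

/-- Channel inversion cancels the path loss: the mean received power is `ρ` at every distance. -/
lemma scaleUL_ccu (i : Fin K) (θ : ℝ) {r : ℝ} (hr : r ∈ Set.Ioc 0 (N.edgeRadius i)) :
    N.scaleUL i θ r = θ / N.rho i := by
  rw [scaleUL, N.txPower_of_le i hr.1.le hr.2, mul_assoc, ← Real.rpow_add hr.1]
  simp

lemma scaleUL_ceu (i : Fin K) (θ : ℝ) {r : ℝ} (hr : N.edgeRadius i < r) :
    N.scaleUL i θ r = θ * r ^ N.etaDD / N.pU := by
  have hr0 := (N.edgeRadius_pos i).trans hr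
  have := N.pU_pos
  rw [scaleUL, N.txPower_of_lt i hr, Real.rpow_neg hr0.le]
  have := Real.rpow_pos_of_pos hr0 N.etaDD
  field_simp

lemma scaleDL_of_pos (i : Fin K) (θ : ℝ) {r : ℝ} (hr : 0 < r) :
    N.scaleDL i θ r = θ * r ^ N.etaDD / N.pD i := by
  rw [scaleDL, abs_of_pos hr]; ring

/-- The second UE belongs to the test cell, so its factor occurs once, at `k = i`. -/
lemma prod_ltIntraCell (T : FDCellular.Topology) (i : Fin K) (r : ℝ) (s : Fin K → ℝ) :
    ∏ k, N.ltIntraCell T i k r (s k) = N.ltIntraCell T i i r (s i) := by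
  rw [← Finset.mul_prod_erase _ _ (Finset.mem_univ i), Finset.prod_eq_one, mul_one]
  exact fun k hk => N.ltIntraCell_of_ne T (Finset.ne_of_mem_erase hk) _ _

/-- Conditional coverage probability of the uplink from the transforms `V` of the interference of
the UEs. -/
noncomputable def coverUL (i : Fin K) (σ : ℝ) (V : Fin K → ℝ) : ℝ :=
  Real.exp (-(σ * N.noise)) * N.siFactorUL i σ *
    ∏ k, V k * N.ltBSatBS k (σ * N.crossFactor .ul i k)

lemma coverUL_nonneg (i : Fin K) (σ : ℝ) {V : Fin K → ℝ} (hV : ∀ k, 0 ≤ V k) :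
    0 ≤ N.coverUL i σ V :=
  mul_nonneg (mul_nonneg (Real.exp_pos _).le (N.siFactorUL_nonneg i σ))
    (Finset.prod_nonneg fun k _ => mul_nonneg (hV k) (N.ltBSatBS_pos k _).le)

/-- All other factors are nonnegative, so smaller transforms of the UE interference lower the
coverage. -/
lemma coverUL_mono (i : Fin K) (σ : ℝ) {V V' : Fin K → ℝ} (hV : ∀ k, 0 ≤ V k)
    (h : ∀ k, V k ≤ V' k) : N.coverUL i σ V ≤ N.coverUL i σ V' :=
  mul_le_mul_of_nonneg_left (Finset.prod_le_prod
    (fun k _ => mul_nonneg (hV k) (N.ltBSatBS_pos k _).le)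
    fun k _ => mul_le_mul_of_nonneg_right (h k) (N.ltBSatBS_pos k _).le)
    (mul_nonneg (Real.exp_pos _).le (N.siFactorUL_nonneg i σ))

lemma ofReal_coverUL (i : Fin K) {σ : ℝ} (hσ : 0 ≤ σ) {V : Fin K → ℝ} (hV : ∀ k, 0 ≤ V k) :
    expNeg (ENNReal.ofReal σ * ENNReal.ofReal N.noise) *
      ((∏ k, ENNReal.ofReal (V k) * ENNReal.ofReal (N.ltBSatBS k (σ * N.crossFactor .ul i k))) *
        ENNReal.ofReal (N.siFactorUL i σ)) = ENNReal.ofReal (N.coverUL i σ V) := by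
  rw [expNeg_ofReal_mul_ofReal hσ N.noise_nonneg,
    prod_ofReal_mul_ofReal _ hV fun k => (N.ltBSatBS_pos k _).le, coverUL,
    ENNReal.ofReal_mul (mul_nonneg (Real.exp_pos _).le (N.siFactorUL_nonneg i σ)),
    ENNReal.ofReal_mul (Real.exp_pos _).le]
  ring

/-- Conditional coverage probability of the downlink from the transforms `V` of the interference of
the UEs. -/
noncomputable def coverDL (T : FDCellular.Topology) (i : Fin K) (σ r : ℝ) (V : Fin K → ℝ) : ℝ :=
  Real.exp (-(σ * N.noise)) * N.siFactorDL T i (σ * N.txPower i r) *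
    ∏ k, N.ltBSatUE i k (σ * N.intraFactor .dl i k) r *
      (V k * N.ltIntraCell T i k r (σ * N.crossFactor .dl i k))

lemma coverDL_nonneg (T : FDCellular.Topology) (i : Fin K) {σ r : ℝ} (hσ : 0 ≤ σ) (hr : 0 ≤ r)
    {V : Fin K → ℝ} (hV : ∀ k, 0 ≤ V k) : 0 ≤ N.coverDL T i σ r V :=
  mul_nonneg (mul_nonneg (Real.exp_pos _).le (N.siFactorDL_nonneg T i _))
    (Finset.prod_nonneg fun k _ => mul_nonneg (N.ltBSatUE_pos i k _ r).le (mul_nonneg (hV k)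
      (N.ltIntraCell_nonneg T i k (mul_nonneg hσ (N.crossFactor_nonneg _ _ _)) hr)))

lemma coverDL_mono (T : FDCellular.Topology) (i : Fin K) {σ r : ℝ} (hσ : 0 ≤ σ) (hr : 0 ≤ r)
    {V V' : Fin K → ℝ} (hV : ∀ k, 0 ≤ V k) (h : ∀ k, V k ≤ V' k) :
    N.coverDL T i σ r V ≤ N.coverDL T i σ r V' := by
  have h1 := fun k => N.ltIntraCell_nonneg T i k
    (mul_nonneg hσ (N.crossFactor_nonneg .dl i k)) hr
  exact mul_le_mul_of_nonneg_left (Finset.prod_le_prod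
    (fun k _ => mul_nonneg (N.ltBSatUE_pos i k _ r).le (mul_nonneg (hV k) (h1 k)))
    fun k _ => mul_le_mul_of_nonneg_left (mul_le_mul_of_nonneg_right (h k) (h1 k))
      (N.ltBSatUE_pos i k _ r).le)
    (mul_nonneg (Real.exp_pos _).le (N.siFactorDL_nonneg T i _))

lemma ofReal_coverDL (T : FDCellular.Topology) (i : Fin K) {σ r : ℝ} (hσ : 0 ≤ σ) (hr : 0 ≤ r)
    {V : Fin K → ℝ} (hV : ∀ k, 0 ≤ V k) :
    expNeg (ENNReal.ofReal σ * ENNReal.ofReal N.noise) *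
      ((∏ k, ENNReal.ofReal (N.ltBSatUE i k (σ * N.intraFactor .dl i k) r) *
        ENNReal.ofReal (V k)) * (ENNReal.ofReal (N.siFactorDL T i (σ * N.txPower i r)) *
        ENNReal.ofReal (N.ltIntraCell T i i r (σ * N.crossFactor .dl i i)))) =
      ENNReal.ofReal (N.coverDL T i σ r V) := by
  have h1 := fun k => N.ltIntraCell_nonneg T i k
    (mul_nonneg hσ (N.crossFactor_nonneg .dl i k)) hr
  have h2 := fun k => (N.ltBSatUE_pos i k (σ * N.intraFactor .dl i k) r).le
  have h3 := Finset.prod_nonneg fun k (_ : k ∈ Finset.univ) => mul_nonneg (h2 k) (hV k)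
  have h4 := N.siFactorDL_nonneg T i (σ * N.txPower i r)
  rw [expNeg_ofReal_mul_ofReal hσ N.noise_nonneg, prod_ofReal_mul_ofReal _ h2 hV,
    ← ENNReal.ofReal_mul h4, ← ENNReal.ofReal_mul h3, ← ENNReal.ofReal_mul (Real.exp_pos _).le,
    coverDL]
  simp_rw [← mul_assoc (N.ltBSatUE _ _ _ _)]
  rw [Finset.prod_mul_distrib (g := fun k => N.ltIntraCell T i k r (σ * N.crossFactor .dl i k)),
    N.prod_ltIntraCell T i r fun k => σ * N.crossFactor .dl i k]
  congr 1; ring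

lemma inClass_ccu_iff_mem (i : Fin K) {r : ℝ} (hr : 0 < r) :
    N.InClass .ccu i r ↔ r ∈ Set.Ioc 0 (N.edgeRadius i) :=
  (N.inClass_ccu_iff i hr.le).trans ⟨fun h => ⟨hr, h⟩, fun h => h.2⟩

lemma inClass_ceu_iff_mem (i : Fin K) {r : ℝ} (hr : 0 < r) :
    N.InClass .ceu i r ↔ r ∈ Set.Ioi (N.edgeRadius i) := by
  have h := N.inClass_ccu_iff i hr.le
  change N.pU < N.rho i * r ^ N.etaDD ↔ N.edgeRadius i < r
  rw [← not_le, h, not_le]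

lemma integral_densCCU (i : Fin K) : ∫ r in Set.Ioc 0 (N.edgeRadius i), N.densCCU i r = 1 := by
  have hP := N.probCCU_pos i
  have h1 : ∫ r in Set.Ioc 0 (N.edgeRadius i), N.probCCU i * N.densCCU i r =
      ∫ r in Set.Ioc 0 (N.edgeRadius i), N.distDensity i r :=
    setIntegral_congr_fun measurableSet_Ioc fun r hr =>
      N.probCCU_mul_densCCU i ⟨hr.1.le, hr.2⟩
  have h2 : ∫ r in Set.Ioc 0 (N.edgeRadius i), N.distDensity i r = N.probCCU i := by
    rw [integral_eq_lintegral_of_nonneg_ae, N.lintegral_Ioc_distDensity,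
      ENNReal.toReal_ofReal hP.le]
    · filter_upwards [ae_restrict_mem measurableSet_Ioc] with r hr
      exact N.distDensity_nonneg i hr.1.le
    · exact (N.continuous_distDensity i).aestronglyMeasurable
  rw [integral_const_mul, h2] at h1
  exact (mul_eq_left₀ hP.ne').1 h1

end Network

/-! ### The outage formulas -/

namespace Elements

section Model

variable {K : ℕ} {Ω : Type*} {mΩ : MeasurableSpace Ω} {μ : Measure Ω} {N : Network K}
  {E : Elements K Ω}

lemma indicator_one_le_one (S : Set ℝ) (r : ℝ) : S.indicator (1 : ℝ → ℝ≥0∞) r ≤ 1 :=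
  Set.indicator_le_self' (by simp) r

/-- The scaled threshold and the user transforms do not depend on the serving distance, so the
coverage factor is constant and the density integrates to one. -/
lemma IsModel.outage_ul_ccu [IsProbabilityMeasure μ] (hE : E.IsModel N μ)
    (T : FDCellular.Topology) (i : Fin K) {θ : ℝ} (hθ : 0 < θ) :
    E.outage N μ T .ul .ccu i θ = 1 - N.coverUL i (θ / N.rho i) fun k =>
      N.ltUECentre N.etaDD k (θ / N.rho i * N.intraFactor .ul i k) := by
  have hσ : 0 ≤ θ / N.rho i := (div_pos hθ (N.rho_pos i)).le
  obtain ⟨f, hf, hfr, hX⟩ := hE.lintegral_sinr_ul T .ccu i hθ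
    (φ := (Set.Ioc 0 (N.edgeRadius i)).indicator 1) (measurable_one.indicator measurableSet_Ioc)
  have h := hE.outage_eq T .ul .ccu i measurableSet_Ioc (fun r hr => hr.1)
    (fun r hr => N.inClass_ccu_iff_mem i hr) (N.probCCU_pos i)
    (fun r hr => N.probCCU_mul_densCCU i ⟨hr.1.le, hr.2⟩) (N.lintegral_Ioc_distDensity i) hf
    (q := fun _ => N.coverUL i (θ / N.rho i) fun k =>
      N.ltUECentre N.etaDD k (θ / N.rho i * N.intraFactor .ul i k))
    (fun r _ => N.coverUL_nonneg i _ fun k => (N.ltUECentre_pos _ _ _).le)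
    (fun r hr => by
      rw [hfr r hr.1, N.scaleUL_ccu i θ hr, ← N.ofReal_coverUL i hσ
        fun k => (N.ltUECentre_pos _ _ _).le]
      simp_rw [N.ueTransform_ccu N.etaDD_gt _ (mul_nonneg hσ (N.intraFactor_nonneg .ul i _))])
    hX
  rw [h.2, integral_mul_const, N.integral_densCCU, one_mul]

lemma IsModel.outage_ul_ceu [IsProbabilityMeasure μ] (hE : E.IsModel N μ)
    (T : FDCellular.Topology) (i : Fin K) {θ : ℝ} (hθ : 0 < θ) :
    IntegrableOn (fun r => N.densCEU i r * N.coverUL i (θ * r ^ N.etaDD / N.pU) fun k =>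
      N.ltUEEdge N.etaDD k (θ * r ^ N.etaDD / N.pU * N.intraFactor .ul i k) r)
      (Set.Ioi (N.edgeRadius i)) ∧
    E.outage N μ T .ul .ceu i θ = 1 - ∫ r in Set.Ioi (N.edgeRadius i),
      N.densCEU i r * N.coverUL i (θ * r ^ N.etaDD / N.pU) fun k =>
        N.ltUEEdge N.etaDD k (θ * r ^ N.etaDD / N.pU * N.intraFactor .ul i k) r := by
  obtain ⟨f, hf, hfr, hX⟩ := hE.lintegral_sinr_ul T .ceu i hθ
    (φ := (Set.Ioi (N.edgeRadius i)).indicator 1) (measurable_one.indicator measurableSet_Ioi)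
  have hpos : ∀ r ∈ Set.Ioi (N.edgeRadius i), 0 < r := fun r hr => (N.edgeRadius_pos i).trans hr
  exact hE.outage_eq T .ul .ceu i measurableSet_Ioi hpos
    (fun r hr => N.inClass_ceu_iff_mem i hr) (N.probCEU_pos i)
    (fun r hr => N.probCEU_mul_densCEU i hr) (N.lintegral_Ioi_distDensity i) hf
    (fun r _ => N.coverUL_nonneg i _ fun k => (N.ltUEEdge_pos _ _ _ _).le)
    (fun r hr => by
      have hr0 := hpos r hr
      have hσ := N.scaleUL_nonneg i hθ hr0
      rw [N.scaleUL_ceu i θ hr] at hσ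
      rw [hfr r hr0, N.scaleUL_ceu i θ hr, ← N.ofReal_coverUL i hσ
        fun k => (N.ltUEEdge_pos _ _ _ _).le]
      simp_rw [N.ueTransform_ceu N.etaDD_gt _ (mul_nonneg hσ (N.intraFactor_nonneg .ul i _)) hr0])
    hX

lemma IsModel.outage_dl_ccu [IsProbabilityMeasure μ] (hE : E.IsModel N μ)
    (T : FDCellular.Topology) (i : Fin K) {θ : ℝ} (hθ : 0 < θ) :
    E.outage N μ T .dl .ccu i θ = 1 - ∫ r in Set.Ioc 0 (N.edgeRadius i),
      N.densCCU i r * N.coverDL T i (θ * r ^ N.etaDD / N.pD i) r fun k =>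
        N.ltUECentre N.etaUD k (θ * r ^ N.etaDD / N.pD i * N.crossFactor .dl i k) := by
  obtain ⟨f, hf, hfr, hX⟩ := hE.lintegral_sinr_dl T .ccu i hθ
    (φ := (Set.Ioc 0 (N.edgeRadius i)).indicator 1) (measurable_one.indicator measurableSet_Ioc)
    (indicator_one_le_one _)
  have hσ : ∀ r, 0 < r → 0 ≤ θ * r ^ N.etaDD / N.pD i := fun r hr => by
    have := N.pD_pos i
    positivity
  exact (hE.outage_eq T .dl .ccu i measurableSet_Ioc (fun r hr => hr.1)
    (fun r hr => N.inClass_ccu_iff_mem i hr) (N.probCCU_pos i)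
    (fun r hr => N.probCCU_mul_densCCU i ⟨hr.1.le, hr.2⟩) (N.lintegral_Ioc_distDensity i) hf
    (fun r hr => N.coverDL_nonneg T i (hσ r hr.1) hr.1.le fun k => (N.ltUECentre_pos _ _ _).le)
    (fun r hr => by
      rw [hfr r hr.1, N.scaleDL_of_pos i θ hr.1, ← N.ofReal_coverDL T i (hσ r hr.1) hr.1.le
        fun k => (N.ltUECentre_pos _ _ _).le]
      simp_rw [N.ueTransform_ccu N.etaUD_gt _
        (mul_nonneg (hσ r hr.1) (N.crossFactor_nonneg .dl i _))])
    hX).2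

lemma IsModel.outage_dl_ceu [IsProbabilityMeasure μ] (hE : E.IsModel N μ)
    (T : FDCellular.Topology) (i : Fin K) {θ : ℝ} (hθ : 0 < θ) :
    IntegrableOn (fun r => N.densCEU i r * N.coverDL T i (θ * r ^ N.etaDD / N.pD i) r fun k =>
      N.ltUEEdge N.etaUD k (θ * r ^ N.etaDD / N.pD i * N.crossFactor .dl i k) r)
      (Set.Ioi (N.edgeRadius i)) ∧
    E.outage N μ T .dl .ceu i θ = 1 - ∫ r in Set.Ioi (N.edgeRadius i),
      N.densCEU i r * N.coverDL T i (θ * r ^ N.etaDD / N.pD i) r fun k =>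
        N.ltUEEdge N.etaUD k (θ * r ^ N.etaDD / N.pD i * N.crossFactor .dl i k) r := by
  obtain ⟨f, hf, hfr, hX⟩ := hE.lintegral_sinr_dl T .ceu i hθ
    (φ := (Set.Ioi (N.edgeRadius i)).indicator 1) (measurable_one.indicator measurableSet_Ioi)
    (indicator_one_le_one _)
  have hpos : ∀ r ∈ Set.Ioi (N.edgeRadius i), 0 < r := fun r hr => (N.edgeRadius_pos i).trans hr
  have hσ : ∀ r, 0 < r → 0 ≤ θ * r ^ N.etaDD / N.pD i := fun r hr => by
    have := N.pD_pos i
    positivity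
  exact hE.outage_eq T .dl .ceu i measurableSet_Ioi hpos
    (fun r hr => N.inClass_ceu_iff_mem i hr) (N.probCEU_pos i)
    (fun r hr => N.probCEU_mul_densCEU i hr) (N.lintegral_Ioi_distDensity i) hf
    (fun r hr => N.coverDL_nonneg T i (hσ r (hpos r hr)) (hpos r hr).le
      fun k => (N.ltUEEdge_pos _ _ _ _).le)
    (fun r hr => by
      have hr0 := hpos r hr
      rw [hfr r hr0, N.scaleDL_of_pos i θ hr0, ← N.ofReal_coverDL T i (hσ r hr0) hr0.le
        fun k => (N.ltUEEdge_pos _ _ _ _).le]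
      simp_rw [N.ueTransform_ceu N.etaUD_gt _
        (mul_nonneg (hσ r hr0) (N.crossFactor_nonneg .dl i _)) hr0])
    hX

/-- Lower coverage probabilities give an upper bound of the outage probability. -/
lemma outage_le_of_cover_le {o R : ℝ} {dens q q' : ℝ → ℝ}
    (h : IntegrableOn (fun r => dens r * q r) (Set.Ioi R) ∧
      o = 1 - ∫ r in Set.Ioi R, dens r * q r) (hd : ∀ r ∈ Set.Ioi R, 0 ≤ dens r)
    (hq' : ∀ r ∈ Set.Ioi R, 0 ≤ q' r) (hle : ∀ r ∈ Set.Ioi R, q' r ≤ q r) :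
    o ≤ 1 - ∫ r in Set.Ioi R, dens r * q' r := by
  rw [h.2]
  -- Integrability is needed only for the larger integrand, where it comes with the exact formula;
  -- nonnegativity suffices for the smaller one.
  refine sub_le_sub_left (integral_mono_of_nonneg ?_ h.1 ?_) 1
  · filter_upwards [ae_restrict_mem measurableSet_Ioi] with r hr
    exact mul_nonneg (hd r hr) (hq' r hr)
  · filter_upwards [ae_restrict_mem measurableSet_Ioi] with r hr
    exact mul_le_mul_of_nonneg_left (hle r hr) (hd r hr)

end Model

end Elements

end FDCellular

/-! ### Assembly in the stated normal form -/

theorem theorem1 {K : ℕ} (N : FDCellular.Network K) {Ω : Type*} [MeasurableSpace Ω]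
    (μ : MeasureTheory.Measure Ω) [MeasureTheory.IsProbabilityMeasure μ]
    (E : FDCellular.Elements K Ω) (hE : E.IsModel N μ)
    (T : FDCellular.Topology) (i : Fin K) (θ : ℝ) (hθ : 0 < θ) :
    -- uplink, cell-centre users
    E.outage N μ T .ul .ccu i θ =
      1 - Real.exp (-(N.noise * θ / N.rho i)) * N.siFactorUL i (θ / N.rho i) *
        ∏ k, N.ltUECentre N.etaDD k (θ * N.intraFactor .ul i k / N.rho i) *
          N.ltBSatBS k (θ * N.crossFactor .ul i k / N.rho i)
    ∧
    -- uplink, cell-edge users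
    E.outage N μ T .ul .ceu i θ =
      1 - ∫ r in Set.Ioi (N.edgeRadius i),
        Real.exp (-(N.noise * r ^ N.etaDD * θ / N.pU)) *
          N.siFactorUL i (θ * r ^ N.etaDD / N.pU) * N.densCEU i r *
          ∏ k, N.ltUEEdge N.etaDD k (r ^ N.etaDD * θ * N.intraFactor .ul i k / N.pU) r *
            N.ltBSatBS k (r ^ N.etaDD * θ * N.crossFactor .ul i k / N.pU)
    ∧
    -- uplink, cell-edge users, bound with the simplified transforms
    E.outage N μ T .ul .ceu i θ ≤
      1 - ∫ r in Set.Ioi (N.edgeRadius i),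
        Real.exp (-(N.noise * r ^ N.etaDD * θ / N.pU)) *
          N.siFactorUL i (θ * r ^ N.etaDD / N.pU) * N.densCEU i r *
          ∏ k, N.ltUEEdgeSimple N.etaDD k (r ^ N.etaDD * θ * N.intraFactor .ul i k / N.pU) r *
            N.ltBSatBS k (r ^ N.etaDD * θ * N.crossFactor .ul i k / N.pU)
    ∧
    -- downlink, cell-centre users
    E.outage N μ T .dl .ccu i θ =
      1 - ∫ r in (0 : ℝ)..N.edgeRadius i,
        Real.exp (-(N.noise * r ^ N.etaDD * θ / N.pD i)) *
          N.siFactorDL T i (θ * N.rho i * r ^ (2 * N.etaDD) / N.pD i) * N.densCCU i r *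
          ∏ k, N.ltBSatUE i k (r ^ N.etaDD * θ * N.intraFactor .dl i k / N.pD i) r *
            (N.ltUECentre N.etaUD k (r ^ N.etaDD * θ * N.crossFactor .dl i k / N.pD i) *
              N.ltIntraCell T i k r (r ^ N.etaDD * θ * N.crossFactor .dl i k / N.pD i))
    ∧
    -- downlink, cell-edge users
    E.outage N μ T .dl .ceu i θ =
      1 - ∫ r in Set.Ioi (N.edgeRadius i),
        Real.exp (-(N.noise * r ^ N.etaDD * θ / N.pD i)) *
          N.siFactorDL T i (θ * N.pU * r ^ N.etaDD / N.pD i) * N.densCEU i r *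
          ∏ k, N.ltBSatUE i k (r ^ N.etaDD * θ * N.intraFactor .dl i k / N.pD i) r *
            (N.ltUEEdge N.etaUD k (r ^ N.etaDD * θ * N.crossFactor .dl i k / N.pD i) r *
              N.ltIntraCell T i k r (r ^ N.etaDD * θ * N.crossFactor .dl i k / N.pD i))
    ∧
    -- downlink, cell-edge users, bound with the simplified transforms
    E.outage N μ T .dl .ceu i θ ≤
      1 - ∫ r in Set.Ioi (N.edgeRadius i),
        Real.exp (-(N.noise * r ^ N.etaDD * θ / N.pD i)) *
          N.siFactorDL T i (θ * N.pU * r ^ N.etaDD / N.pD i) * N.densCEU i r *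
          ∏ k, N.ltBSatUE i k (r ^ N.etaDD * θ * N.intraFactor .dl i k / N.pD i) r *
            (N.ltUEEdgeSimple N.etaUD k (r ^ N.etaDD * θ * N.crossFactor .dl i k / N.pD i) r *
              N.ltIntraCell T i k r (r ^ N.etaDD * θ * N.crossFactor .dl i k / N.pD i)) := by
  have hU := N.pU_pos
  have hD := N.pD_pos i
  have hpos : ∀ r ∈ Set.Ioi (N.edgeRadius i), 0 < r := fun r hr => (N.edgeRadius_pos i).trans hr
  have hdens : ∀ r ∈ Set.Ioi (N.edgeRadius i), 0 ≤ N.densCEU i r := fun r hr =>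
    (mul_nonneg_iff_of_pos_left (N.probCEU_pos i)).1
      ((N.probCEU_mul_densCEU i hr).symm ▸ N.distDensity_nonneg i (hpos r hr).le)
  have hσU : ∀ r ∈ Set.Ioi (N.edgeRadius i), 0 ≤ θ * r ^ N.etaDD / N.pU := fun r hr => by
    have := hpos r hr
    positivity
  have hσD : ∀ r ∈ Set.Ioi (N.edgeRadius i), 0 ≤ θ * r ^ N.etaDD / N.pD i := fun r hr => by
    have := hpos r hr
    positivity
  have hn : ∀ r P : ℝ, θ * r ^ N.etaDD / P * N.noise = N.noise * r ^ N.etaDD * θ / P :=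
    fun r P => by ring
  have hs : ∀ r P a : ℝ, θ * r ^ N.etaDD / P * a = r ^ N.etaDD * θ * a / P :=
    fun r P a => by ring
  refine ⟨?_, ?_, ?_, ?_, ?_, ?_⟩
  · rw [hE.outage_ul_ccu T i hθ, FDCellular.Network.coverUL]
    simp_rw [div_mul_eq_mul_div, mul_comm θ N.noise]
  · rw [(hE.outage_ul_ceu T i hθ).2]
    congr 1
    refine MeasureTheory.setIntegral_congr_fun measurableSet_Ioi fun r _ => ?_
    simp only [FDCellular.Network.coverUL, hn, hs]
    ring
  · refine (FDCellular.Elements.outage_le_of_cover_le (hE.outage_ul_ceu T i hθ) hdens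
      (q' := fun r => N.coverUL i (θ * r ^ N.etaDD / N.pU) fun k => N.ltUEEdgeSimple N.etaDD k
        (θ * r ^ N.etaDD / N.pU * N.intraFactor .ul i k) r)
      (fun r _ => N.coverUL_nonneg i _ fun k => (N.ltUEEdgeSimple_pos _ _ _ _).le)
      (fun r hr => N.coverUL_mono i _ (fun k => (N.ltUEEdgeSimple_pos _ _ _ _).le)
        fun k => N.ltUEEdgeSimple_le N.etaDD_gt k
          (mul_nonneg (hσU r hr) (N.intraFactor_nonneg _ _ _)) (hpos r hr))).trans_eq ?_
    congr 1
    refine MeasureTheory.setIntegral_congr_fun measurableSet_Ioi fun r _ => ?_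
    simp only [FDCellular.Network.coverUL, hn, hs]
    ring
  · rw [hE.outage_dl_ccu T i hθ, intervalIntegral.integral_of_le (N.edgeRadius_pos i).le]
    congr 1
    refine MeasureTheory.setIntegral_congr_fun measurableSet_Ioc fun r hr => ?_
    -- For a cell-centre user the self-interference carries the power `ρ r ^ η`, which doubles the
    -- exponent of `r`.
    have htx : θ * r ^ N.etaDD / N.pD i * N.txPower i r =
        θ * N.rho i * r ^ (2 * N.etaDD) / N.pD i := by
      rw [N.txPower_of_le i hr.1.le hr.2, two_mul, Real.rpow_add hr.1]
      ring
    simp only [FDCellular.Network.coverDL, htx, hn, hs]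
    ring
  · rw [(hE.outage_dl_ceu T i hθ).2]
    congr 1
    refine MeasureTheory.setIntegral_congr_fun measurableSet_Ioi fun r hr => ?_
    -- For a cell-edge user the transmit power is constantly `pU`, so the exponent of `r` is not
    -- doubled.
    have htx : θ * r ^ N.etaDD / N.pD i * N.txPower i r =
        θ * N.pU * r ^ N.etaDD / N.pD i := by
      rw [N.txPower_of_lt i hr]
      ring
    simp only [FDCellular.Network.coverDL, htx, hn, hs]
    ring
  · refine (FDCellular.Elements.outage_le_of_cover_le (hE.outage_dl_ceu T i hθ) hdens
      (q' := fun r => N.coverDL T i (θ * r ^ N.etaDD / N.pD i) r fun k =>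
        N.ltUEEdgeSimple N.etaUD k (θ * r ^ N.etaDD / N.pD i * N.crossFactor .dl i k) r)
      (fun r hr => N.coverDL_nonneg T i (hσD r hr) (hpos r hr).le
        fun k => (N.ltUEEdgeSimple_pos _ _ _ _).le)
      (fun r hr => N.coverDL_mono T i (hσD r hr) (hpos r hr).le
        (fun k => (N.ltUEEdgeSimple_pos _ _ _ _).le)
        fun k => N.ltUEEdgeSimple_le N.etaUD_gt k
          (mul_nonneg (hσD r hr) (N.crossFactor_nonneg _ _ _)) (hpos r hr))).trans_eq ?_
    congr 1
    refine MeasureTheory.setIntegral_congr_fun measurableSet_Ioi fun r hr => ?_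
    have htx : θ * r ^ N.etaDD / N.pD i * N.txPower i r =
        θ * N.pU * r ^ N.etaDD / N.pD i := by
      rw [N.txPower_of_lt i hr]
      ring
    simp only [FDCellular.Network.coverDL, htx, hn, hs]
    ring
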